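/- \textbf{Conventions.} A decision problem is a set of instances, represented injectively by words over a finite alphabet, with a distinguished set of yes-instances. Write $A\le_p B$ if there is a polynomial-time (Turing machine) computable map from instances of $A$ to instances of $B$ that preserves both yes- and no-instances. A polynomial in $\mathbb Z[x_1,\dots,x_d]$ is given explicitly as a sum of terms, each consisting of an integer coefficient and a vector of $d$ exponents, all written in binary, with $d$ in unary. Let $\mathrm{ETR}$ be the problem of deciding whether a sentence $\exists x_1\cdots\exists x_n\,\Phi(x_1,\dots,x_n)$ is true over $\mathbb R$, where $\Phi$ is a quantifier-free Boolean combination of polynomial equations and inequalities with integer coefficients. The class $\exists\mathbb R$ consists of all decision problems $A$ with $A\le_p\mathrm{ETR}$, and a decision problem $B$ is $\exists\mathbb R$-hard if $A\le_p B$ for every $A\in\exists\mathbb R$. For a fixed integer $k$, an instance of $\mathrm{CLSC}\text{-}k$ is a polynomial $f\in\mathbb Z[x_1,\dots,x_d]$ together with a rational threshold $\theta>0$; the question is whether $L_\theta=\{x\in\mathbb R^d : f(x)\ge\theta\}$ has at least $k$ connected components. \textbf{Theorem (Hardness of CLSC-$k$).} For every fixed $k\ge 2$, $\mathrm{CLSC}\text{-}k$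 is $\exists\mathbb R$-hard. Moreover, let $m\ge 0$, let $r\in\mathbb Z[y_1,\dots,y_m]$, and let $V(r)=\{y\in\mathbb R^m : r(y)=0\}$. \begin{enumerate} \item For the two-sheet polynomial $F(y,s)=1-\bigl[r(y)^2+(s^2-1)^2\bigr]$ one has $\{F\ge 1\}=V(r)\times\{1,-1\}$, and this set has at least $2$ connected components if and only if $V(r)\neq\varnothing$. \item For every $k\ge2$ and the polynomial $F_k=1-\sum_{i=1}^{k-1}\bigl[r(y^{(i)})^2+((s^{(i)})^2-1)^2\bigr]$ in $k-1$ independent copies of the variables $(y,s)$, one has $\{F_k\ge 1\}=(V(r)\times\{1,-1\})^{k-1}$. If $V(r)\ne\varnothing$, this set has at least $2^{k-1}$ connected components; and it has at least $k$ connected components if and only if $V(r)\neq\varnothing$. \end{enumerate} -/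

import Mathlib

namespace ContinuousClustering

/-! ### Decision problems, polynomial-time reductions -/

/-- A decision problem: instances, written as words over a finite alphabet, together with the
set of yes-instances. -/
structure DecisionProblem where
  /-- the instances -/
  Inst : Type
  /-- the alphabet -/
  Symb : Type
  /-- the alphabet is finite -/
  finSymb : Fintype Symb
  /-- the word that represents an instance -/
  encode : Inst → List Symb
  /-- a word represents at most one instance -/
  encode_injective : Function.Injective encode
  /-- the yes-instances -/
  Yes : Inst → Prop

/-- Polynomial-time many-one reducibility, by (multi-stack) Turing machines whose number of steps
is bounded by a polynomial in the length of the input word. -/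
def PolyTimeReducible (A B : DecisionProblem) : Prop :=
  ∃ f : A.Inst → B.Inst,
    Nonempty (Turing.TM2ComputableInPolyTime A.encode B.encode f) ∧
      ∀ a, A.Yes a ↔ B.Yes (f a)

/-! ### Explicit polynomials -/

/-- An explicit sum of monomials in `d` variables: each term is an integer coefficient together
with the vector of its `d` exponents. -/
abbrev PolyCode (d : ℕ) : Type := List (ℤ × (Fin d → ℕ))

/-- The polynomial in `ℤ[x₁, …, x_d]` that an explicit sum of monomials denotes. -/
noncomputable def PolyCode.toPoly {d : ℕ} (p : PolyCode d) : MvPolynomial (Fin d) ℤ :=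
  (p.map fun t => MvPolynomial.monomial (Finsupp.equivFunOnFinite.symm t.2) t.1).sum

/-- The alphabet in which instances are written. -/
inductive Sym : Type
  | bit (b : Bool)
  | tick
  | minus
  | sep
  | term
  | endPoly
  | eqZero
  | nonneg
  | pos
  | not
  | and
  | or
  deriving DecidableEq, Fintype

/-- Natural numbers in binary, closed by a separator. -/
def encNat (n : ℕ) : List Sym := (Computability.encodeNat n).map Sym.bit ++ [Sym.sep]

/-- Integers: a minus sign if negative, then the absolute value in binary. -/
def encInt (z : ℤ) : List Sym := (if z < 0 then [Sym.minus] else []) ++ encNat z.natAbs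

/-- Rational numbers: numerator, then denominator. -/
def encRat (q : ℚ) : List Sym := encInt q.num ++ encNat q.den

/-- The number of variables, in unary. -/
def encDim (d : ℕ) : List Sym := List.replicate d Sym.tick ++ [Sym.sep]

/-- A list of exponents, each in binary. -/
def encNats (l : List ℕ) : List Sym := l.flatMap encNat

/-- One term: its coefficient, then its `d` exponents, all in binary. -/
def encTerm {d : ℕ} (t : ℤ × (Fin d → ℕ)) : List Sym :=
  encInt t.1 ++ encNats (List.ofFn t.2)

/-- An explicit sum of monomials, term by term. -/
def encPoly {d : ℕ} (p : PolyCode d) : List Sym :=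
  p.flatMap (fun t => Sym.term :: encTerm t) ++ [Sym.endPoly]

/-! ### The existential theory of the reals -/

/-- Quantifier-free Boolean combinations of polynomial equations and inequalities with integer
coefficients, in `n` variables. (The relations `<`, `≤`, `≠` arise by changing the signs of the
coefficients and by negation.) -/
inductive QFFormula (n : ℕ) : Type
  | eqZero (p : PolyCode n)
  | nonneg (p : PolyCode n)
  | pos (p : PolyCode n)
  | not (φ : QFFormula n)
  | and (φ ψ : QFFormula n)
  | or (φ ψ : QFFormula n)

/-- Truth of a quantifier-free formula at a real point. -/
def QFFormula.Holds {n : ℕ} (x : Fin n → ℝ) : QFFormula n → Prop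
  | .eqZero p => MvPolynomial.aeval x p.toPoly = 0
  | .nonneg p => 0 ≤ MvPolynomial.aeval x p.toPoly
  | .pos p => 0 < MvPolynomial.aeval x p.toPoly
  | .not φ => ¬ φ.Holds x
  | .and φ ψ => φ.Holds x ∧ ψ.Holds x
  | .or φ ψ => φ.Holds x ∨ ψ.Holds x

/-- Formulas are written in prefix notation. -/
def encFormula {n : ℕ} : QFFormula n → List Sym
  | .eqZero p => Sym.eqZero :: encPoly p
  | .nonneg p => Sym.nonneg :: encPoly p
  | .pos p => Sym.pos :: encPoly p
  | .not φ => Sym.not :: encFormula φ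
  | .and φ ψ => Sym.and :: (encFormula φ ++ encFormula ψ)
  | .or φ ψ => Sym.or :: (encFormula φ ++ encFormula ψ)

/-- An existential sentence `∃ x₁ … ∃ x_n, Φ(x₁, …, x_n)`. -/
structure ExistsSentence where
  /-- the number of variables -/
  n : ℕ
  /-- the matrix -/
  matrix : QFFormula n

/-- The word of an existential sentence. -/
def encSentence (s : ExistsSentence) : List Sym := encDim s.n ++ encFormula s.matrix

/-! ### Super-level sets and their components -/

/-- The super-level set `{x | f(x) ≥ θ}`. -/
def superLevel {σ : Type} (f : MvPolynomial σ ℤ) (θ : ℝ) : Set (σ → ℝ) :=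
  {x | θ ≤ MvPolynomial.aeval x f}

/-- The number of connected components of a set, as a subspace. -/
noncomputable def numComponents {X : Type} [TopologicalSpace X] (S : Set X) : ℕ∞ :=
  ENat.card (ConnectedComponents S)

/-- An instance of component counting: an explicit polynomial with integer coefficients and a
positive rational threshold. -/
structure LevelInstance where
  /-- the number of variables -/
  d : ℕ
  /-- the polynomial -/
  f : PolyCode d
  /-- the threshold -/
  θ : ℚ
  /-- the threshold is positive -/
  θ_pos : 0 < θ

/-- The word of an instance of component counting. -/
def encLevel (i : LevelInstance) : List Sym := encDim i.d ++ encRat i.θ ++ encPoly i.f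

/-! ### Unique readability of the encodings -/

theorem encDim_read {a b : ℕ} {s t : List Sym} (h : encDim a ++ s = encDim b ++ t) :
    a = b ∧ s = t := by
  induction a generalizing b with
  | zero =>
    cases b with
    | zero => simpa [encDim] using h
    | succ b => simp [encDim, List.replicate_succ] at h
  | succ a ih =>
    cases b with
    | zero => simp [encDim, List.replicate_succ] at h
    | succ b =>
      have h' : encDim a ++ s = encDim b ++ t := by
        simpa [encDim, List.replicate_succ] using h
      obtain ⟨h1, h2⟩ := ih h'
      exact ⟨by rw [h1], h2⟩

theorem bits_read {a b : List Bool} {s t : List Sym}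
    (h : a.map Sym.bit ++ Sym.sep :: s = b.map Sym.bit ++ Sym.sep :: t) : a = b ∧ s = t := by
  induction a generalizing b with
  | nil => cases b <;> simp_all
  | cons x a ih =>
    cases b with
    | nil => simp at h
    | cons y b =>
      simp only [List.map_cons, List.cons_append, List.cons.injEq, Sym.bit.injEq] at h
      obtain ⟨h1, h2⟩ := ih h.2
      exact ⟨by rw [h.1, h1], h2⟩

theorem encNat_read {a b : ℕ} {s t : List Sym} (h : encNat a ++ s = encNat b ++ t) :
    a = b ∧ s = t := by
  obtain ⟨h1, h2⟩ := bits_read (a := Computability.encodeNat a) (b := Computability.encodeNat b)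
    (s := s) (t := t) (by simpa [encNat] using h)
  refine ⟨?_, h2⟩
  rw [← Computability.decode_encodeNat a, ← Computability.decode_encodeNat b, h1]

theorem encNat_head {n : ℕ} {s t : List Sym} : encNat n ++ s ≠ Sym.minus :: t := by
  unfold encNat
  cases Computability.encodeNat n <;> simp

theorem encInt_read {a b : ℤ} {s t : List Sym} (h : encInt a ++ s = encInt b ++ t) :
    a = b ∧ s = t := by
  unfold encInt at h
  by_cases ha : a < 0 <;> by_cases hb : b < 0
  · simp only [ha, hb, if_true, List.cons_append, List.nil_append, List.cons.injEq,
      true_and] at h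
    obtain ⟨h1, h2⟩ := encNat_read h
    exact ⟨by omega, h2⟩
  · simp only [ha, hb, if_true, if_false, List.cons_append, List.nil_append] at h
    exact absurd h.symm encNat_head
  · simp only [ha, hb, if_true, if_false, List.cons_append, List.nil_append] at h
    exact absurd h encNat_head
  · simp only [ha, hb, if_false, List.nil_append] at h
    obtain ⟨h1, h2⟩ := encNat_read h
    exact ⟨by omega, h2⟩

theorem encRat_read {a b : ℚ} {s t : List Sym} (h : encRat a ++ s = encRat b ++ t) :
    a = b ∧ s = t := by
  unfold encRat at h
  rw [List.append_assoc, List.append_assoc] at h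
  obtain ⟨h1, h2⟩ := encInt_read h
  obtain ⟨h3, h4⟩ := encNat_read h2
  exact ⟨Rat.ext h1 h3, h4⟩

theorem encNats_read {a b : List ℕ} (hl : a.length = b.length) {s t : List Sym}
    (h : encNats a ++ s = encNats b ++ t) : a = b ∧ s = t := by
  induction a generalizing b with
  | nil =>
    cases b with
    | nil => simpa [encNats] using h
    | cons y b => simp at hl
  | cons x a ih =>
    cases b with
    | nil => simp at hl
    | cons y b =>
      simp only [encNats, List.flatMap_cons, List.append_assoc] at h
      obtain ⟨h1, h2⟩ := encNat_read h
      obtain ⟨h3, h4⟩ := ih (by simpa using hl) h2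
      exact ⟨by rw [h1, h3], h4⟩

theorem encTerm_read {d : ℕ} {a b : ℤ × (Fin d → ℕ)} {s t : List Sym}
    (h : encTerm a ++ s = encTerm b ++ t) : a = b ∧ s = t := by
  unfold encTerm at h
  rw [List.append_assoc, List.append_assoc] at h
  obtain ⟨h1, h2⟩ := encInt_read h
  obtain ⟨h3, h4⟩ := encNats_read (by simp) h2
  exact ⟨Prod.ext h1 (List.ofFn_injective h3), h4⟩

theorem encPoly_read {d : ℕ} {a b : PolyCode d} {s t : List Sym}
    (h : encPoly a ++ s = encPoly b ++ t) : a = b ∧ s = t := by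
  induction a generalizing b with
  | nil =>
    cases b with
    | nil => simpa [encPoly] using h
    | cons y b => simp [encPoly] at h
  | cons x a ih =>
    cases b with
    | nil => simp [encPoly] at h
    | cons y b =>
      have h' : encTerm x ++ (encPoly a ++ s) = encTerm y ++ (encPoly b ++ t) := by
        simpa [encPoly] using h
      obtain ⟨h1, h2⟩ := encTerm_read h'
      obtain ⟨h3, h4⟩ := ih h2
      exact ⟨by rw [h1, h3], h4⟩

theorem encFormula_read {n : ℕ} {a b : QFFormula n} {s t : List Sym}
    (h : encFormula a ++ s = encFormula b ++ t) : a = b ∧ s = t := by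
  induction a generalizing b s t with
  | eqZero p | nonneg p | pos p =>
    cases b <;> simp [encFormula] at h
    obtain ⟨h1, h2⟩ := encPoly_read h
    exact ⟨by rw [h1], h2⟩
  | not φ ih =>
    cases b <;> simp [encFormula] at h
    obtain ⟨h1, h2⟩ := ih h
    exact ⟨by rw [h1], h2⟩
  | and φ ψ ih1 ih2 | or φ ψ ih1 ih2 =>
    cases b <;> simp [encFormula] at h
    obtain ⟨h1, h2⟩ := ih1 h
    obtain ⟨h3, h4⟩ := ih2 h2
    exact ⟨by rw [h1, h3], h4⟩

theorem encSentence_injective : Function.Injective encSentence := by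
  rintro ⟨n, φ⟩ ⟨m, ψ⟩ h
  obtain ⟨h1, h2⟩ := encDim_read h
  dsimp only at h1 h2
  subst h1
  obtain ⟨h3, -⟩ := encFormula_read (s := []) (t := []) (by simpa using h2)
  rw [h3]

theorem encLevel_injective : Function.Injective encLevel := by
  rintro ⟨d, f, θ, hθ⟩ ⟨d', f', θ', hθ'⟩ h
  unfold encLevel at h
  rw [List.append_assoc, List.append_assoc] at h
  obtain ⟨h1, h2⟩ := encDim_read h
  dsimp only at h1 h2
  subst h1
  obtain ⟨h3, h4⟩ := encRat_read h2
  subst h3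
  obtain ⟨h5, -⟩ := encPoly_read (s := []) (t := []) (by simpa using h4)
  rw [h5]

/-! ### The class `∃ℝ` and the problem CLSC-`k` -/

/-- The existential theory of the reals, as a decision problem. -/
def ETR : DecisionProblem where
  Inst := ExistsSentence
  Symb := Sym
  finSymb := inferInstance
  encode := encSentence
  encode_injective := encSentence_injective
  Yes s := ∃ x : Fin s.n → ℝ, s.matrix.Holds x

/-- Membership in the class `∃ℝ`. -/
def InExistsR (A : DecisionProblem) : Prop := PolyTimeReducible A ETR

/-- Hardness for the class `∃ℝ`. -/
def ExistsRHard (B : DecisionProblem) : Prop :=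
  ∀ A : DecisionProblem, InExistsR A → PolyTimeReducible A B

/-- CLSC-`k`: does `{x ∈ ℝ^d | f(x) ≥ θ}` have at least `k` connected components? -/
def CLSC (k : ℕ) : DecisionProblem where
  Inst := LevelInstance
  Symb := Sym
  finSymb := inferInstance
  encode := encLevel
  encode_injective := encLevel_injective
  Yes i := (k : ℕ∞) ≤ numComponents (superLevel i.f.toPoly (i.θ : ℝ))

/-! ### The two-sheet polynomial -/

/-- The penalty `r(y)² + (s² - 1)²` in the variables `y` (indices `some j`) and `s` (index
`none`). -/
noncomputable def sheetPenalty {m : ℕ} (r : MvPolynomial (Fin m) ℤ) :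
    MvPolynomial (Option (Fin m)) ℤ :=
  MvPolynomial.rename some r ^ 2 + (MvPolynomial.X none ^ 2 - 1) ^ 2

/-- The two-sheet polynomial `1 - [r(y)² + (s² - 1)²]`. -/
noncomputable def twoSheet {m : ℕ} (r : MvPolynomial (Fin m) ℤ) :
    MvPolynomial (Option (Fin m)) ℤ :=
  1 - sheetPenalty r

/-- The polynomial `1 - ∑ᵢ [r(y⁽ⁱ⁾)² + ((s⁽ⁱ⁾)² - 1)²]` on `n` independent copies of the
variables. -/
noncomputable def twoSheetCopies (n : ℕ) {m : ℕ} (r : MvPolynomial (Fin m) ℤ) :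
    MvPolynomial (Fin n × Option (Fin m)) ℤ :=
  1 - ∑ i : Fin n, MvPolynomial.rename (fun v => (i, v)) (sheetPenalty r)

/-- The real zero set `V(r)`. -/
def realZeros {m : ℕ} (r : MvPolynomial (Fin m) ℤ) : Set (Fin m → ℝ) :=
  {y | MvPolynomial.aeval y r = 0}

/-- The set `V(r) × {1, -1}`, the last coordinate being the one with index `none`. -/
def sheets {m : ℕ} (r : MvPolynomial (Fin m) ℤ) : Set (Option (Fin m) → ℝ) :=
  {x | (fun j => x (some j)) ∈ realZeros r ∧ (x none = 1 ∨ x none = -1)}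

end ContinuousClustering

/-! Hardness compiles an existential sentence into one polynomial that simulates an evaluation along
the word of the sentence. Annotate each letter by its role (`roleWord`), enclose the word between
`start` and `finish`, and attach three real registers to every letter; a word of length L gives 3L
variables. Each letter imposes polynomial equations on its own registers and on those of at most
three other letters: the next one, the beginning of the second operand of a connective, and the
variable to which an exponent bit belongs (`equations`). Read from right to left they evaluate the
formula: coefficients by Horner's scheme and powers by repeated squaring, so that binary exponents
cost only a few variables per bit. An atom receives a truth value in {0, 1}, certified by an inverse
or a square root, and connectives become arithmetic. The letter that closes the list of variables
demands the truth value 1. The first registers of the ticks are the quantified variables.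
`exists_allOK` solves the equations of the formula for any values of the variables, and
`sound_formula` shows that every solution carries the correct truth value.

Let r be the first register of `start`. The polynomial is 1 - (∏_{j<k} (r - j))² minus the squares
of all equations, so it is at least 1 exactly where every penalty vanishes. Nothing else constrains
r. If the sentence is false the super-level set is empty; if it is true, r maps the set continuously
onto the discrete set {0, …, k - 1}, which forces at least k components (`card_le_numComponents`,
`reduction_correct`). The statements on two-sheet polynomials are proved independently by the same
principle, with the signs s⁽ⁱ⁾ as the continuous discrete-valued map. The reduction does not pass
through them.

For polynomial time, machines must be composed (`PolyTime.comp`): each step pushes a bounded number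
of letters, so the intermediate word has polynomial length. The reduction is a chain of four passes:
annotate the letters; copy the word once for every position and every monomial index, with that
position marked (`Spread`); scan each copy to the right for the next letter and the second operand;
scan it back to the left for the variable while writing the exponents. All but the copying are
finite-state transducers with one counter. The counter first tracks the operands outstanding in
prefix notation, and in the last pass the index of the variable. -/

namespace Turing

open StateTransition Function

/-! ### Runs of bounded length -/

/-- `f` leads from `a` to `b` in at most `t` steps. -/
def RunsIn {σ : Type*} (f : σ → Option σ) (t : ℕ) (a b : σ) : Prop :=
  ∃ n ≤ t, (flip bind f)^[n] (some a) = some b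

namespace RunsIn

variable {σ τ : Type*} {f : σ → Option σ}

theorem refl (a : σ) : RunsIn f 0 a a := ⟨0, le_rfl, rfl⟩

theorem mono {s t : ℕ} {a b : σ} (h : RunsIn f s a b) (hst : s ≤ t) : RunsIn f t a b := by
  obtain ⟨n, hn, e⟩ := h
  exact ⟨n, hn.trans hst, e⟩

theorem trans {s t : ℕ} {a b c : σ} (h : RunsIn f s a b) (h' : RunsIn f t b c) :
    RunsIn f (s + t) a c := by
  obtain ⟨n, hn, e⟩ := h
  obtain ⟨m, hm, e'⟩ := h'
  refine ⟨m + n, by omega, ?_⟩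
  rw [iterate_add_apply, e, e']

theorem head {t : ℕ} {a b c : σ} (h : f a = some b) (h' : RunsIn f t b c) :
    RunsIn f (t + 1) a c := by
  obtain ⟨n, hn, e⟩ := h'
  refine ⟨n + 1, by omega, ?_⟩
  rw [iterate_succ_apply]
  have : flip bind f (some a) = some b := h
  rw [this, e]

theorem iterate_none (n : ℕ) : (flip bind f)^[n] none = none := by
  induction n with
  | zero => rfl
  | succ n ih => rw [iterate_succ_apply]; exact ih

theorem iterate_succ_some {n : ℕ} {a b : σ} (h : (flip bind f)^[n + 1] (some a) = some b) :
    ∃ a', f a = some a' ∧ (flip bind f)^[n] (some a') = some b := by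
  rw [iterate_succ_apply] at h
  have e : flip bind f (some a) = f a := rfl
  rw [e] at h
  cases h' : f a with
  | none => rw [h', iterate_none] at h; cases h
  | some a' => rw [h'] at h; exact ⟨a', rfl, h⟩

/-- Runs are transported along a map that commutes with steps. -/
theorem map {g : τ → Option τ} (φ : σ → τ) (hφ : ∀ a a', f a = some a' → g (φ a) = some (φ a'))
    {t : ℕ} {a b : σ} (h : RunsIn f t a b) : RunsIn g t (φ a) (φ b) := by
  obtain ⟨n, hn, e⟩ := h
  refine mono ?_ hn
  clear hn
  induction n generalizing a with
  | zero =>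
    have : a = b := Option.some.inj e
    rw [this]
    exact refl _
  | succ n ih =>
    obtain ⟨a', h1, h2⟩ := iterate_succ_some e
    exact head (hφ _ _ h1) (ih h2)

/-- A quantity that grows by at most `c` in every step grows by at most `c * t` in a run. -/
theorem growth (size : σ → ℕ) (c : ℕ) (hc : ∀ a a', f a = some a' → size a' ≤ size a + c)
    {t : ℕ} {a b : σ} (h : RunsIn f t a b) : size b ≤ size a + c * t := by
  obtain ⟨n, hn, e⟩ := h
  have key : size b ≤ size a + c * n := by
    clear hn
    induction n generalizing a with
    | zero =>
      have : a = b := Option.some.inj e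
      rw [this]; omega
    | succ n ih =>
      obtain ⟨a', h1, h2⟩ := iterate_succ_some e
      have := ih h2
      have := hc _ _ h1
      rw [Nat.mul_succ]; omega
  exact key.trans (by gcongr)

end RunsIn

theorem initList_eq (tm : FinTM2) (s : List (tm.Γ tm.k₀)) :
    initList tm s = ⟨some tm.main, tm.initialState, update (fun _ => []) tm.k₀ s⟩ := by
  unfold initList
  congr 1
  funext k
  by_cases h : k = tm.k₀
  · subst h; simp
  · simp [h]

theorem haltList_eq (tm : FinTM2) (s : List (tm.Γ tm.k₁)) :
    haltList tm s = ⟨none, tm.initialState, update (fun _ => []) tm.k₁ s⟩ := by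
  unfold haltList
  congr 1
  funext k
  by_cases h : k = tm.k₁
  · subst h; simp
  · simp [h]

/-- Computability in polynomial time, as a proposition. -/
def PolyTime {α β αΓ βΓ : Type} (ea : α → List αΓ) (eb : β → List βΓ) (f : α → β) : Prop :=
  Nonempty (TM2ComputableInPolyTime ea eb f)

theorem PolyTime.of_runsIn {α β αΓ βΓ : Type} {ea : α → List αΓ} {eb : β → List βΓ} {f : α → β}
    (tm : FinTM2) (e₀ : tm.Γ tm.k₀ ≃ αΓ) (e₁ : tm.Γ tm.k₁ ≃ βΓ) (p : Polynomial ℕ)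
    (h : ∀ a, RunsIn (TM2.step tm.m) (p.eval (ea a).length)
      ⟨some tm.main, tm.initialState, update (fun _ => []) tm.k₀ ((ea a).map e₀.symm)⟩
      ⟨none, tm.initialState, update (fun _ => []) tm.k₁ ((eb (f a)).map e₁.symm)⟩) :
    PolyTime ea eb f := by
  refine ⟨⟨⟨tm, e₀, e₁⟩, p, fun a => ?_⟩⟩
  refine { steps := (h a).choose, evals_in_steps := ?_, steps_le_m := (h a).choose_spec.1 }
  rw [initList_eq, Option.map_some, haltList_eq]
  exact (h a).choose_spec.2

theorem TM2ComputableInPolyTime.runsIn {α β αΓ βΓ : Type} {ea : α → List αΓ} {eb : β → List βΓ}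
    {f : α → β} (h : TM2ComputableInPolyTime ea eb f) (a : α) :
    RunsIn (TM2.step h.tm.m) (h.time.eval (ea a).length)
      ⟨some h.tm.main, h.tm.initialState,
        update (fun _ => []) h.tm.k₀ ((ea a).map h.inputAlphabet.symm)⟩
      ⟨none, h.tm.initialState,
        update (fun _ => []) h.tm.k₁ ((eb (f a)).map h.outputAlphabet.symm)⟩ := by
  obtain ⟨⟨n, e⟩, hn⟩ := h.outputsFun a
  refine ⟨n, hn, ?_⟩
  rw [initList_eq, Option.map_some, haltList_eq] at e
  exact e

/-! ### Growth of the stacks -/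

/-- The number of `push` instructions of a statement. -/
def TM2.Stmt.pushes {K : Type*} {Γ : K → Type*} {Λ σ : Type*} : TM2.Stmt Γ Λ σ → ℕ
  | .push _ _ q => q.pushes + 1
  | .peek _ _ q => q.pushes
  | .pop _ _ q => q.pushes
  | .load _ q => q.pushes
  | .branch _ q₁ q₂ => q₁.pushes + q₂.pushes
  | .goto _ => 0
  | .halt => 0

/-- One step executes one path through the statement, and `pushes` adds up both sides of a branch,
so it bounds the pushes along every path. -/
theorem TM2.stepAux_length {K : Type*} [DecidableEq K] {Γ : K → Type*} {Λ σ : Type*}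
    (q : TM2.Stmt Γ Λ σ) (v : σ) (S : ∀ k, List (Γ k)) (k : K) :
    ((TM2.stepAux q v S).stk k).length ≤ (S k).length + q.pushes := by
  induction q generalizing v S with
  | push k' f q ih =>
    refine (ih _ _).trans ?_
    by_cases h : k = k'
    · subst h; simp [TM2.Stmt.pushes]; omega
    · simp [h, TM2.Stmt.pushes]
  | peek k' f q ih => exact ih _ _
  | pop k' f q ih =>
    refine (ih _ _).trans ?_
    by_cases h : k = k'
    · subst h; simp [TM2.Stmt.pushes]
    · simp [h, TM2.Stmt.pushes]
  | load f q ih => exact ih _ _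
  | branch p q₁ q₂ ih₁ ih₂ =>
    simp only [TM2.stepAux, TM2.Stmt.pushes]
    cases p v
    · exact (ih₂ _ _).trans (by omega)
    · exact (ih₁ _ _).trans (by omega)
  | goto l => simp [TM2.stepAux, TM2.Stmt.pushes]
  | halt => simp [TM2.stepAux, TM2.Stmt.pushes]

/-- There are finitely many labels, so the number of pushes per step has a uniform bound c, and the
output stack cannot outgrow c times the running time. Composition needs this to bound the input of
the second machine. -/
theorem TM2ComputableInPolyTime.exists_length_le {α β αΓ βΓ : Type} {ea : α → List αΓ}
    {eb : β → List βΓ} {f : α → β} (h : TM2ComputableInPolyTime ea eb f) :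
    ∃ c : ℕ, ∀ a, (eb (f a)).length ≤ (ea a).length + c * h.time.eval (ea a).length := by
  let _ := h.tm.ΛFin
  refine ⟨Finset.univ.sup fun l => (h.tm.m l).pushes, fun a => ?_⟩
  have := (h.runsIn a).growth (fun c => (c.stk h.tm.k₁).length)
    (Finset.univ.sup fun l => (h.tm.m l).pushes) (by
      rintro ⟨l, v, S⟩ c' hc
      cases l with
      | none => simp at hc
      | some l =>
        simp only [TM2.step, Option.some.injEq] at hc
        subst hc
        refine (TM2.stepAux_length _ _ _ _).trans ?_
        have := Finset.le_sup (f := fun l => (h.tm.m l).pushes) (Finset.mem_univ l)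
        simpa using this)
  simp only [update_self, List.length_map] at this
  refine this.trans ?_
  gcongr
  -- The output stack may be the input stack, in which case it starts with the input word; this is
  -- the source of the summand `(ea a).length`.
  by_cases e : h.tm.k₁ = h.tm.k₀
  · rw [e]; simp
  · simp [e]

end Turing

namespace Turing

open StateTransition Function

/-! ### Composition of machines -/

namespace Comp

/-- The stack alphabets of the composite machine: those of the two machines and, between them, a
stack for the word that is handed over. -/
abbrev StackAlphabet {K₁ K₂ : Type} (Γ₁ : K₁ → Type) (B : Type) (Γ₂ : K₂ → Type) :
    K₁ ⊕ (Unit ⊕ K₂) → Type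
  | .inl k => Γ₁ k
  | .inr (.inl _) => B
  | .inr (.inr k) => Γ₂ k

variable {K₁ K₂ : Type} {Γ₁ : K₁ → Type} {B : Type} {Γ₂ : K₂ → Type}
  {Λ₁ Λ₂ σ₁ σ₂ : Type}

/-- Labels of the composite machine: those of the two machines, and labels of the two loops that
hand over the word. -/
abbrev Label (Λ₁ B Λ₂ : Type) := Λ₁ ⊕ ((Option B ⊕ Option B) ⊕ Λ₂)

/-- Internal states of the composite machine. -/
abbrev State (σ₁ σ₂ B : Type) := σ₁ × σ₂ × Option B

/-- The stacks of the composite machine. -/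
def contents (S : ∀ k, List (Γ₁ k)) (l : List B) (T : ∀ k, List (Γ₂ k)) :
    ∀ k, List (StackAlphabet Γ₁ B Γ₂ k)
  | .inl k => S k
  | .inr (.inl _) => l
  | .inr (.inr k) => T k

theorem contents_nil :
    contents (Γ₁ := Γ₁) (B := B) (Γ₂ := Γ₂) (fun _ => []) [] (fun _ => []) = fun _ => [] := by
  funext k
  rcases k with k | k | k <;> rfl

section

variable [DecidableEq K₁] [DecidableEq K₂]

theorem update_contents_fst (S : ∀ k, List (Γ₁ k)) (l : List B) (T : ∀ k, List (Γ₂ k)) (k : K₁)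
    (x : List (Γ₁ k)) :
    update (contents S l T) (.inl k) x = contents (update S k x) l T := by
  funext k'
  rcases k' with k' | k' | k'
  · by_cases h : k' = k
    · subst h; simp [contents]
    · have : (Sum.inl k' : K₁ ⊕ (Unit ⊕ K₂)) ≠ .inl k := by simpa using h
      rw [update_of_ne this]; simp [contents, h]
  · rfl
  · rfl

theorem update_contents_snd (S : ∀ k, List (Γ₁ k)) (l : List B) (T : ∀ k, List (Γ₂ k)) (k : K₂)
    (x : List (Γ₂ k)) :
    update (contents S l T) (.inr (.inr k)) x = contents S l (update T k x) := by
  funext k'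
  rcases k' with k' | k' | k'
  · rfl
  · rfl
  · by_cases h : k' = k
    · subst h; simp [contents]
    · have : (Sum.inr (Sum.inr k') : K₁ ⊕ (Unit ⊕ K₂)) ≠ .inr (.inr k) := by simpa using h
      rw [update_of_ne this]; simp [contents, h]

theorem update_contents_mid (S : ∀ k, List (Γ₁ k)) (l : List B) (T : ∀ k, List (Γ₂ k))
    (x : List B) :
    update (contents S l T) (.inr (.inl ())) x = contents S x T := by
  funext k'
  rcases k' with k' | k' | k' <;> rfl

end

/-- Statements of the first machine; instead of halting, it starts to hand over. -/
def liftFst : TM2.Stmt Γ₁ Λ₁ σ₁ →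
    TM2.Stmt (StackAlphabet Γ₁ B Γ₂) (Label Λ₁ B Λ₂) (State σ₁ σ₂ B)
  | .push k f q => .push (.inl k) (fun v => f v.1) (liftFst q)
  | .peek k f q => .peek (.inl k) (fun v s => (f v.1 s, v.2)) (liftFst q)
  | .pop k f q => .pop (.inl k) (fun v s => (f v.1 s, v.2)) (liftFst q)
  | .load f q => .load (fun v => (f v.1, v.2)) (liftFst q)
  | .branch f q₁ q₂ => .branch (fun v => f v.1) (liftFst q₁) (liftFst q₂)
  | .goto f => .goto fun v => .inl (f v.1)
  | .halt => .goto fun _ => .inr (.inl (.inl none))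

/-- Statements of the second machine. -/
def liftSnd : TM2.Stmt Γ₂ Λ₂ σ₂ →
    TM2.Stmt (StackAlphabet Γ₁ B Γ₂) (Label Λ₁ B Λ₂) (State σ₁ σ₂ B)
  | .push k f q => .push (.inr (.inr k)) (fun v => f v.2.1) (liftSnd q)
  | .peek k f q => .peek (.inr (.inr k)) (fun v s => (v.1, f v.2.1 s, v.2.2)) (liftSnd q)
  | .pop k f q => .pop (.inr (.inr k)) (fun v s => (v.1, f v.2.1 s, v.2.2)) (liftSnd q)
  | .load f q => .load (fun v => (v.1, f v.2.1, v.2.2)) (liftSnd q)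
  | .branch f q₁ q₂ => .branch (fun v => f v.2.1) (liftSnd q₁) (liftSnd q₂)
  | .goto f => .goto fun v => .inr (.inr (f v.2.1))
  | .halt => .halt

/-- The program of the composite machine, which hands over the word on stack `k₁` of the first
machine to stack `k₀` of the second one, where it enters at `main`. -/
def program (M₁ : Λ₁ → TM2.Stmt Γ₁ Λ₁ σ₁) (M₂ : Λ₂ → TM2.Stmt Γ₂ Λ₂ σ₂) (k₁ : K₁) (k₀ : K₂)
    (d : Γ₁ k₁ → B) (e : B → Γ₂ k₀) (main : Λ₂) :
    Label Λ₁ B Λ₂ → TM2.Stmt (StackAlphabet Γ₁ B Γ₂) (Label Λ₁ B Λ₂) (State σ₁ σ₂ B)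
  | .inl l => liftFst (M₁ l)
  | .inr (.inl (.inl none)) =>
    .pop (.inl k₁) (fun v (s : Option (Γ₁ k₁)) => (v.1, v.2.1, s.map d)) <|
      .goto fun v => if v.2.2.isSome then .inr (.inl (.inl v.2.2)) else .inr (.inl (.inr none))
  | .inr (.inl (.inl (some b))) =>
    .push (.inr (.inl ())) (fun _ => b) <| .goto fun _ => .inr (.inl (.inl none))
  | .inr (.inl (.inr none)) =>
    .pop (.inr (.inl ())) (fun v (s : Option B) => (v.1, v.2.1, s)) <|
      .goto fun v => if v.2.2.isSome then .inr (.inl (.inr v.2.2)) else .inr (.inr main)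
  | .inr (.inl (.inr (some b))) =>
    .push (.inr (.inr k₀)) (fun _ => e b) <| .goto fun _ => .inr (.inl (.inr none))
  | .inr (.inr l) => liftSnd (M₂ l)

section

variable [DecidableEq K₁] [DecidableEq K₂]

/-- Configurations of the first machine as configurations of the composite one. -/
def cfgFst (w : σ₂) (c : TM2.Cfg Γ₁ Λ₁ σ₁) :
    TM2.Cfg (StackAlphabet Γ₁ B Γ₂) (Label Λ₁ B Λ₂) (State σ₁ σ₂ B) :=
  ⟨some (match c.l with
    | some l => .inl l
    | none => .inr (.inl (.inl none))), (c.var, w, none), contents c.stk [] fun _ => []⟩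

/-- Configurations of the second machine as configurations of the composite one. -/
def cfgSnd (v : σ₁) (c : TM2.Cfg Γ₂ Λ₂ σ₂) :
    TM2.Cfg (StackAlphabet Γ₁ B Γ₂) (Label Λ₁ B Λ₂) (State σ₁ σ₂ B) :=
  ⟨c.l.map fun l => .inr (.inr l), (v, c.var, none), contents (fun _ => []) [] c.stk⟩

/-- The embedding of configurations commutes with steps. Halting fits in because `cfgFst` sends a
missing label to the entry of the hand-over loop, which is where `liftFst` jumps instead of halting.
-/
theorem stepAux_liftFst (q : TM2.Stmt Γ₁ Λ₁ σ₁) (v : σ₁) (w : σ₂) (S : ∀ k, List (Γ₁ k)) :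
    TM2.stepAux (liftFst (Λ₂ := Λ₂) (Γ₂ := Γ₂) (B := B) q) (v, w, none)
      (contents S [] fun _ => []) = cfgFst w (TM2.stepAux q v S) := by
  induction q generalizing v S with
  | push k f q ih =>
    simp only [liftFst, TM2.stepAux]
    rw [update_contents_fst]
    exact ih _ _
  | peek k f q ih => exact ih _ _
  | pop k f q ih =>
    simp only [liftFst, TM2.stepAux]
    rw [update_contents_fst]
    exact ih _ _
  | load f q ih => exact ih _ _
  | branch p q₁ q₂ ih₁ ih₂ =>
    simp only [liftFst, TM2.stepAux]
    cases p v
    · exact ih₂ _ _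
    · exact ih₁ _ _
  | goto l => rfl
  | halt => rfl

theorem stepAux_liftSnd (q : TM2.Stmt Γ₂ Λ₂ σ₂) (v : σ₁) (w : σ₂) (T : ∀ k, List (Γ₂ k)) :
    TM2.stepAux (liftSnd (Λ₁ := Λ₁) (Γ₁ := Γ₁) (B := B) q) (v, w, none)
      (contents (fun _ => []) [] T) = cfgSnd v (TM2.stepAux q w T) := by
  induction q generalizing w T with
  | push k f q ih =>
    simp only [liftSnd, TM2.stepAux]
    rw [update_contents_snd]
    exact ih _ _
  | peek k f q ih => exact ih _ _
  | pop k f q ih =>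
    simp only [liftSnd, TM2.stepAux]
    rw [update_contents_snd]
    exact ih _ _
  | load f q ih => exact ih _ _
  | branch p q₁ q₂ ih₁ ih₂ =>
    simp only [liftSnd, TM2.stepAux]
    cases p w
    · exact ih₂ _ _
    · exact ih₁ _ _
  | goto l => rfl
  | halt => rfl

variable (M₁ : Λ₁ → TM2.Stmt Γ₁ Λ₁ σ₁) (M₂ : Λ₂ → TM2.Stmt Γ₂ Λ₂ σ₂) (k₁ : K₁) (k₀ : K₂)
  (d : Γ₁ k₁ → B) (e : B → Γ₂ k₀) (main : Λ₂) (v : σ₁) (w : σ₂)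

theorem runs_fst {t : ℕ} {c c' : TM2.Cfg Γ₁ Λ₁ σ₁} (h : RunsIn (TM2.step M₁) t c c') :
    RunsIn (TM2.step (program M₁ M₂ k₁ k₀ d e main)) t (cfgFst w c) (cfgFst w c') := by
  refine h.map _ ?_
  rintro ⟨l, v, S⟩ c' hc
  cases l with
  | none => simp at hc
  | some l =>
    simp only [TM2.step, Option.some.injEq] at hc
    subst hc
    exact congrArg some (stepAux_liftFst _ _ _ _)

theorem runs_snd {t : ℕ} {c c' : TM2.Cfg Γ₂ Λ₂ σ₂} (h : RunsIn (TM2.step M₂) t c c') :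
    RunsIn (TM2.step (program M₁ M₂ k₁ k₀ d e main)) t (cfgSnd v c) (cfgSnd v c') := by
  refine h.map _ ?_
  rintro ⟨l, v, S⟩ c' hc
  cases l with
  | none => simp at hc
  | some l =>
    simp only [TM2.step, Option.some.injEq] at hc
    subst hc
    exact congrArg some (stepAux_liftSnd _ _ _ _)

/-- Moving a word between stacks reverses it. The hand-over goes through the middle stack, so that
the second reversal, in `runs_load`, restores the order. -/
theorem runs_unload (s : List (Γ₁ k₁)) (l : List B) :
    RunsIn (TM2.step (program M₁ M₂ k₁ k₀ d e main)) (2 * s.length + 1)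
      ⟨some (.inr (.inl (.inl none))), (v, w, none),
        contents (update (fun _ => []) k₁ s) l fun _ => []⟩
      ⟨some (.inr (.inl (.inr none))), (v, w, none),
        contents (fun _ => []) ((s.map d).reverse ++ l) fun _ => []⟩ := by
  -- The third component of the state holds the letter read last and changes during the loop, so the
  -- induction must allow any value there.
  suffices ∀ x, RunsIn (TM2.step (program M₁ M₂ k₁ k₀ d e main)) (2 * s.length + 1)
      ⟨some (.inr (.inl (.inl none))), (v, w, x),
        contents (update (fun _ => []) k₁ s) l fun _ => []⟩
      ⟨some (.inr (.inl (.inr none))), (v, w, none),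
        contents (fun _ => []) ((s.map d).reverse ++ l) fun _ => []⟩ from this none
  induction s generalizing l with
  | nil =>
    intro x
    refine RunsIn.head ?_ (RunsIn.refl _)
    simp only [TM2.step, program, TM2.stepAux, update_contents_fst]
    simp [contents]
  | cons a s ih =>
    intro x
    refine RunsIn.mono (s := (2 * s.length + 1) + 1 + 1) ?_ (by simp only [List.length_cons]; omega)
    refine RunsIn.head (b := ⟨some (.inr (.inl (.inl (some (d a))))), (v, w, some (d a)),
        contents (update (fun _ => []) k₁ s) l fun _ => []⟩) ?_ (RunsIn.head
      (b := ⟨some (.inr (.inl (.inl none))), (v, w, some (d a)),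
        contents (update (fun _ => []) k₁ s) (d a :: l) fun _ => []⟩) ?_ ?_)
    · simp only [TM2.step, program, TM2.stepAux, update_contents_fst]
      simp [contents]
    · simp only [TM2.step, program, TM2.stepAux, update_contents_mid]
      simp [contents]
    · simpa using ih (d a :: l) (some (d a))

theorem runs_load (l : List B) (s : List (Γ₂ k₀)) :
    RunsIn (TM2.step (program M₁ M₂ k₁ k₀ d e main)) (2 * l.length + 1)
      ⟨some (.inr (.inl (.inr none))), (v, w, none),
        contents (fun _ => []) l (update (fun _ => []) k₀ s)⟩
      ⟨some (.inr (.inr main)), (v, w, none),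
        contents (fun _ => []) [] (update (fun _ => []) k₀ ((l.map e).reverse ++ s))⟩ := by
  suffices ∀ x, RunsIn (TM2.step (program M₁ M₂ k₁ k₀ d e main)) (2 * l.length + 1)
      ⟨some (.inr (.inl (.inr none))), (v, w, x),
        contents (fun _ => []) l (update (fun _ => []) k₀ s)⟩
      ⟨some (.inr (.inr main)), (v, w, none),
        contents (fun _ => []) [] (update (fun _ => []) k₀ ((l.map e).reverse ++ s))⟩ from this none
  induction l generalizing s with
  | nil =>
    intro x
    refine RunsIn.head ?_ (RunsIn.refl _)
    simp only [TM2.step, program, TM2.stepAux, update_contents_mid]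
    simp [contents]
  | cons a l ih =>
    intro x
    refine RunsIn.mono (s := (2 * l.length + 1) + 1 + 1) ?_ (by simp only [List.length_cons]; omega)
    refine RunsIn.head (b := ⟨some (.inr (.inl (.inr (some a)))), (v, w, some a),
        contents (fun _ => []) l (update (fun _ => []) k₀ s)⟩) ?_ (RunsIn.head
      (b := ⟨some (.inr (.inl (.inr none))), (v, w, some a),
        contents (fun _ => []) l (update (fun _ => []) k₀ (e a :: s))⟩) ?_ ?_)
    · simp only [TM2.step, program, TM2.stepAux, update_contents_mid]
      simp [contents]
    · simp only [TM2.step, program, TM2.stepAux, update_contents_snd]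
      simp [contents]
    · simpa using ih (e a :: s) (some a)

end

end Comp

theorem eval_mono_nat (p : Polynomial ℕ) {m n : ℕ} (h : m ≤ n) : p.eval m ≤ p.eval n := by
  rw [Polynomial.eval_eq_sum, Polynomial.eval_eq_sum]
  exact Finset.sum_le_sum fun i _ => Nat.mul_le_mul_left _ (Nat.pow_le_pow_left h i)

/-- The composite of two functions that are computable in polynomial time is computable in
polynomial time. -/
theorem PolyTime.comp {α β γ αΓ βΓ γΓ : Type} {ea : α → List αΓ} {eb : β → List βΓ}
    {ec : γ → List γΓ} {f : α → β} {g : β → γ} (hg : PolyTime eb ec g) (hf : PolyTime ea eb f) :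
    PolyTime ea ec (g ∘ f) := by
  obtain ⟨h₁⟩ := hf
  obtain ⟨h₂⟩ := hg
  obtain ⟨c, hc⟩ := h₁.exists_length_le
  let _ := h₁.tm.kFin
  let _ := h₂.tm.kFin
  let _ := h₁.tm.ΛFin
  let _ := h₂.tm.ΛFin
  let _ := h₁.tm.σFin
  let _ := h₂.tm.σFin
  let _ := h₁.tm.Γk₀Fin
  let _ := h₂.tm.Γk₀Fin
  let _ : Fintype βΓ := Fintype.ofEquiv _ h₂.inputAlphabet
  let tm : FinTM2 :=
    { K := h₁.tm.K ⊕ (Unit ⊕ h₂.tm.K)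
      k₀ := .inl h₁.tm.k₀
      k₁ := .inr (.inr h₂.tm.k₁)
      Γ := Comp.StackAlphabet h₁.tm.Γ βΓ h₂.tm.Γ
      Λ := Comp.Label h₁.tm.Λ βΓ h₂.tm.Λ
      main := .inl h₁.tm.main
      σ := Comp.State h₁.tm.σ h₂.tm.σ βΓ
      initialState := (h₁.tm.initialState, h₂.tm.initialState, none)
      Γk₀Fin := h₁.tm.Γk₀Fin
      m := Comp.program h₁.tm.m h₂.tm.m h₁.tm.k₁ h₂.tm.k₀ h₁.outputAlphabet
        h₂.inputAlphabet.symm h₂.tm.main }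
  -- A bound on the length of the intermediate word; each of the two moves of this word takes at
  -- most 2B + 1 steps.
  let B : Polynomial ℕ := Polynomial.X + Polynomial.C c * h₁.time
  refine PolyTime.of_runsIn tm h₁.inputAlphabet h₂.outputAlphabet
    (h₁.time + ((2 * B + 1) + ((2 * B + 1) + h₂.time.comp B))) fun a => ?_
  have hB : (eb (f a)).length ≤ B.eval (ea a).length := by simpa [B] using hc a
  have r₁ := Comp.runs_fst h₁.tm.m h₂.tm.m h₁.tm.k₁ h₂.tm.k₀ h₁.outputAlphabet
    h₂.inputAlphabet.symm h₂.tm.main h₂.tm.initialState (h₁.runsIn a)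
  have r₂ := Comp.runs_unload h₁.tm.m h₂.tm.m h₁.tm.k₁ h₂.tm.k₀ h₁.outputAlphabet
    h₂.inputAlphabet.symm h₂.tm.main h₁.tm.initialState h₂.tm.initialState
    ((eb (f a)).map h₁.outputAlphabet.symm) []
  have r₃ := Comp.runs_load h₁.tm.m h₂.tm.m h₁.tm.k₁ h₂.tm.k₀ h₁.outputAlphabet
    h₂.inputAlphabet.symm h₂.tm.main h₁.tm.initialState h₂.tm.initialState
    (eb (f a)).reverse []
  have r₄ := Comp.runs_snd h₁.tm.m h₂.tm.m h₁.tm.k₁ h₂.tm.k₀ h₁.outputAlphabet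
    h₂.inputAlphabet.symm h₂.tm.main h₁.tm.initialState (h₂.runsIn (f a))
  simp only [List.map_map, Equiv.self_comp_symm, List.map_id, List.append_nil, List.length_map,
    List.map_reverse, List.reverse_reverse, List.length_reverse] at r₂ r₃
  rw [update_eq_self_iff.2 rfl] at r₃
  have e₀ := Comp.update_contents_fst (Γ₁ := h₁.tm.Γ) (B := βΓ) (Γ₂ := h₂.tm.Γ) (fun _ => []) []
    (fun _ => []) h₁.tm.k₀ ((ea a).map h₁.inputAlphabet.symm)
  have e₁ := Comp.update_contents_snd (Γ₁ := h₁.tm.Γ) (B := βΓ) (Γ₂ := h₂.tm.Γ) (fun _ => []) []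
    (fun _ => []) h₂.tm.k₁ ((ec (g (f a))).map h₂.outputAlphabet.symm)
  rw [Comp.contents_nil] at e₀ e₁
  have r := r₁.trans (r₂.trans (r₃.trans r₄))
  simp only [Comp.cfgFst, Comp.cfgSnd, ← e₀, ← e₁] at r
  refine RunsIn.mono r ?_
  have := eval_mono_nat h₂.time hB
  simp only [Polynomial.eval_add, Polynomial.eval_mul, Polynomial.eval_comp, Polynomial.eval_one,
    Polynomial.eval_ofNat]
  omega

end Turing

namespace Turing

open StateTransition Function

/-! ### Pushing words -/

section PushWord

variable {K : Type*} {Γ : K → Type*} {Λ σ : Type*} (k : K) [Inhabited (Γ k)]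

/-- Push the first `n` letters of the word `f v`, the last one first. -/
def pushTake (f : σ → List (Γ k)) (q : TM2.Stmt Γ Λ σ) : ℕ → TM2.Stmt Γ Λ σ
  | 0 => q
  | n + 1 => .branch (fun v => decide (n < (f v).length))
      (.push k (fun v => (f v).getD n default) (pushTake f q n)) (pushTake f q n)

/-- Push the word `f v`, so that its first letter gets on top of the stack. -/
def pushWord [Fintype σ] (f : σ → List (Γ k)) (q : TM2.Stmt Γ Λ σ) : TM2.Stmt Γ Λ σ :=
  pushTake k f q (Finset.univ.sup fun v => (f v).length)

theorem stepAux_pushTake [DecidableEq K] (f : σ → List (Γ k)) (q : TM2.Stmt Γ Λ σ) (n : ℕ) (v : σ)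
    (S : ∀ k, List (Γ k)) :
    TM2.stepAux (pushTake k f q n) v S =
      TM2.stepAux q v (update S k ((f v).take n ++ S k)) := by
  induction n generalizing S with
  | zero => simp [pushTake]
  | succ n ih =>
    by_cases h : n < (f v).length
    · simp only [pushTake, TM2.stepAux, h, decide_true, cond_true, ih, update_self, update_idem]
      rw [List.take_add_one (i := n), List.getD_eq_getElem _ _ h, List.getElem?_eq_getElem h,
        List.append_assoc]
      rfl
    · simp only [pushTake, TM2.stepAux, h, decide_false, cond_false, ih]
      rw [List.take_of_length_le (by omega), List.take_of_length_le (by omega)]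

theorem stepAux_pushWord [DecidableEq K] [Fintype σ] (f : σ → List (Γ k)) (q : TM2.Stmt Γ Λ σ)
    (v : σ) (S : ∀ k, List (Γ k)) :
    TM2.stepAux (pushWord k f q) v S = TM2.stepAux q v (update S k (f v ++ S k)) := by
  rw [pushWord, stepAux_pushTake, List.take_of_length_le]
  exact Finset.le_sup (f := fun v => (f v).length) (Finset.mem_univ v)

end PushWord

/-! ### Transducers with a counter -/

/-- The operations on a counter. -/
inductive CounterOp
  | keep
  | inc
  | dec
  | reset
  deriving DecidableEq

instance : Fintype CounterOp :=
  ⟨{.keep, .inc, .dec, .reset}, fun x => by cases x <;> simp⟩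

/-- The effect of an operation on a counter. -/
def CounterOp.app : CounterOp → ℕ → ℕ
  | keep, c => c
  | inc, c => c + 1
  | dec, c => c - 1
  | reset, _ => 0

/-- A finite-state transducer with a counter that can be tested for zero. The flag handed to
`next`, `op` and `out` is whether the counter is positive. -/
structure CounterTransducer (Q α β : Type) where
  /-- the initial state -/
  init : Q
  /-- the next state -/
  next : Q → Bool → α → Q
  /-- the operation on the counter -/
  op : Q → Bool → α → CounterOp
  /-- the word that is written -/
  out : Q → Bool → α → List β
  /-- the word that is written at the end -/
  fin : Q → List β

namespace CounterTransducer

variable {Q α β : Type} (T : CounterTransducer Q α β)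

/-- The word that is written from state `q` and value `c` of the counter on. -/
def run : Q → ℕ → List α → List β
  | q, _, [] => T.fin q
  | q, c, a :: l =>
    T.out q (decide (0 < c)) a ++
      run (T.next q (decide (0 < c)) a) ((T.op q (decide (0 < c)) a).app c) l

/-- The stacks of the machine. -/
inductive Stack
  | inp
  | ctr
  | out
  deriving DecidableEq

instance : Fintype Stack :=
  ⟨{.inp, .ctr, .out}, fun x => by cases x <;> simp⟩

/-- The labels of the machine. -/
inductive Lab
  | read
  | act (o : CounterOp)
  | clear
  deriving DecidableEq, Fintype

/-- The stack alphabets of the machine. -/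
abbrev StackAlphabet (α β : Type) : Stack → Type
  | .inp => α
  | .ctr => Unit
  | .out => β

/-- The stacks of the machine. -/
def contents (i : List α) (c : ℕ) (o : List β) : ∀ k, List (StackAlphabet α β k)
  | .inp => i
  | .ctr => List.replicate c ()
  | .out => o

theorem contents_inp (i : List α) (c : ℕ) (o : List β) : contents i c o .inp = i := rfl

theorem contents_ctr (i : List α) (c : ℕ) (o : List β) :
    contents i c o .ctr = List.replicate c () := rfl

theorem contents_out (i : List α) (c : ℕ) (o : List β) : contents i c o .out = o := rfl

theorem isSome_head?_replicate (c : ℕ) :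
    (List.replicate c ()).head?.isSome = decide (0 < c) := by
  cases c <;> rfl

theorem contents_nil : contents (α := α) (β := β) [] 0 [] = fun _ => [] := by
  funext k; cases k <;> rfl

theorem update_inp (i : List α) (c : ℕ) (o : List β) (x : List α) :
    update (contents i c o) .inp x = contents x c o := by
  funext k; cases k <;> rfl

theorem update_ctr (i : List α) (c d : ℕ) (o : List β) :
    update (contents i c o) .ctr (List.replicate d ()) = contents i d o := by
  funext k; cases k <;> rfl

theorem update_out (i : List α) (c : ℕ) (o x : List β) :
    update (contents i c o) .out x = contents i c x := by
  funext k; cases k <;> rfl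

/-- The internal states: state of the transducer, letter read, flag of the counter, and whether
the last `pop` of the counter found something. -/
abbrev St (Q α : Type) := Q × Option α × Bool × Bool

/-- The next state of the transducer. -/
def St.next (v : St Q α) : Q := v.2.1.elim v.1 (T.next v.1 v.2.2.1)

/-- The program of the machine. -/
def program [Fintype Q] [Fintype α] [Inhabited β] :
    Lab → TM2.Stmt (StackAlphabet α β) Lab (St Q α)
  | .read => .peek .ctr (fun v s => (v.1, none, s.isSome, false)) <|
      .pop .inp (fun v s => (v.1, s, v.2.2)) <|
      .branch (fun v => v.2.1.isNone)
        (pushWord .out (fun v => (T.fin v.1).reverse) <| .goto fun _ => .clear)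
        (pushWord .out
          (fun v => (v.2.1.elim [] (T.out v.1 v.2.2.1)).reverse) <|
          .goto fun v => .act (v.2.1.elim .keep (T.op v.1 v.2.2.1)))
  | .act .keep => .load (fun v => (St.next T v, none, false, false)) <| .goto fun _ => .read
  | .act .inc => .push .ctr (fun _ => ()) <|
      .load (fun v => (St.next T v, none, false, false)) <| .goto fun _ => .read
  | .act .dec => .pop .ctr (fun v _ => v) <|
      .load (fun v => (St.next T v, none, false, false)) <| .goto fun _ => .read
  | .act .reset => .pop .ctr (fun v s => (v.1, v.2.1, v.2.2.1, s.isSome)) <|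
      .branch (fun v => v.2.2.2) (.goto fun _ => .act .reset)
      (.load (fun v => (St.next T v, none, false, false)) <| .goto fun _ => .read)
  | .clear => .pop .ctr (fun v s => (v.1, v.2.1, v.2.2.1, s.isSome)) <|
      .branch (fun v => v.2.2.2) (.goto fun _ => .clear)
      (.load (fun _ => (T.init, none, false, false)) .halt)

variable [Fintype Q] [Fintype α] [Inhabited β]

theorem runs_clear (c : ℕ) (o : List β) (v : St Q α) :
    RunsIn (TM2.step T.program) (c + 1) ⟨some .clear, v, contents [] c o⟩
      ⟨none, (T.init, none, false, false), contents [] 0 o⟩ := by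
  induction c generalizing v with
  | zero =>
    refine RunsIn.head ?_ (RunsIn.refl _)
    simp [program, contents]
  | succ c ih =>
    refine RunsIn.head ?_ (ih (v.1, v.2.1, v.2.2.1, true))
    have := update_ctr (α := α) [] (c + 1) c o
    simpa [program, contents, List.replicate_succ] using this

theorem runs_reset (i : List α) (c : ℕ) (o : List β) (v : St Q α) :
    RunsIn (TM2.step T.program) (c + 1) ⟨some (.act .reset), v, contents i c o⟩
      ⟨some .read, (St.next T v, none, false, false), contents i 0 o⟩ := by
  induction c generalizing v with
  | zero =>
    refine RunsIn.head ?_ (RunsIn.refl _)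
    simp [program, contents, St.next]
  | succ c ih =>
    refine RunsIn.head ?_ (ih (v.1, v.2.1, v.2.2.1, true))
    have := update_ctr i (c + 1) c o
    simpa [program, contents, List.replicate_succ] using this

/-- An amortised bound with the value of the counter as potential: the cost plus the new value is at
most the old value plus 2. A reset takes as many steps as the counter is high, and earlier
increments have paid for them. -/
theorem runs_act (op : CounterOp) (i : List α) (c : ℕ) (o : List β) (v : St Q α) :
    RunsIn (TM2.step T.program) (c + 2 - op.app c) ⟨some (.act op), v, contents i c o⟩
      ⟨some .read, (St.next T v, none, false, false), contents i (op.app c) o⟩ := by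
  cases op with
  | keep =>
    refine (RunsIn.head ?_ (RunsIn.refl _)).mono (by simp [CounterOp.app])
    simp [program, CounterOp.app]
  | inc =>
    refine (RunsIn.head ?_ (RunsIn.refl _)).mono (by simp [CounterOp.app])
    have := update_ctr i c (c + 1) o
    simpa [program, CounterOp.app, contents, List.replicate_succ] using this
  | dec =>
    refine (RunsIn.head ?_ (RunsIn.refl _)).mono (by simp [CounterOp.app]; omega)
    have := update_ctr i c (c - 1) o
    simpa [program, CounterOp.app, contents] using this
  | reset => exact (runs_reset T i c o v).mono (by simp [CounterOp.app])

theorem step_read_nil (q : Q) (c : ℕ) (o : List β) :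
    TM2.step T.program ⟨some .read, (q, none, false, false), contents [] c o⟩ =
      some ⟨some .clear, (q, none, decide (0 < c), false),
        contents [] c ((T.fin q).reverse ++ o)⟩ := by
  simp only [program, TM2.step, TM2.stepAux, stepAux_pushWord, contents_inp, contents_ctr,
    update_inp, contents_out, update_out, isSome_head?_replicate]
  rfl

theorem step_read_cons (q : Q) (a : α) (l : List α) (c : ℕ) (o : List β) :
    TM2.step T.program ⟨some .read, (q, none, false, false), contents (a :: l) c o⟩ =
      some ⟨some (.act (T.op q (decide (0 < c)) a)), (q, some a, decide (0 < c), false),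
        contents l c ((T.out q (decide (0 < c)) a).reverse ++ o)⟩ := by
  simp only [program, TM2.step, TM2.stepAux, stepAux_pushWord, contents_inp, contents_ctr,
    update_inp, contents_out, update_out, isSome_head?_replicate]
  rfl

/-- By the amortised bound of `runs_act` the run is linear in the input even though a single reset
may be long. The output is reversed because it is written onto a stack. -/
theorem runs_read (l : List α) (q : Q) (c : ℕ) (o : List β) :
    RunsIn (TM2.step T.program) (4 * l.length + c + 2)
      ⟨some .read, (q, none, false, false), contents l c o⟩
      ⟨none, (T.init, none, false, false), contents [] 0 ((T.run q c l).reverse ++ o)⟩ := by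
  induction l generalizing q c o with
  | nil =>
    exact (RunsIn.head (T.step_read_nil q c o) (T.runs_clear c _ _)).mono (by simp)
  | cons a l ih =>
    have h := RunsIn.head (T.step_read_cons q a l c o) ((T.runs_act _ _ _ _ _).trans (ih _ _ _))
    simp only [run, List.reverse_append, List.append_assoc]
    refine h.mono ?_
    have : (T.op q (decide (0 < c)) a).app c ≤ c + 1 := by
      cases T.op q (decide (0 < c)) a <;> (simp [CounterOp.app]; try omega)
    simp only [List.length_cons]
    omega

/-- A transducer writes the reverse of its output in polynomial time. -/
theorem polyTime_reverse : PolyTime id id fun l => (T.run T.init 0 l).reverse := by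
  let tm : FinTM2 :=
    { K := Stack
      k₀ := .inp
      k₁ := .out
      Γ := StackAlphabet α β
      Λ := Lab
      main := .read
      σ := St Q α
      initialState := (T.init, none, false, false)
      Γk₀Fin := inferInstanceAs (Fintype α)
      m := T.program }
  refine PolyTime.of_runsIn tm (Equiv.refl α) (Equiv.refl β) (4 * Polynomial.X + 2) fun l => ?_
  have h := T.runs_read l T.init 0 []
  have e₀ := update_inp (α := α) (β := β) [] 0 [] l
  have e₁ := update_out (α := α) (β := β) [] 0 [] (T.run T.init 0 l).reverse
  rw [contents_nil] at e₀ e₁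
  simp only [← e₀, List.append_nil, ← e₁] at h
  have hl : (l.map (Equiv.refl α).symm) = l := by simp
  have ho : ((T.run T.init 0 l).reverse.map (Equiv.refl β).symm) = (T.run T.init 0 l).reverse := by
    simp
  simp only [id, hl, ho, Polynomial.eval_add, Polynomial.eval_mul, Polynomial.eval_X,
    Polynomial.eval_ofNat]
  exact h

end CounterTransducer

/-- The transducer that copies its input. -/
def copyTransducer (α : Type) : CounterTransducer Unit α α where
  init := ()
  next _ _ _ := ()
  op _ _ _ := .keep
  out _ _ a := [a]
  fin _ := []

theorem copyTransducer_run {α : Type} (l : List α) (c : ℕ) : (copyTransducer α).run () c l = l := by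
  induction l generalizing c with
  | nil => rfl
  | cons a l ih => exact congrArg (a :: ·) (ih _)

theorem polyTime_reverse {α : Type} [Fintype α] [Inhabited α] :
    PolyTime id id (List.reverse : List α → List α) := by
  have h := (copyTransducer α).polyTime_reverse
  have e : (fun l => ((copyTransducer α).run () 0 l).reverse) = List.reverse := by
    funext l; rw [copyTransducer_run]
  exact e ▸ h

theorem CounterTransducer.polyTime {Q α β : Type} [Fintype Q] [Fintype α] [Fintype β] [Inhabited β]
    (T : CounterTransducer Q α β) : PolyTime id id (T.run T.init 0) := by
  have h := (Turing.polyTime_reverse (α := β)).comp T.polyTime_reverse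
  have e : List.reverse ∘ (fun l => (T.run T.init 0 l).reverse) = T.run T.init 0 := by
    funext l; simp
  exact e ▸ h

end Turing

namespace Turing

open StateTransition Function

/-! ### Listing the positions of a word -/

/-- The side on which a letter of a word lies, seen from a given position. -/
inductive Side
  | left
  | self
  | right
  deriving DecidableEq

instance : Fintype Side := ⟨{.left, .self, .right}, fun x => by cases x <;> simp⟩

namespace Spread

/-- A letter of a word in which a position is chosen: the letter, its side, the letter at the
chosen position, and a tag. -/
abbrev Sight (α : Type) (n : ℕ) := α × Side × α × Fin (n + 1)

variable {α : Type} {n : ℕ}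

/-- The word `u ++ a :: v`, in which the position of `a` is chosen and tagged by `j`. -/
def block (u : List α) (a : α) (j : Fin (n + 1)) (v : List α) : List (Sight α n) :=
  u.map (fun b => (b, .left, a, j)) ++ (a, .self, a, j) :: v.map (fun b => (b, .right, a, j))

/-- The words `u ++ a :: v`, in which the position of `a` is chosen, for all tags less than `i`. -/
def blocks (n : ℕ) (u : List α) (a : α) (v : List α) : ℕ → List (Sight α n)
  | 0 => []
  | i + 1 => blocks n u a v i ++ block u a (Fin.ofNat (n + 1) i) v

/-- The words `u ++ v` in which a position of `v` is chosen and tagged, the last position first. -/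
def spread (n : ℕ) : List α → List α → List (Sight α n)
  | _, [] => []
  | u, a :: v => spread n (u ++ [a]) v ++ blocks n u a v (n + 1)

/-- The stacks of the machine. -/
inductive Stack
  | inp
  | left
  | tmp
  | out
  deriving DecidableEq

instance : Fintype Stack := ⟨{.inp, .left, .tmp, .out}, fun x => by cases x <;> simp⟩

/-- The labels of the machine. -/
inductive Lab
  | next
  | rightDown
  | rightUp
  | leftDown
  | leftUp
  | clear
  deriving DecidableEq

instance : Fintype Lab :=
  ⟨{.next, .rightDown, .rightUp, .leftDown, .leftUp, .clear}, fun x => by cases x <;> simp⟩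

/-- The stack alphabets of the machine. -/
abbrev StackAlphabet (α : Type) (n : ℕ) : Stack → Type
  | .inp => α
  | .left => α
  | .tmp => α
  | .out => Sight α n

/-- The stacks of the machine. -/
def contents (i l t : List α) (o : List (Sight α n)) : ∀ k, List (StackAlphabet α n k)
  | .inp => i
  | .left => l
  | .tmp => t
  | .out => o

section

variable (i l t x : List α) (o y : List (Sight α n))

theorem contents_inp : contents i l t o .inp = i := rfl

theorem contents_left : contents i l t o .left = l := rfl

theorem contents_tmp : contents i l t o .tmp = t := rfl

theorem contents_out : contents i l t o .out = o := rfl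

theorem contents_nil : contents (α := α) (n := n) [] [] [] [] = fun _ => [] := by
  funext k; cases k <;> rfl

theorem update_inp : update (contents i l t o) .inp x = contents x l t o := by
  funext k; cases k <;> rfl

theorem update_left : update (contents i l t o) .left x = contents i x t o := by
  funext k; cases k <;> rfl

theorem update_tmp : update (contents i l t o) .tmp x = contents i l x o := by
  funext k; cases k <;> rfl

theorem update_out : update (contents i l t o) .out y = contents i l t y := by
  funext k; cases k <;> rfl

end

/-- The internal states: the letter at the chosen position, the tag, and the letter read. -/
abbrev St (α : Type) (n : ℕ) := Option α × Fin (n + 1) × Option α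

/-- The program of the machine. -/
def program (α : Type) [Inhabited α] (n : ℕ) : Lab → TM2.Stmt (StackAlphabet α n) Lab (St α n)
  | .next => .pop .inp (fun _ s => (s, Fin.ofNat (n + 1) n, none)) <|
      .goto fun v => if v.1.isSome then .rightDown else .clear
  | .rightDown => .pop .inp (fun v s => (v.1, v.2.1, s)) <|
      .branch (fun v => v.2.2.isSome)
        (.push .tmp (fun v => v.2.2.getD default) <| .goto fun _ => .rightDown)
        (.goto fun _ => .rightUp)
  | .rightUp => .pop .tmp (fun v s => (v.1, v.2.1, s)) <|
      .branch (fun v => v.2.2.isSome)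
        (.push .inp (fun v => v.2.2.getD default) <|
          .push .out (fun v => (v.2.2.getD default, .right, v.1.getD default, v.2.1)) <|
          .goto fun _ => .rightUp)
        (.push .out (fun v => (v.1.getD default, .self, v.1.getD default, v.2.1)) <|
          .goto fun _ => .leftDown)
  | .leftDown => .pop .left (fun v s => (v.1, v.2.1, s)) <|
      .branch (fun v => v.2.2.isSome)
        (.push .tmp (fun v => v.2.2.getD default) <|
          .push .out (fun v => (v.2.2.getD default, .left, v.1.getD default, v.2.1)) <|
          .goto fun _ => .leftDown)
        (.goto fun _ => .leftUp)
  | .leftUp => .pop .tmp (fun v s => (v.1, v.2.1, s)) <|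
      .branch (fun v => v.2.2.isSome)
        (.push .left (fun v => v.2.2.getD default) <| .goto fun _ => .leftUp)
        (.branch (fun v => decide (v.2.1.val = 0))
          (.push .left (fun v => v.1.getD default) <| .goto fun _ => .next)
          (.load (fun v => (v.1, Fin.ofNat (n + 1) (v.2.1.val - 1), none)) <|
            .goto fun _ => .rightDown))
  | .clear => .pop .left (fun v s => (v.1, v.2.1, s)) <|
      .branch (fun v => v.2.2.isSome) (.goto fun _ => .clear)
        (.load (fun _ => (none, 0, none)) .halt)

section

variable [Inhabited α] (a : α) (j : Fin (n + 1)) (s : Option α)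

theorem runs_clear (l : List α) (o : List (Sight α n)) (v : St α n) :
    RunsIn (TM2.step (program α n)) (l.length + 1) ⟨some .clear, v, contents [] l [] o⟩
      ⟨none, (none, 0, none), contents [] [] [] o⟩ := by
  induction l generalizing v with
  | nil =>
    refine RunsIn.head ?_ (RunsIn.refl _)
    simp only [program, TM2.step, TM2.stepAux, contents_left, update_left]
    rfl
  | cons b l ih =>
    refine RunsIn.head ?_ (ih (v.1, v.2.1, some b))
    simp only [program, TM2.step, TM2.stepAux, contents_left, update_left]
    rfl

theorem runs_rightDown (i l t : List α) (o : List (Sight α n)) :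
    RunsIn (TM2.step (program α n)) (i.length + 1)
      ⟨some .rightDown, (some a, j, s), contents i l t o⟩
      ⟨some .rightUp, (some a, j, none), contents [] l (i.reverse ++ t) o⟩ := by
  induction i generalizing t s with
  | nil =>
    refine RunsIn.head ?_ (RunsIn.refl _)
    simp only [program, TM2.step, TM2.stepAux, contents_inp, update_inp]
    rfl
  | cons b i ih =>
    have h := ih (some b) (b :: t)
    rw [List.reverse_cons, List.append_assoc]
    refine RunsIn.head ?_ h
    simp only [program, TM2.step, TM2.stepAux, contents_inp, update_inp, contents_tmp, update_tmp]
    rfl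

theorem runs_rightUp (i l t : List α) (o : List (Sight α n)) :
    RunsIn (TM2.step (program α n)) (t.length + 1)
      ⟨some .rightUp, (some a, j, s), contents i l t o⟩
      ⟨some .leftDown, (some a, j, none), contents (t.reverse ++ i) l []
        ((a, .self, a, j) :: ((t.reverse.map fun b => (b, .right, a, j)) ++ o))⟩ := by
  induction t generalizing i o s with
  | nil =>
    refine RunsIn.head ?_ (RunsIn.refl _)
    simp only [program, TM2.step, TM2.stepAux, contents_tmp, update_tmp, contents_out, update_out]
    rfl
  | cons b t ih =>
    have h := ih (some b) (b :: i) ((b, .right, a, j) :: o)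
    simp only [List.reverse_cons, List.append_assoc, List.map_append, List.map_cons, List.map_nil,
      List.singleton_append]
    refine RunsIn.head ?_ h
    simp only [program, TM2.step, TM2.stepAux, contents_inp, update_inp, contents_tmp, update_tmp,
      contents_out, update_out]
    rfl

theorem runs_leftDown (i l t : List α) (o : List (Sight α n)) :
    RunsIn (TM2.step (program α n)) (l.length + 1)
      ⟨some .leftDown, (some a, j, s), contents i l t o⟩
      ⟨some .leftUp, (some a, j, none), contents i [] (l.reverse ++ t)
        ((l.reverse.map fun b => (b, .left, a, j)) ++ o)⟩ := by
  induction l generalizing t o s with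
  | nil =>
    refine RunsIn.head ?_ (RunsIn.refl _)
    simp only [program, TM2.step, TM2.stepAux, contents_left, update_left]
    rfl
  | cons b l ih =>
    have h := ih (some b) (b :: t) ((b, .left, a, j) :: o)
    simp only [List.reverse_cons, List.append_assoc, List.map_append, List.map_cons, List.map_nil,
      List.singleton_append]
    refine RunsIn.head ?_ h
    simp only [program, TM2.step, TM2.stepAux, contents_left, update_left, contents_tmp, update_tmp,
      contents_out, update_out]
    rfl

theorem runs_leftUp (i l t : List α) (o : List (Sight α n)) :
    RunsIn (TM2.step (program α n)) (t.length + 1)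
      ⟨some .leftUp, (some a, j, s), contents i l t o⟩
      (if j.val = 0 then ⟨some .next, (some a, j, none), contents i (a :: (t.reverse ++ l)) [] o⟩
        else ⟨some .rightDown, (some a, Fin.ofNat (n + 1) (j.val - 1), none),
          contents i (t.reverse ++ l) [] o⟩) := by
  induction t generalizing l s with
  | nil =>
    refine RunsIn.head ?_ (RunsIn.refl _)
    simp only [program, TM2.step, TM2.stepAux, contents_left, update_left, contents_tmp, update_tmp]
    by_cases h : j.val = 0
    · simp only [h, decide_true, cond_true, if_true]; rfl
    · simp only [h, decide_false, cond_false, if_false]; rfl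
  | cons b t ih =>
    have h := ih (some b) (b :: l)
    simp only [List.reverse_cons, List.append_assoc, List.singleton_append]
    refine RunsIn.head ?_ h
    simp only [program, TM2.step, TM2.stepAux, contents_left, update_left, contents_tmp, update_tmp]
    rfl

/-- The output is pushed, so the block is produced from its last letter to its first: the right
part, the chosen letter, the left part. Each part travels to the auxiliary stack and back, so it is
intact for the next tag. -/
theorem runs_block (u v : List α) (o : List (Sight α n)) :
    RunsIn (TM2.step (program α n)) (2 * (u.length + v.length) + 4)
      ⟨some .rightDown, (some a, j, none), contents v u.reverse [] o⟩
      (if j.val = 0 then ⟨some .next, (some a, j, none),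
          contents v (u ++ [a]).reverse [] (block u a j v ++ o)⟩
        else ⟨some .rightDown, (some a, Fin.ofNat (n + 1) (j.val - 1), none),
          contents v u.reverse [] (block u a j v ++ o)⟩) := by
  have h₁ := runs_rightDown a j none v u.reverse [] o
  have h₂ := runs_rightUp a j none [] u.reverse (v.reverse ++ []) o
  have h := ((h₁.trans h₂).trans (runs_leftDown a j none ((v.reverse ++ []).reverse ++ [])
    u.reverse [] _)).trans (runs_leftUp a j none _ [] _ _)
  simp only [List.append_nil, List.reverse_reverse] at h
  have e : (u.map fun b => (b, Side.left, a, j)) ++ (a, Side.self, a, j) ::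
      ((v.map fun b => (b, Side.right, a, j)) ++ o) = block u a j v ++ o := by
    simp [block]
  rw [e] at h
  simp only [List.reverse_append, List.reverse_cons, List.reverse_nil, List.nil_append,
    List.singleton_append]
  refine h.mono ?_
  simp only [List.length_reverse]
  omega

theorem runs_blocks (u v : List α) (o : List (Sight α n)) (i : ℕ) (hi : i ≤ n) :
    ∃ w, RunsIn (TM2.step (program α n)) ((i + 1) * (2 * (u.length + v.length) + 4))
      ⟨some .rightDown, (some a, Fin.ofNat (n + 1) i, none), contents v u.reverse [] o⟩
      ⟨some .next, w, contents v (u ++ [a]).reverse [] (blocks n u a v (i + 1) ++ o)⟩ := by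
  induction i generalizing o with
  | zero =>
    have h := runs_block a (Fin.ofNat (n + 1) 0) u v o
    rw [if_pos (by simp)] at h
    refine ⟨_, RunsIn.mono (t := _) h (by omega)⟩
  | succ i ih =>
    have h := runs_block a (Fin.ofNat (n + 1) (i + 1)) u v o
    have e : (Fin.ofNat (n + 1) (i + 1)).val = i + 1 := by
      simp only [Fin.val_ofNat]; exact Nat.mod_eq_of_lt (by omega)
    rw [if_neg (by omega), e, Nat.add_sub_cancel] at h
    obtain ⟨w, hw⟩ := ih (block u a (Fin.ofNat (n + 1) (i + 1)) v ++ o) (by omega)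
    refine ⟨w, ?_⟩
    have e' : blocks n u a v (i + 1 + 1) ++ o =
        blocks n u a v (i + 1) ++ (block u a (Fin.ofNat (n + 1) (i + 1)) v ++ o) := by
      rw [blocks, List.append_assoc]
    rw [e']
    exact (h.trans hw).mono (by ring_nf; omega)

/-- Positions are treated from left to right and tags from n down to 0. As later output lies above
earlier output, the final word begins with the last position and tag 0; the header of the instance
will be written there. -/
theorem runs_next (v u : List α) (o : List (Sight α n)) (w : St α n) :
    RunsIn (TM2.step (program α n))
      (v.length * ((n + 1) * (2 * (u.length + v.length) + 4) + 1) + (u.length + v.length) + 2)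
      ⟨some .next, w, contents v u.reverse [] o⟩
      ⟨none, (none, 0, none), contents [] [] [] (spread n u v ++ o)⟩ := by
  induction v generalizing u o w with
  | nil =>
    refine (RunsIn.head ?_ (runs_clear u.reverse o (none, Fin.ofNat (n + 1) n, none))).mono ?_
    · simp only [program, TM2.step, TM2.stepAux, contents_inp, update_inp]
      rfl
    · simp
  | cons a v ih =>
    obtain ⟨w', h⟩ := runs_blocks a u v o n le_rfl
    have h' := h.trans (ih (u ++ [a]) (blocks n u a v (n + 1) ++ o) w')
    rw [spread, List.append_assoc]
    refine (RunsIn.head ?_ h').mono ?_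
    · simp only [program, TM2.step, TM2.stepAux, contents_inp, update_inp]
      rfl
    · simp only [List.length_append, List.length_cons, List.length_nil]
      have e : u.length + (0 + 1) + v.length = u.length + (v.length + 1) := by omega
      rw [e]
      have : (n + 1) * (2 * (u.length + v.length) + 4) ≤
          (n + 1) * (2 * (u.length + (v.length + 1)) + 4) := by gcongr; omega
      rw [Nat.add_one_mul v.length]
      omega

end

/-- The positions of a word can be listed in polynomial time. -/
theorem polyTime [Fintype α] [Inhabited α] (n : ℕ) :
    PolyTime id id fun l : List α => spread n [] l := by
  let tm : FinTM2 :=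
    { K := Stack
      k₀ := .inp
      k₁ := .out
      Γ := StackAlphabet α n
      Λ := Lab
      main := .next
      σ := St α n
      initialState := (none, 0, none)
      Γk₀Fin := inferInstanceAs (Fintype α)
      m := program α n }
  refine PolyTime.of_runsIn tm (Equiv.refl α) (Equiv.refl (Sight α n))
    (Polynomial.X * (Polynomial.C (n + 1) * (2 * Polynomial.X + 4) + 1) + Polynomial.X + 2)
    fun l => ?_
  have h := runs_next (n := n) l [] [] (none, 0, none)
  have e₀ := update_inp (α := α) (n := n) [] [] [] l []
  have e₁ := update_out (α := α) (n := n) [] [] [] [] (spread n [] l)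
  rw [contents_nil] at e₀ e₁
  simp only [List.reverse_nil, List.append_nil, ← e₀, ← e₁] at h
  have hl : (l.map (Equiv.refl α).symm) = l := by simp
  have ho : ((spread n [] l).map (Equiv.refl (Sight α n)).symm) = spread n [] l := by simp
  simp only [id, hl, ho]
  refine RunsIn.mono h ?_
  simp

end Spread

end Turing

namespace ContinuousClustering

/-! ### Counting components -/

/-- A continuous map to a discrete space is constant on components, so it factors through the space
of components, and the factor is still surjective. -/
theorem card_le_numComponents {X : Type} [TopologicalSpace X] {S : Set X} {D : Type}
    [TopologicalSpace D] [DiscreteTopology D] {g : S → D} (hg : Continuous g)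
    (hs : Function.Surjective g) : ENat.card D ≤ numComponents S := by
  have h : Function.Surjective hg.connectedComponentsLift := fun d => by
    obtain ⟨x, rfl⟩ := hs d
    exact ⟨x, rfl⟩
  exact Cardinal.toENat.monotone' (Cardinal.mk_le_of_surjective h)

theorem numComponents_empty {X : Type} [TopologicalSpace X] :
    numComponents (∅ : Set X) = 0 := by
  have : IsEmpty (ConnectedComponents (∅ : Set X)) :=
    ⟨fun c => Quotient.inductionOn c fun x => x.2⟩
  exact (ENat.card_eq_zero_iff_empty _).2 this

theorem nonempty_of_le_numComponents {X : Type} [TopologicalSpace X] {S : Set X} {k : ℕ}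
    (hk : 1 ≤ k) (h : (k : ℕ∞) ≤ numComponents S) : S.Nonempty := by
  rw [Set.nonempty_iff_ne_empty]
  rintro rfl
  rw [numComponents_empty] at h
  have : k ≤ 0 := by exact_mod_cast h
  omega

/-! ### The two-sheet polynomial -/

section TwoSheet

variable {m : ℕ} (r : MvPolynomial (Fin m) ℤ)

theorem aeval_sheetPenalty (x : Option (Fin m) → ℝ) :
    MvPolynomial.aeval x (sheetPenalty r) =
      MvPolynomial.aeval (fun j => x (some j)) r ^ 2 + (x none ^ 2 - 1) ^ 2 := by
  simp [sheetPenalty, MvPolynomial.aeval_rename, Function.comp_def]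

theorem aeval_sheetPenalty_nonneg (x : Option (Fin m) → ℝ) :
    0 ≤ MvPolynomial.aeval x (sheetPenalty r) := by
  rw [aeval_sheetPenalty]; positivity

theorem aeval_sheetPenalty_eq_zero {x : Option (Fin m) → ℝ} :
    MvPolynomial.aeval x (sheetPenalty r) = 0 ↔ x ∈ sheets r := by
  rw [aeval_sheetPenalty, add_eq_zero_iff_of_nonneg (sq_nonneg _) (sq_nonneg _)]
  have : x none ^ 2 - 1 = (x none - 1) * (x none + 1) := by ring
  simp [sheets, realZeros, this, sub_eq_zero, add_eq_zero_iff_eq_neg]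

theorem aeval_twoSheetCopies (n : ℕ) (x : Fin n × Option (Fin m) → ℝ) :
    MvPolynomial.aeval x (twoSheetCopies n r) =
      1 - ∑ i, MvPolynomial.aeval (fun v => x (i, v)) (sheetPenalty r) := by
  simp [twoSheetCopies, MvPolynomial.aeval_rename, Function.comp_def]

theorem superLevel_twoSheet : superLevel (twoSheet r) 1 = sheets r := by
  ext x
  have h := aeval_sheetPenalty_nonneg r x
  rw [← aeval_sheetPenalty_eq_zero]
  simp only [superLevel, twoSheet, Set.mem_ofPred_eq, map_sub, map_one]
  constructor <;> intro h' <;> linarith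

theorem superLevel_twoSheetCopies (n : ℕ) :
    superLevel (twoSheetCopies n r) 1 =
      {x | ∀ i : Fin n, (fun v => x (i, v)) ∈ sheets r} := by
  ext x
  have h := Finset.sum_nonneg fun (i : Fin n) (_ : i ∈ Finset.univ) =>
    aeval_sheetPenalty_nonneg r fun v => x (i, v)
  have e := Finset.sum_eq_zero_iff_of_nonneg fun (i : Fin n) (_ : i ∈ Finset.univ) =>
    aeval_sheetPenalty_nonneg r fun v => x (i, v)
  simp only [Finset.mem_univ, true_imp_iff, aeval_sheetPenalty_eq_zero] at e
  rw [Set.mem_ofPred_eq, ← e]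
  simp only [superLevel, Set.mem_ofPred_eq, aeval_twoSheetCopies]
  constructor <;> intro h' <;> linarith

/-- The set `{1, -1}`. -/
abbrev signs : Set ℝ := {1, -1}

theorem card_signs_pow (n : ℕ) : ENat.card (Fin n → signs) = ((2 ^ n : ℕ) : ℕ∞) := by
  rw [ENat.card_eq_coe_natCard, Nat.card_fun]
  have : Nat.card signs = 2 := by
    rw [Nat.card_coe_set_eq]
    exact Set.ncard_pair (by norm_num)
  rw [this, Nat.card_fin]

/-- The sign coordinates form a continuous map to the discrete set {1, -1}ⁿ. It is onto because one
zero y can serve in all copies, with arbitrary signs. -/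
theorem two_pow_le_numComponents_copies (n : ℕ) (hr : (realZeros r).Nonempty) :
    ((2 ^ n : ℕ) : ℕ∞) ≤ numComponents
      {x : Fin n × Option (Fin m) → ℝ | ∀ i : Fin n, (fun v => x (i, v)) ∈ sheets r} := by
  obtain ⟨y, hy⟩ := hr
  rw [← card_signs_pow]
  refine card_le_numComponents (g := fun x i => ⟨x.1 (i, none), (x.2 i).2⟩) ?_ fun s => ?_
  · exact continuous_pi fun i =>
      ((continuous_apply (i, none)).comp continuous_subtype_val).subtype_mk _
  · refine ⟨⟨fun p => p.2.elim (s p.1 : ℝ) y, fun i => ⟨hy, (s i).2⟩⟩, ?_⟩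
    funext i
    rfl

theorem two_le_numComponents_sheets (hr : (realZeros r).Nonempty) :
    2 ≤ numComponents (sheets r) := by
  obtain ⟨y, hy⟩ := hr
  have e : ENat.card signs = 2 := by
    rw [← Set.encard, Set.encard_pair (by norm_num)]
  rw [← e]
  refine card_le_numComponents (g := fun x => ⟨x.1 none, x.2.2⟩) ?_ fun s => ?_
  · exact ((continuous_apply none).comp continuous_subtype_val).subtype_mk _
  · exact ⟨⟨fun v => v.elim (s : ℝ) y, ⟨hy, s.2⟩⟩, rfl⟩

theorem two_le_numComponents_sheets_iff :
    2 ≤ numComponents (sheets r) ↔ (realZeros r).Nonempty := by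
  refine ⟨fun h => ?_, two_le_numComponents_sheets r⟩
  obtain ⟨x, hx⟩ := nonempty_of_le_numComponents (k := 2) (by norm_num) (by exact_mod_cast h)
  exact ⟨_, hx.1⟩

theorem le_numComponents_copies_iff {k : ℕ} (hk : 2 ≤ k) :
    (k : ℕ∞) ≤ numComponents {x : Fin (k - 1) × Option (Fin m) → ℝ |
      ∀ i : Fin (k - 1), (fun v => x (i, v)) ∈ sheets r} ↔ (realZeros r).Nonempty := by
  refine ⟨fun h => ?_, fun h => le_trans ?_ (two_pow_le_numComponents_copies r (k - 1) h)⟩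
  · obtain ⟨x, hx⟩ := nonempty_of_le_numComponents (by omega) h
    -- Here k ≥ 2 matters: at least one copy must exist for a point of the set to contain a zero.
    exact ⟨_, (hx ⟨0, by omega⟩).1⟩
  · have := Nat.lt_two_pow_self (n := k - 1)
    exact_mod_cast (by omega : k ≤ 2 ^ (k - 1))

end TwoSheet

end ContinuousClustering

namespace ContinuousClustering

/-! ### Words with annotated letters -/

/-- The letters of the word of a sentence, annotated by their role; `start` and `finish` enclose
the word. -/
inductive Role : Type
  | start
  | tick
  | dimSep
  | coefBit (b : Bool)
  | coefSep
  | minus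
  | expBit (b : Bool)
  | expSep
  | term
  | endPoly
  | eqZero
  | nonneg
  | pos
  | not
  | and
  | or
  | finish
  deriving DecidableEq, Fintype

instance : Inhabited Role := ⟨.start⟩

/-- The annotated word of a term. -/
def roleTerm {d : ℕ} (t : ℤ × (Fin d → ℕ)) : List Role :=
  Role.term :: (if t.1 < 0 then [Role.minus] else []) ++
    ((Computability.encodeNat t.1.natAbs).map Role.coefBit ++ [Role.coefSep]) ++
    (List.ofFn t.2).flatMap fun e =>
      (Computability.encodeNat e).map Role.expBit ++ [Role.expSep]

/-- The annotated word of a polynomial. -/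
def rolePoly {d : ℕ} (p : PolyCode d) : List Role :=
  p.flatMap roleTerm ++ [Role.endPoly]

/-- The annotated word of a formula. -/
def roleFormula {n : ℕ} : QFFormula n → List Role
  | .eqZero p => Role.eqZero :: rolePoly p
  | .nonneg p => Role.nonneg :: rolePoly p
  | .pos p => Role.pos :: rolePoly p
  | .not φ => Role.not :: roleFormula φ
  | .and φ ψ => Role.and :: (roleFormula φ ++ roleFormula ψ)
  | .or φ ψ => Role.or :: (roleFormula φ ++ roleFormula ψ)

/-- The annotated word of a sentence. -/
def roleWord (s : ExistsSentence) : List Role :=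
  Role.start :: (List.replicate s.n Role.tick ++
    Role.dimSep :: (roleFormula s.matrix ++ [Role.finish]))

/-- The letters that begin an atomic formula. -/
def Role.isAtom : Role → Bool
  | .eqZero | .nonneg | .pos => true
  | _ => false

/-- The letters that begin a conjunction or a disjunction. -/
def Role.isBinary : Role → Bool
  | .and | .or => true
  | _ => false

/-- The letters that begin a formula. -/
def Role.isHead : Role → Bool
  | .eqZero | .nonneg | .pos | .not | .and | .or => true
  | _ => false

/-- The letters that end a term. -/
def Role.endsTerm : Role → Bool
  | .term | .endPoly => true
  | _ => false

/-! ### Local expressions -/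

/-- The positions of a word that matter for a given position: itself, the next one, the beginning
of the second operand, and the variable to which an exponent belongs. -/
inductive Kind
  | self
  | next
  | operand
  | base
  deriving DecidableEq

instance : Fintype Kind := ⟨{.self, .next, .operand, .base}, fun x => by cases x <;> simp⟩

/-- The values at a position. -/
abbrev Regs := Fin 3 → ℝ

/-- Polynomial expressions in the values at the positions that matter. -/
inductive Ex
  | const (z : ℤ)
  | var (k : Kind) (n : Fin 3)
  | add (a b : Ex)
  | mul (a b : Ex)

/-- The coefficient and the exponents of a monomial. -/
abbrev Mono := ℤ × (Kind → Fin 3 → ℕ)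

/-- The value of a monomial. -/
def Mono.eval (env : Kind → Regs) (t : Mono) : ℝ := t.1 * ∏ k, ∏ n, env k n ^ t.2 k n

namespace Ex

/-- The value of an expression. -/
def eval (env : Kind → Regs) : Ex → ℝ
  | const z => z
  | var k n => env k n
  | add a b => a.eval env + b.eval env
  | mul a b => a.eval env * b.eval env

/-- The difference of two expressions. -/
def sub (a b : Ex) : Ex := add a (mul (const (-1)) b)

@[simp] theorem eval_sub (env : Kind → Regs) (a b : Ex) :
    (sub a b).eval env = a.eval env - b.eval env := by
  simp [sub, eval]; ring

/-- An expression as a sum of monomials. -/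
def expand : Ex → List Mono
  | const z => [(z, 0)]
  | var k n => [(1, fun k' n' => if k' = k ∧ n' = n then 1 else 0)]
  | add a b => a.expand ++ b.expand
  | mul a b => a.expand.flatMap fun s => b.expand.map fun t => (s.1 * t.1, s.2 + t.2)

theorem sum_expand (env : Kind → Regs) (e : Ex) :
    (e.expand.map (Mono.eval env)).sum = e.eval env := by
  induction e with
  | const z => simp [expand, eval, Mono.eval]
  | var k n =>
    simp only [expand, eval, List.map_cons, List.map_nil, List.sum_cons, List.sum_nil, Mono.eval]
    rw [Finset.prod_eq_single k, Finset.prod_eq_single n]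
    · simp
    · intro n' _ h; simp [h]
    · simp
    · intro k' _ h; simp [h]
    · simp
  | add a b iha ihb => simp [expand, eval, iha, ihb]
  | mul a b iha ihb =>
    have h : ∀ s t : Mono, Mono.eval env (s.1 * t.1, s.2 + t.2) = s.eval env * t.eval env := by
      intro s t
      simp only [Mono.eval, Pi.add_apply, pow_add, Finset.prod_mul_distrib, Int.cast_mul]
      ring
    have h' : ∀ l l' : List Mono, ((l.flatMap fun s => l'.map fun t =>
        (s.1 * t.1, s.2 + t.2)).map (Mono.eval env)).sum =
        (l.map (Mono.eval env)).sum * (l'.map (Mono.eval env)).sum := by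
      intro l l'
      induction l with
      | nil => simp
      | cons s l ih =>
        simp only [List.flatMap_cons, List.map_append, List.sum_append, ih, List.map_cons,
          List.sum_cons, add_mul, List.map_map, Function.comp_def, h, List.sum_map_mul_left]
    rw [expand, h', iha, ihb, eval]

/-- The sum of the squares of some expressions. -/
def sumSq : List Ex → Ex
  | [] => const 0
  | e :: l => add (mul e e) (sumSq l)

theorem eval_sumSq_nonneg (env : Kind → Regs) (l : List Ex) : 0 ≤ (sumSq l).eval env := by
  induction l with
  | nil => simp [sumSq, eval]
  | cons e l ih => exact add_nonneg (mul_self_nonneg _) ih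

theorem eval_sumSq_eq_zero (env : Kind → Regs) (l : List Ex) :
    (sumSq l).eval env = 0 ↔ ∀ e ∈ l, e.eval env = 0 := by
  induction l with
  | nil => simp [sumSq, eval]
  | cons e l ih =>
    rw [sumSq, eval, eval, add_eq_zero_iff_of_nonneg (mul_self_nonneg _)
      (eval_sumSq_nonneg env l), ih, List.forall_mem_cons, mul_self_eq_zero]

/-- The product of the differences of the first value of the position itself and the numbers less
than `k`. -/
def levels : ℕ → Ex
  | 0 => const 1
  | k + 1 => mul (levels k) (sub (var .self 0) (const k))

theorem eval_levels_eq_zero (env : Kind → Regs) (k : ℕ) :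
    (levels k).eval env = 0 ↔ ∃ j < k, env .self 0 = j := by
  induction k with
  | zero => simp [levels, eval]
  | succ k ih =>
    rw [levels, eval, mul_eq_zero, ih, eval_sub, sub_eq_zero]
    simp only [eval, Int.cast_natCast, Nat.lt_succ_iff_lt_or_eq, or_and_right, exists_or,
      exists_eq_left]

end Ex

open Ex in
/-- The equations between the values at a position and at the positions that matter for it. Read
from right to left, the values at a letter of a polynomial are the sum of the complete terms, the
product of the complete factors of the current term, and the current factor. The first value at a
letter that begins a formula is the truth value of the formula. -/
def equations : Role → List Ex
  | .start | .tick | .finish => []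
  | .dimSep => [sub (var .next 0) (const 1)]
  | .endPoly => [var .self 0, sub (var .self 1) (const 1), sub (var .self 2) (const 1)]
  | .expSep => [sub (var .self 0) (var .next 0),
      sub (var .self 1) (mul (var .next 1) (var .next 2)), sub (var .self 2) (const 1)]
  | .coefSep => [sub (var .self 0) (var .next 0),
      sub (var .self 1) (mul (var .next 1) (var .next 2)), var .self 2]
  | .expBit b => [sub (var .self 0) (var .next 0), sub (var .self 1) (var .next 1),
      sub (var .self 2) (mul (mul (var .next 2) (var .next 2))
        (if b then var .base 0 else const 1))]
  | .coefBit b => [sub (var .self 0) (var .next 0), sub (var .self 1) (var .next 1),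
      sub (var .self 2) (add (add (var .next 2) (var .next 2)) (const (if b then 1 else 0)))]
  | .minus => [sub (var .self 0) (var .next 0), sub (var .self 1) (var .next 1),
      add (var .self 2) (var .next 2)]
  | .term => [sub (var .self 0) (add (var .next 0) (mul (var .next 1) (var .next 2))),
      sub (var .self 1) (const 1), sub (var .self 2) (const 1)]
  | .eqZero => [mul (var .self 0) (var .next 0),
      mul (sub (const 1) (var .self 0)) (sub (mul (var .next 0) (var .self 1)) (const 1))]
  | .nonneg => [mul (var .self 0) (sub (var .next 0) (mul (var .self 1) (var .self 1))),
      mul (sub (const 1) (var .self 0))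
        (add (mul (var .next 0) (mul (var .self 1) (var .self 1))) (const 1))]
  | .pos => [mul (var .self 0)
        (sub (mul (var .next 0) (mul (var .self 1) (var .self 1))) (const 1)),
      mul (sub (const 1) (var .self 0)) (add (var .next 0) (mul (var .self 1) (var .self 1)))]
  | .not => [sub (var .self 0) (sub (const 1) (var .next 0))]
  | .and => [sub (var .self 0) (mul (var .next 0) (var .operand 0))]
  | .or => [sub (var .self 0)
      (sub (add (var .next 0) (var .operand 0)) (mul (var .next 0) (var .operand 0)))]

/-- The contribution of a position to the polynomial. -/
def summand (k : ℕ) : Role → Ex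
  | .start => .sub (.const 1) (.mul (.levels k) (.levels k))
  | a => .sub (.const 0) (.sumSq (equations a))

/-- A bound on the number of monomials of a summand. -/
def width (k : ℕ) : ℕ := Finset.univ.sup fun a => (summand k a).expand.length

/-- The monomials of a summand, padded by zeros. -/
def monoAt (k : ℕ) (a : Role) (j : ℕ) : Mono := (summand k a).expand.getD j (0, 0)

theorem sum_range_getD {α : Type*} (f : α → ℝ) (z : α) (hz : f z = 0) (l : List α) (n : ℕ)
    (hn : l.length ≤ n) : ((List.range n).map fun j => f (l.getD j z)).sum = (l.map f).sum := by
  induction l generalizing n with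
  | nil => simp [hz]
  | cons a l ih =>
    obtain ⟨n, rfl⟩ : ∃ m, n = m + 1 := ⟨n - 1, by simp at hn; omega⟩
    rw [List.range_succ_eq_map]
    simp only [List.map_cons, List.map_map, List.sum_cons, Function.comp_def,
      List.getD_cons_zero, List.getD_cons_succ, Nat.succ_eq_add_one]
    rw [ih n (by simpa using hn)]

/-- Padding with zero monomials gives every letter the same number of terms, so a tag from one fixed
finite set can index them in the machine. -/
theorem sum_monoAt (k : ℕ) (a : Role) (env : Kind → Regs) :
    ((List.range (width k + 1)).map fun j => (monoAt k a j).eval env).sum =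
      (summand k a).eval env := by
  rw [← Ex.sum_expand]
  refine sum_range_getD _ _ (by simp [Mono.eval]) _ _ ?_
  exact (Finset.le_sup (f := fun a => (summand k a).expand.length) (Finset.mem_univ a)).trans
    (Nat.le_succ _)

end ContinuousClustering

namespace ContinuousClustering

open Turing

/-! ### Finding the positions that matter -/

/-- The stages of the search for the second operand: within the first operand, behind it, done. -/
inductive Search
  | seek
  | ready
  | found
  deriving DecidableEq

instance : Fintype Search := ⟨{.seek, .ready, .found}, fun x => by cases x <;> simp⟩

/-- The state of the scan to the right of a position: whether the next letter is the first one,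
whether the current term has not ended, and the stage of the search for the second operand. -/
structure Scan where
  /-- the next letter is the first one -/
  first : Bool
  /-- the current term has not ended -/
  inTerm : Bool
  /-- the stage of the search for the second operand -/
  search : Search
  deriving DecidableEq, Fintype

/-- The state at the beginning of the scan. -/
def Scan.init : Scan := ⟨true, true, .seek⟩

/-- The next state of the scan. The counter holds the number of operands that are still to come
within the first operand; the flag is whether it is positive. -/
def Scan.next (q : Scan) (pos : Bool) (b : Role) : Scan where
  first := false
  inTerm := q.inTerm && !b.endsTerm
  search := match q.search with
    | .seek => if b.isAtom && !pos then .ready else .seek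
    | .ready => if b.isHead then .found else .ready
    | .found => .found

/-- The operation of the scan on the counter. -/
def Scan.op (q : Scan) (b : Role) : CounterOp :=
  if q.search = .seek then if b.isBinary then .inc else if b.isAtom then .dec else .keep
  else .keep

/-- The kind of a letter, as found by the scan. -/
def Scan.kind (q : Scan) (b : Role) : Option Kind :=
  if q.first then some .next
  else if q.search = .ready ∧ b.isHead = true then some .operand else none

/-- Whether the letter ends an exponent of the current term. -/
def Scan.counts (q : Scan) (b : Role) : Bool := q.inTerm && decide (b = .expSep)

/-- The kinds of the letters to the right of a position, and whether they end an exponent of the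
current term. -/
def scan : Scan → ℕ → List Role → List (Option Kind × Bool)
  | _, _, [] => []
  | q, c, b :: l =>
    (q.kind b, q.counts b) :: scan (q.next (decide (0 < c)) b) ((q.op b).app c) l

/-- The kinds of the letters to the left of a position, read from right to left. The base of the
current factor is found by counting; the flag is whether it has been found. -/
def leftScan : Bool → ℕ → List Role → List (Option Kind)
  | _, _, [] => []
  | f, c, b :: l =>
    (if b = .tick ∧ c = 0 ∧ f = false then some .base else none) ::
      leftScan (f || (decide (b = .tick) && !decide (0 < c)))
        (if b = .dimSep ∨ b = .tick then c - 1 else c) l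

/-- The number of ends of exponents to the right of a position within the current term. -/
def expCount (v : List Role) : ℕ := (scan .init 0 v).countP fun x => x.2

/-- The kinds of the letters of the word `u ++ a :: v`, seen from the position of `a`. -/
def kinds (u v : List Role) : List (Option Kind) :=
  (leftScan false (expCount v) u.reverse).reverse ++
    some .self :: (scan .init 0 v).map fun x => x.1

theorem length_scan (q : Scan) (c : ℕ) (l : List Role) : (scan q c l).length = l.length := by
  induction l generalizing q c with
  | nil => rfl
  | cons b l ih => simp [scan, ih]

theorem length_leftScan (f : Bool) (c : ℕ) (l : List Role) :
    (leftScan f c l).length = l.length := by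
  induction l generalizing f c with
  | nil => rfl
  | cons b l ih => simp [leftScan, ih]

theorem length_kinds (u v : List Role) (a : Role) :
    (kinds u v).length = (u ++ a :: v).length := by
  simp [kinds, length_scan, length_leftScan]

/-- The product of the values at the positions of kind `K`. -/
def envOf (ks : List (Option Kind)) (vs : List Regs) (K : Kind) : Regs := fun n =>
  (List.zipWith (fun k r => if k = some K then r n else 1) ks vs).prod

theorem envOf_append {ks ks' : List (Option Kind)} {vs vs' : List Regs} (K : Kind)
    (h : ks.length = vs.length) :
    envOf (ks ++ ks') (vs ++ vs') K = envOf ks vs K * envOf ks' vs' K := by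
  funext n
  simp [envOf, List.zipWith_append h]

theorem envOf_cons (k : Option Kind) (r : Regs) (ks : List (Option Kind)) (vs : List Regs)
    (K : Kind) : envOf (k :: ks) (r :: vs) K = (if k = some K then r else 1) * envOf ks vs K := by
  funext n
  by_cases h : k = some K <;> simp [envOf, h]

theorem envOf_reverse {ks : List (Option Kind)} {vs : List Regs} (K : Kind)
    (h : ks.length = vs.length) : envOf ks.reverse vs.reverse K = envOf ks vs K := by
  funext n
  rw [envOf, envOf, ← List.reverse_zipWith h, List.prod_reverse]

theorem envOf_eq_one {ks : List (Option Kind)} {K : Kind} (h : some K ∉ ks) (vs : List Regs) :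
    envOf ks vs K = 1 := by
  induction ks generalizing vs with
  | nil => rfl
  | cons k ks ih =>
    rw [List.mem_cons, not_or] at h
    cases vs with
    | nil => rfl
    | cons r vs => rw [envOf_cons, ih h.2, if_neg (Ne.symm h.1), one_mul]

theorem mem_scan {q : Scan} {c : ℕ} {l : List Role} {K : Kind}
    (h : some K ∈ (scan q c l).map fun x => x.1) :
    K = .operand ∨ (K = .next ∧ q.first = true) := by
  induction l generalizing q c with
  | nil => simp [scan] at h
  | cons b l ih =>
    simp only [scan, List.map_cons, List.mem_cons] at h
    rcases h with h | h
    · unfold Scan.kind at h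
      split_ifs at h with h₁ h₂
      · exact .inr ⟨Option.some.inj h, h₁⟩
      · exact .inl (Option.some.inj h)
    · rcases ih h with h | h
      · exact .inl h
      · simp [Scan.next] at h

theorem mem_leftScan {f : Bool} {c : ℕ} {l : List Role} {K : Kind}
    (h : some K ∈ leftScan f c l) : K = .base := by
  induction l generalizing f c with
  | nil => simp [leftScan] at h
  | cons b l ih =>
    simp only [leftScan, List.mem_cons] at h
    rcases h with h | h
    · split_ifs at h
      exact Option.some.inj h
    · exact ih h

/-! ### Words with values -/

/-- A letter with the values at its position. -/
abbrev Cell := Role × Regs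

/-- The first letter's values. -/
def headRegs : List Cell → Regs
  | [] => 1
  | x :: _ => x.2

/-- The values at the beginning of the second operand. -/
def operandRegs (l : List Cell) : Regs :=
  envOf ((scan .init 0 (l.map Prod.fst)).map fun x => x.1) (l.map Prod.snd) .operand

/-- The values at the base, if `c` exponents end to the right of the position. -/
def baseRegs (l : List Cell) (c : ℕ) : Regs :=
  envOf (leftScan false c (l.map Prod.fst).reverse) (l.map Prod.snd).reverse .base

/-- The values at the positions that matter for a letter with values `r` that is followed by `l`,
where `X` yields the values at the base. -/
def localEnv (X : ℕ → Regs) (r : Regs) (l : List Cell) : Kind → Regs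
  | .self => r
  | .next => headRegs l
  | .operand => operandRegs l
  | .base => X (expCount (l.map Prod.fst))

theorem envOf_scan_next (l : List Cell) :
    envOf ((scan .init 0 (l.map Prod.fst)).map fun x => x.1) (l.map Prod.snd) .next =
      headRegs l := by
  cases l with
  | nil => rfl
  | cons x l =>
    simp only [List.map_cons, scan]
    rw [envOf_cons, envOf_eq_one fun h => ?_]
    · simp [headRegs, Scan.kind, Scan.init]
    · rcases mem_scan h with h | h
      · cases h
      · simp [Scan.next] at h

/-- Links what the machines compute, a kind for each position, with what the equations mean. The
scan to the left only yields `base`, the scan to the right only `next` and `operand`; for every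
other kind the respective product is empty and equals 1. -/
theorem envOf_kinds (u l : List Cell) (r : Regs) :
    envOf (kinds (u.map Prod.fst) (l.map Prod.fst)) (u.map Prod.snd ++ r :: l.map Prod.snd) =
      localEnv (baseRegs u) r l := by
  funext K
  have hlen : (leftScan false (expCount (l.map Prod.fst)) (u.map Prod.fst).reverse).length =
      (u.map Prod.snd).reverse.length := by simp [length_leftScan]
  rw [kinds, envOf_append K (by simpa using hlen), envOf_cons]
  have hl := envOf_reverse K hlen
  rw [List.reverse_reverse] at hl
  rw [hl]
  have h₁ : K ≠ .base → envOf (leftScan false (expCount (l.map Prod.fst))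
      (u.map Prod.fst).reverse) (u.map Prod.snd).reverse K = 1 := fun h =>
    envOf_eq_one (fun h' => h (mem_leftScan h')) _
  have h₂ : K ≠ .operand → K ≠ .next →
      envOf ((scan .init 0 (l.map Prod.fst)).map fun x => x.1) (l.map Prod.snd) K = 1 :=
    fun h h' => envOf_eq_one (fun h'' => by
      rcases mem_scan h'' with e | e
      · exact h e
      · exact h' e.1) _
  cases K with
  | self => rw [h₁ (by decide), h₂ (by decide) (by decide)]; simp [localEnv]
  | next => rw [h₁ (by decide), envOf_scan_next]; simp [localEnv]
  | operand => rw [h₁ (by decide)]; simp [localEnv, operandRegs]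
  | base => rw [h₂ (by decide) (by decide)]; simp [localEnv, baseRegs]

/-! ### Counting exponents -/

/-- The number of ends of exponents before the end of the current term. -/
def expEnds : List Role → ℕ
  | [] => 0
  | b :: l => if b.endsTerm then 0 else (if b = .expSep then 1 else 0) + expEnds l

/-- Once `inTerm` is false it stays false, so only the ends of exponents before the first `term` or
`endPoly` contribute. -/
theorem countP_scan (q : Scan) (c : ℕ) (l : List Role) :
    ((scan q c l).countP fun x => x.2) = if q.inTerm then expEnds l else 0 := by
  induction l generalizing q c with
  | nil => simp [scan, expEnds]
  | cons b l ih =>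
    rw [scan, List.countP_cons, ih]
    rcases q with ⟨f, t, s⟩
    cases t
    · simp [Scan.next, Scan.counts]
    · by_cases h : b.endsTerm = true
      · have h' : b ≠ .expSep := by rintro rfl; cases h
        simp [Scan.next, Scan.counts, expEnds, h, h']
      · rw [Bool.not_eq_true] at h
        by_cases h' : b = .expSep
        · subst h'
          simp [Scan.next, Scan.counts, expEnds, Role.endsTerm, add_comm]
        · simp [Scan.next, Scan.counts, expEnds, h, h', add_comm]

theorem expCount_eq (l : List Role) : expCount l = expEnds l := by
  rw [expCount, countP_scan]; rfl

/-! ### Finding the second operand -/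

/-- The values found by the scan at the beginning of the second operand. -/
def scanOperand (q : Scan) (c : ℕ) (l : List Cell) : Regs :=
  envOf ((scan q c (l.map Prod.fst)).map fun x => x.1) (l.map Prod.snd) .operand

theorem scanOperand_cons (q : Scan) (c : ℕ) (x : Cell) (l : List Cell) :
    scanOperand q c (x :: l) = (if q.kind x.1 = some .operand then x.2 else 1) *
      scanOperand (q.next (decide (0 < c)) x.1) ((q.op x.1).app c) l :=
  envOf_cons ..

theorem scanOperand_found (f t : Bool) (c : ℕ) (l : List Cell) :
    scanOperand ⟨f, t, .found⟩ c l = 1 := by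
  induction l generalizing f t c with
  | nil => rfl
  | cons x l ih =>
    rw [scanOperand_cons]
    simp only [Scan.next, ih, mul_one]
    cases f <;> simp [Scan.kind]

theorem scanOperand_ready (t : Bool) (c : ℕ) (x : Cell) (l : List Cell) (h : x.1.isHead = true) :
    scanOperand ⟨false, t, .ready⟩ c (x :: l) = x.2 := by
  rw [scanOperand_cons]
  simp [Scan.next, h, scanOperand_found, Scan.kind]

theorem Role.isHead_of_isAtom {b : Role} (h : b.isHead = false) : b.isAtom = false := by
  cases b <;> simp_all [Role.isHead, Role.isAtom]

theorem Role.isHead_of_isBinary {b : Role} (h : b.isHead = false) : b.isBinary = false := by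
  cases b <;> simp_all [Role.isHead, Role.isBinary]

theorem scanOperand_skip (t : Bool) (s : Search) (c : ℕ) (l l' : List Cell)
    (h : ∀ x ∈ l, x.1.isHead = false) :
    ∃ t', scanOperand ⟨false, t, s⟩ c (l ++ l') = scanOperand ⟨false, t', s⟩ c l' := by
  induction l generalizing t with
  | nil => exact ⟨t, rfl⟩
  | cons x l ih =>
    rw [List.forall_mem_cons] at h
    obtain ⟨t', ht'⟩ := ih (t && !x.1.endsTerm) h.2
    refine ⟨t', ?_⟩
    rw [← ht', List.cons_append, scanOperand_cons]
    have h₁ := Role.isHead_of_isAtom h.1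
    have h₂ := Role.isHead_of_isBinary h.1
    cases s <;> simp [Scan.kind, Scan.next, Scan.op, h.1, h₁, h₂, CounterOp.app]

theorem isHead_roleTerm {d : ℕ} (t : ℤ × (Fin d → ℕ)) : ∀ b ∈ roleTerm t, b.isHead = false := by
  intro b hb
  simp only [roleTerm, List.cons_append, List.mem_cons, List.mem_append, List.mem_map,
    List.mem_flatMap, List.not_mem_nil, or_false] at hb
  rcases hb with rfl | (hb | ⟨_, _, rfl⟩ | rfl) | ⟨_, _, ⟨_, _, rfl⟩ | rfl⟩
  · rfl
  · split_ifs at hb <;> simp at hb; subst hb; rfl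
  all_goals rfl

theorem isHead_rolePoly {d : ℕ} (p : PolyCode d) : ∀ b ∈ rolePoly p, b.isHead = false := by
  intro b hb
  simp only [rolePoly, List.mem_append, List.mem_flatMap, List.mem_singleton] at hb
  rcases hb with ⟨t, _, hb⟩ | rfl
  · exact isHead_roleTerm t b hb
  · rfl

theorem exists_roleFormula_eq_cons {n : ℕ} (φ : QFFormula n) :
    ∃ b l, roleFormula φ = b :: l ∧ b.isHead = true := by
  cases φ <;> exact ⟨_, _, rfl, rfl⟩

theorem scanOperand_atom (f t : Bool) (c : ℕ) (x : Cell) (l l' : List Cell)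
    (hx : x.1.isAtom = true) (h : ∀ x ∈ l, x.1.isHead = false) :
    ∃ t', scanOperand ⟨f, t, .seek⟩ c (x :: (l ++ l')) =
      scanOperand ⟨false, t', if c = 0 then .ready else .seek⟩ (c - 1) l' := by
  obtain ⟨t', ht'⟩ := scanOperand_skip (t && !x.1.endsTerm)
    (if c = 0 then .ready else .seek) (c - 1) l l' h
  refine ⟨t', ?_⟩
  rw [← ht', scanOperand_cons]
  have hb : x.1.isBinary = false := by
    rcases x with ⟨b, r⟩
    cases b <;> simp_all [Role.isAtom, Role.isBinary]
  have hk : Scan.kind ⟨f, t, .seek⟩ x.1 ≠ some .operand := by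
    cases f <;> simp [Scan.kind]
  rw [if_neg hk, one_mul]
  rcases Nat.eq_zero_or_pos c with rfl | hc
  · simp [Scan.next, Scan.op, hx, hb, CounterOp.app]
  · simp [Scan.next, Scan.op, hx, hb, CounterOp.app, hc, hc.ne']

theorem Scan.kind_seek (f t : Bool) (b : Role) : Scan.kind ⟨f, t, .seek⟩ b ≠ some .operand := by
  cases f <;> simp [Scan.kind]

/-- The invariant of prefix notation: a complete formula uses up exactly one outstanding operand.
Started with c further operands outstanding, the scan leaves the formula with c - 1, or is ready for
the second operand if c was 0. A connective raises c by one for its first operand, and its second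
operand lowers it again. -/
theorem scanOperand_formula {n : ℕ} (φ : QFFormula n) (f t : Bool) (c : ℕ) (l l' : List Cell)
    (h : l.map Prod.fst = roleFormula φ) :
    ∃ t', scanOperand ⟨f, t, .seek⟩ c (l ++ l') =
      scanOperand ⟨false, t', if c = 0 then .ready else .seek⟩ (c - 1) l' := by
  have atom : ∀ (f t : Bool) (c : ℕ) (l l' : List Cell) (b : Role) (p : PolyCode n),
      b.isAtom = true → l.map Prod.fst = b :: rolePoly p →
      ∃ t', scanOperand ⟨f, t, .seek⟩ c (l ++ l') =
      scanOperand ⟨false, t', if c = 0 then .ready else .seek⟩ (c - 1) l' := by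
    intro f t c l l' b p hb h
    obtain ⟨x, l, rfl, rfl, hl⟩ := List.map_eq_cons_iff.1 h
    refine scanOperand_atom f t c x l l' hb fun y hy => isHead_rolePoly p _ ?_
    rw [← hl]
    exact List.mem_map_of_mem hy
  have binary : ∀ (φ ψ : QFFormula n),
      (∀ (f t : Bool) (c : ℕ) (l l' : List Cell), l.map Prod.fst = roleFormula φ →
        ∃ t', scanOperand ⟨f, t, .seek⟩ c (l ++ l') =
        scanOperand ⟨false, t', if c = 0 then .ready else .seek⟩ (c - 1) l') →
      (∀ (f t : Bool) (c : ℕ) (l l' : List Cell), l.map Prod.fst = roleFormula ψ →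
        ∃ t', scanOperand ⟨f, t, .seek⟩ c (l ++ l') =
        scanOperand ⟨false, t', if c = 0 then .ready else .seek⟩ (c - 1) l') →
      ∀ (f t : Bool) (c : ℕ) (l l' : List Cell) (b : Role), b = .and ∨ b = .or →
      l.map Prod.fst = b :: (roleFormula φ ++ roleFormula ψ) →
      ∃ t', scanOperand ⟨f, t, .seek⟩ c (l ++ l') =
      scanOperand ⟨false, t', if c = 0 then .ready else .seek⟩ (c - 1) l' := by
    intro φ ψ ihφ ihψ f t c l l' b hb h
    obtain ⟨x, l, rfl, hx, hl⟩ := List.map_eq_cons_iff.1 h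
    obtain ⟨l₁, l₂, rfl, h₁, h₂⟩ := List.map_eq_append_iff.1 hl
    obtain ⟨t₁, ht₁⟩ := ihφ false t (c + 1) l₁ (l₂ ++ l') h₁
    obtain ⟨t₂, ht₂⟩ := ihψ false t₁ c l₂ l' h₂
    refine ⟨t₂, ?_⟩
    rw [List.cons_append, scanOperand_cons, if_neg (Scan.kind_seek _ _ _), one_mul, hx,
      List.append_assoc, ← ht₂]
    rw [if_neg (Nat.succ_ne_zero c), Nat.add_sub_cancel] at ht₁
    rw [← ht₁]
    rcases hb with rfl | rfl <;>
      simp [Scan.next, Scan.op, Role.isAtom, Role.isBinary, Role.endsTerm, CounterOp.app]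
  induction φ generalizing f t c l l' with
  | eqZero p => exact atom f t c l l' _ p rfl h
  | nonneg p => exact atom f t c l l' _ p rfl h
  | pos p => exact atom f t c l l' _ p rfl h
  | not φ ih =>
    obtain ⟨x, l, rfl, hx, hl⟩ := List.map_eq_cons_iff.1 h
    obtain ⟨t', ht'⟩ := ih false t c l l' hl
    refine ⟨t', ?_⟩
    rw [List.cons_append, scanOperand_cons, if_neg (Scan.kind_seek _ _ _), one_mul, hx, ← ht']
    simp [Scan.next, Scan.op, Role.isAtom, Role.isBinary, Role.endsTerm, CounterOp.app]
  | and φ ψ ihφ ihψ => exact binary φ ψ ihφ ihψ f t c l l' _ (.inl rfl) h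
  | or φ ψ ihφ ihψ => exact binary φ ψ ihφ ihψ f t c l l' _ (.inr rfl) h

theorem operandRegs_formula {n : ℕ} (φ : QFFormula n) (l : List Cell) (x : Cell) (l' : List Cell)
    (h : l.map Prod.fst = roleFormula φ) (hx : x.1.isHead = true) :
    operandRegs (l ++ x :: l') = x.2 := by
  obtain ⟨t, ht⟩ := scanOperand_formula φ true true 0 l (x :: l') h
  rw [if_pos rfl, scanOperand_ready _ _ _ _ hx] at ht
  exact ht

end ContinuousClustering

namespace ContinuousClustering

/-! ### Solutions of the local equations -/

/-- The equations of a letter with values `r` that is followed by `l`. -/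
def LocalOK (X : ℕ → Regs) (a : Role) (r : Regs) (l : List Cell) : Prop :=
  ∀ e ∈ equations a, e.eval (localEnv X r l) = 0

/-- The equations of all letters of a word. -/
def AllOK (X : ℕ → Regs) : List Cell → Prop
  | [] => True
  | x :: l => LocalOK X x.1 x.2 l ∧ AllOK X l

theorem allOK_cons_append {X : ℕ → Regs} {x : Cell} {l l' : List Cell} :
    AllOK X (x :: l ++ l') ↔ LocalOK X x.1 x.2 (l ++ l') ∧ AllOK X (l ++ l') := Iff.rfl

theorem map_fst_eq_cons {l : List Cell} {a : Role} {w : List Role}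
    (h : l.map Prod.fst = a :: w) : ∃ r l', l = (a, r) :: l' ∧ l'.map Prod.fst = w := by
  obtain ⟨⟨a, r⟩, l, rfl, rfl, hl⟩ := List.map_eq_cons_iff.1 h
  exact ⟨r, l, rfl, hl⟩

/-- Values for a letter that is followed by `l` exist. -/
theorem exists_localOK (X : ℕ → Regs) (a : Role) (l : List Cell) (ha : a ≠ .dimSep) :
    ∃ r, LocalOK X a r l := by
  generalize hv : headRegs l 0 = v
  cases a with
  | start | tick | finish => exact ⟨0, by simp [LocalOK, equations]⟩
  | dimSep => exact absurd rfl ha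
  -- For the three atoms, with v the value of the polynomial, the first register is the truth value
  -- t and the second a certificate w. The factors t and 1 - t select which condition w must
  -- satisfy: v = 0 against vw = 1; v = w² against vw² = -1; vw² = 1 against v = -w².
  | eqZero =>
    by_cases h : v = 0
    · exact ⟨![1, 0, 0], by simp [LocalOK, equations, Ex.eval, localEnv, hv, h]⟩
    · exact ⟨![0, v⁻¹, 0], by simp [LocalOK, equations, Ex.eval, localEnv, hv, h]⟩
  | nonneg =>
    by_cases h : 0 ≤ v
    · exact ⟨![1, √v, 0], by simp [LocalOK, equations, Ex.eval, localEnv, hv, h]⟩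
    · refine ⟨![0, √(-v)⁻¹, 0], ?_⟩
      have h' : 0 ≤ (-v)⁻¹ := inv_nonneg.2 (by linarith)
      have h'' : v ≠ 0 := by rintro rfl; exact h le_rfl
      have e : v * (-v)⁻¹ = -1 := by rw [inv_neg, mul_neg, mul_inv_cancel₀ h'']
      simp [LocalOK, equations, Ex.eval, localEnv, hv, -Real.sqrt_inv, -inv_neg,
        Real.mul_self_sqrt h', e]
  | pos =>
    by_cases h : 0 < v
    · refine ⟨![1, √v⁻¹, 0], ?_⟩
      have h' : 0 ≤ v⁻¹ := inv_nonneg.2 h.le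
      simp [LocalOK, equations, Ex.eval, localEnv, hv, -Real.sqrt_inv, Real.mul_self_sqrt h',
        h.ne']
    · refine ⟨![0, √(-v), 0], ?_⟩
      have h' : 0 ≤ -v := by linarith
      simp [LocalOK, equations, Ex.eval, localEnv, hv, Real.mul_self_sqrt h']
  | endPoly => exact ⟨![0, 1, 1], by simp [LocalOK, equations, Ex.eval, localEnv]⟩
  | expSep =>
    exact ⟨![v, headRegs l 1 * headRegs l 2, 1], by
      simp [LocalOK, equations, Ex.eval, localEnv, hv]⟩
  | coefSep =>
    exact ⟨![v, headRegs l 1 * headRegs l 2, 0], by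
      simp [LocalOK, equations, Ex.eval, localEnv, hv]⟩
  | expBit b =>
    exact ⟨![v, headRegs l 1, headRegs l 2 * headRegs l 2 *
      (if b then X (expCount (l.map Prod.fst)) 0 else 1)], by
      cases b <;> simp [LocalOK, equations, Ex.eval, localEnv, hv]⟩
  | coefBit b =>
    exact ⟨![v, headRegs l 1, headRegs l 2 + headRegs l 2 + (if b then 1 else 0)], by
      cases b <;> simp [LocalOK, equations, Ex.eval, localEnv, hv]⟩
  | minus =>
    exact ⟨![v, headRegs l 1, - headRegs l 2], by
      simp [LocalOK, equations, Ex.eval, localEnv, hv]⟩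
  | term =>
    exact ⟨![v + headRegs l 1 * headRegs l 2, 1, 1], by
      simp [LocalOK, equations, Ex.eval, localEnv, hv]⟩
  | not => exact ⟨![1 - v, 0, 0], by simp [LocalOK, equations, Ex.eval, localEnv, hv]⟩
  | and =>
    exact ⟨![v * operandRegs l 0, 0, 0], by simp [LocalOK, equations, Ex.eval, localEnv, hv]⟩
  | or =>
    exact ⟨![v + operandRegs l 0 - v * operandRegs l 0, 0, 0], by
      simp [LocalOK, equations, Ex.eval, localEnv, hv]⟩

/-- The equations are triangular from right to left: each letter's registers are determined, or can
be chosen, from those after it and the variables in `X`. Only `dimSep` is excluded, because its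
equation constrains the next letter and leaves its own registers free. -/
theorem exists_allOK (X : ℕ → Regs) (w : List Role) (hw : Role.dimSep ∉ w) :
    ∃ l : List Cell, l.map Prod.fst = w ∧ AllOK X l := by
  induction w with
  | nil => exact ⟨[], rfl, trivial⟩
  | cons a w ih =>
    rw [List.mem_cons, not_or] at hw
    obtain ⟨l, rfl, hl⟩ := ih hw.2
    obtain ⟨r, hr⟩ := exists_localOK X a l (Ne.symm hw.1)
    exact ⟨(a, r) :: l, rfl, hr, hl⟩

/-! ### Values of polynomials -/

/-- The number with given binary digits, the least significant one first. -/
def ofBits : List Bool → ℕ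
  | [] => 0
  | b :: l => 2 * ofBits l + b.toNat

theorem ofBits_encodePosNum (n : PosNum) : ofBits (Computability.encodePosNum n) = n := by
  induction n with
  | one => rfl
  | bit1 n ih => simp [Computability.encodePosNum, ofBits, ih]; ring
  | bit0 n ih => simp [Computability.encodePosNum, ofBits, ih]; ring

theorem ofBits_encodeNat (n : ℕ) : ofBits (Computability.encodeNat n) = n := by
  have h : ∀ m : Num, ofBits (Computability.encodeNum m) = m := by
    intro m
    cases m with
    | zero => rfl
    | pos m => exact ofBits_encodePosNum m
  rw [Computability.encodeNat, h, Num.to_of_nat]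

/-- The value of a power product with given exponents. -/
def monVal (X : ℕ → Regs) : List ℕ → ℝ
  | [] => 1
  | e :: l => X (l.length + 1) 0 ^ e * monVal X l

section

variable {X : ℕ → Regs}

/-- Bits are stored with the least significant one first, so from right to left they arrive with the
most significant one first, and doubling and adding is Horner's scheme started at 0 by `coefSep`.
The pending last factor is multiplied into the product at `coefSep`. -/
theorem sound_coef (bs : List Bool) (l rest : List Cell)
    (hl : l.map Prod.fst = bs.map Role.coefBit ++ [Role.coefSep]) (h : AllOK X (l ++ rest)) :
    headRegs (l ++ rest) 0 = headRegs rest 0 ∧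
      headRegs (l ++ rest) 1 = headRegs rest 1 * headRegs rest 2 ∧
      headRegs (l ++ rest) 2 = ofBits bs ∧ AllOK X rest := by
  induction bs generalizing l with
  | nil =>
    obtain ⟨r, l, rfl, htl⟩ := map_fst_eq_cons hl
    obtain rfl := List.map_eq_nil_iff.1 htl
    obtain ⟨h₁, h₂⟩ := allOK_cons_append.1 h
    simp only [LocalOK, equations, Ex.eval, localEnv, List.mem_cons, List.not_mem_nil,
      forall_eq_or_imp, Ex.eval_sub, sub_eq_zero, false_imp_iff, implies_true, and_true,
      List.nil_append] at h₁
    exact ⟨h₁.1, h₁.2.1, by simpa [ofBits, headRegs] using h₁.2.2, h₂⟩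
  | cons b bs ih =>
    obtain ⟨r, l, rfl, htl⟩ := map_fst_eq_cons hl
    obtain ⟨h₁, h₂⟩ := allOK_cons_append.1 h
    obtain ⟨i₀, i₁, i₂, i₃⟩ := ih l htl h₂
    simp only [LocalOK, equations, Ex.eval, localEnv, List.mem_cons, List.not_mem_nil,
      forall_eq_or_imp, Ex.eval_sub, sub_eq_zero, false_imp_iff, implies_true, and_true] at h₁
    refine ⟨h₁.1.trans i₀, h₁.2.1.trans i₁, h₁.2.2.trans ?_, i₃⟩
    have : headRegs (l ++ rest) 2 = ofBits bs := i₂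
    rw [this]
    cases b <;> simp [ofBits] <;> ring

/-- Square and multiply, from the most significant bit down. The `expSep` that closes an exponent
lies to the right of its bits and is counted, so the base has index one more than the number of ends
in `rest`. -/
theorem sound_exp (bs : List Bool) (l rest : List Cell)
    (hl : l.map Prod.fst = bs.map Role.expBit ++ [Role.expSep]) (h : AllOK X (l ++ rest)) :
    headRegs (l ++ rest) 0 = headRegs rest 0 ∧
      headRegs (l ++ rest) 1 = headRegs rest 1 * headRegs rest 2 ∧
      headRegs (l ++ rest) 2 = X (expEnds (rest.map Prod.fst) + 1) 0 ^ ofBits bs ∧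
      expEnds ((l ++ rest).map Prod.fst) = expEnds (rest.map Prod.fst) + 1 ∧ AllOK X rest := by
  induction bs generalizing l with
  | nil =>
    obtain ⟨r, l, rfl, htl⟩ := map_fst_eq_cons hl
    obtain rfl := List.map_eq_nil_iff.1 htl
    obtain ⟨h₁, h₂⟩ := allOK_cons_append.1 h
    simp only [LocalOK, equations, Ex.eval, localEnv, List.mem_cons, List.not_mem_nil,
      forall_eq_or_imp, Ex.eval_sub, sub_eq_zero, false_imp_iff, implies_true, and_true,
      List.nil_append] at h₁
    exact ⟨h₁.1, h₁.2.1, by simpa [ofBits, headRegs] using h₁.2.2,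
      by simp [expEnds, Role.endsTerm, add_comm], h₂⟩
  | cons b bs ih =>
    obtain ⟨r, l, rfl, htl⟩ := map_fst_eq_cons hl
    obtain ⟨h₁, h₂⟩ := allOK_cons_append.1 h
    obtain ⟨i₀, i₁, i₂, i₃, i₄⟩ := ih l htl h₂
    simp only [LocalOK, equations, Ex.eval, localEnv, List.mem_cons, List.not_mem_nil,
      forall_eq_or_imp, Ex.eval_sub, sub_eq_zero, false_imp_iff, implies_true, and_true] at h₁
    refine ⟨h₁.1.trans i₀, h₁.2.1.trans i₁, h₁.2.2.trans ?_,
      by simpa [expEnds, Role.endsTerm] using i₃, i₄⟩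
    have e : headRegs (l ++ rest) 2 = X (expEnds (rest.map Prod.fst) + 1) 0 ^ ofBits bs :=
      i₂
    have e' : expCount ((l ++ rest).map Prod.fst) = expEnds (rest.map Prod.fst) + 1 :=
      (expCount_eq _).trans i₃
    rw [e]
    cases b
    · simp [ofBits, Ex.eval, ← pow_add, two_mul]
    · rw [if_pos rfl, Ex.eval, localEnv, e', ← pow_add, ← pow_succ, ofBits, two_mul]
      rfl

/-- The last factor completed is still in register 2 and not yet in the product of register 1; hence
the invariant concerns the product of both registers. -/
theorem sound_exps (es : List ℕ) (l rest : List Cell)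
    (hl : l.map Prod.fst = es.flatMap fun e =>
      (Computability.encodeNat e).map Role.expBit ++ [Role.expSep])
    (hr : expEnds (rest.map Prod.fst) = 0) (h : AllOK X (l ++ rest)) :
    headRegs (l ++ rest) 0 = headRegs rest 0 ∧
      headRegs (l ++ rest) 1 * headRegs (l ++ rest) 2 =
        headRegs rest 1 * headRegs rest 2 * monVal X es ∧
      expEnds ((l ++ rest).map Prod.fst) = es.length ∧ AllOK X rest := by
  induction es generalizing l with
  | nil =>
    obtain rfl := List.map_eq_nil_iff.1 hl
    exact ⟨rfl, by simp [monVal], hr, h⟩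
  | cons e es ih =>
    rw [List.flatMap_cons] at hl
    obtain ⟨l₁, l₂, rfl, h₁, h₂⟩ := List.map_eq_append_iff.1 hl
    rw [List.append_assoc] at h ⊢
    obtain ⟨i₀, i₁, i₂, i₃, i₄⟩ := sound_exp _ l₁ (l₂ ++ rest) h₁ h
    obtain ⟨j₀, j₁, j₂, j₃⟩ := ih l₂ h₂ i₄
    refine ⟨i₀.trans j₀, ?_, by rw [i₃, j₂]; rfl, j₃⟩
    rw [i₁, i₂, j₁, j₂, ofBits_encodeNat, monVal]
    ring

/-- The value of an explicit polynomial. -/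
def polyVal (X : ℕ → Regs) {d : ℕ} : PolyCode d → ℝ
  | [] => 0
  | t :: p => polyVal X p + t.1 * monVal X (List.ofFn t.2)

theorem sound_term {d : ℕ} (t : ℤ × (Fin d → ℕ)) (l rest : List Cell)
    (hl : l.map Prod.fst = roleTerm t) (hr : expEnds (rest.map Prod.fst) = 0)
    (hr₁ : headRegs rest 1 = 1) (hr₂ : headRegs rest 2 = 1) (h : AllOK X (l ++ rest)) :
    headRegs (l ++ rest) 0 = headRegs rest 0 + t.1 * monVal X (List.ofFn t.2) ∧
      headRegs (l ++ rest) 1 = 1 ∧ headRegs (l ++ rest) 2 = 1 ∧ AllOK X rest := by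
  rw [roleTerm, List.append_assoc, List.cons_append] at hl
  obtain ⟨r, l, rfl, htl⟩ := map_fst_eq_cons hl
  obtain ⟨h₁, h₂⟩ := allOK_cons_append.1 h
  simp only [LocalOK, equations, Ex.eval, localEnv, List.mem_cons, List.not_mem_nil,
    forall_eq_or_imp, Ex.eval_sub, sub_eq_zero, false_imp_iff, implies_true, and_true,
    Int.cast_one] at h₁
  obtain ⟨e₀, e₁, e₂⟩ := h₁
  obtain ⟨lm, l, rfl, hm, hce⟩ := List.map_eq_append_iff.1 htl
  obtain ⟨lc, le, rfl, hc, he⟩ := List.map_eq_append_iff.1 hce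
  simp only [List.append_assoc] at h₂ e₀
  -- The optional minus sign multiplies the coefficient by -1 and passes the other registers on;
  -- both cases are put into one statement.
  have key : headRegs (lm ++ (lc ++ (le ++ rest))) 0 = headRegs (lc ++ (le ++ rest)) 0 ∧
      headRegs (lm ++ (lc ++ (le ++ rest))) 1 = headRegs (lc ++ (le ++ rest)) 1 ∧
      headRegs (lm ++ (lc ++ (le ++ rest))) 2 =
        (if t.1 < 0 then -1 else 1) * headRegs (lc ++ (le ++ rest)) 2 ∧
      AllOK X (lc ++ (le ++ rest)) := by
    by_cases ht : t.1 < 0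
    · rw [if_pos ht] at hm
      obtain ⟨r, l, rfl, hnil⟩ := map_fst_eq_cons hm
      obtain rfl := List.map_eq_nil_iff.1 hnil
      obtain ⟨h₁, h₂⟩ := allOK_cons_append.1 h₂
      simp only [LocalOK, equations, Ex.eval, localEnv, List.mem_cons, List.not_mem_nil,
        forall_eq_or_imp, Ex.eval_sub, sub_eq_zero, false_imp_iff, implies_true, and_true,
        List.nil_append, add_eq_zero_iff_eq_neg] at h₁
      exact ⟨h₁.1, h₁.2.1, by rw [if_pos ht, neg_one_mul]; exact h₁.2.2, h₂⟩
    · rw [if_neg ht] at hm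
      obtain rfl := List.map_eq_nil_iff.1 hm
      exact ⟨rfl, rfl, by rw [if_neg ht, one_mul]; rfl, h₂⟩
  obtain ⟨k₀, k₁, k₂, k₃⟩ := key
  obtain ⟨c₀, c₁, c₂, c₃⟩ := sound_coef _ lc (le ++ rest) hc k₃
  obtain ⟨x₀, x₁, -, x₃⟩ := sound_exps _ le rest he hr c₃
  refine ⟨?_, e₁, e₂, x₃⟩
  have ht : (if t.1 < 0 then -1 else 1) * ((t.1.natAbs : ℕ) : ℝ) = (t.1 : ℝ) := by
    rw [Nat.cast_natAbs]
    split_ifs with ht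
    · rw [abs_of_neg ht]; push_cast; ring
    · rw [abs_of_nonneg (not_lt.1 ht), one_mul]
  change r 0 = _
  rw [e₀, k₀, k₁, k₂, c₀, c₁, c₂, x₀, x₁, hr₁, hr₂, ofBits_encodeNat, ht]
  ring

theorem expEnds_rolePoly {d : ℕ} (p : PolyCode d) (l : List Role) :
    expEnds (rolePoly p ++ l) = 0 := by
  cases p <;> simp [rolePoly, roleTerm, expEnds, Role.endsTerm]

theorem sound_poly {d : ℕ} (p : PolyCode d) (l rest : List Cell)
    (hl : l.map Prod.fst = rolePoly p) (h : AllOK X (l ++ rest)) :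
    headRegs (l ++ rest) 0 = polyVal X p ∧ headRegs (l ++ rest) 1 = 1 ∧
      headRegs (l ++ rest) 2 = 1 ∧ AllOK X rest := by
  induction p generalizing l with
  | nil =>
    obtain ⟨r, l, rfl, htl⟩ := map_fst_eq_cons hl
    obtain rfl := List.map_eq_nil_iff.1 htl
    obtain ⟨h₁, h₂⟩ := allOK_cons_append.1 h
    simp only [LocalOK, equations, Ex.eval, localEnv, List.mem_cons, List.not_mem_nil,
      forall_eq_or_imp, Ex.eval_sub, sub_eq_zero, false_imp_iff, implies_true, and_true,
      Int.cast_one] at h₁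
    exact ⟨h₁.1, h₁.2.1, h₁.2.2, h₂⟩
  | cons t p ih =>
    rw [rolePoly, List.flatMap_cons, List.append_assoc] at hl
    obtain ⟨l₁, l₂, rfl, h₁, h₂⟩ := List.map_eq_append_iff.1 hl
    rw [List.append_assoc] at h ⊢
    have hr : expEnds ((l₂ ++ rest).map Prod.fst) = 0 := by
      rw [List.map_append, h₂]; exact expEnds_rolePoly p _
    have hA : ∀ l l' : List Cell, AllOK X (l ++ l') → AllOK X l' := by
      intro l l' h
      induction l with
      | nil => exact h
      | cons x l ih => exact ih h.2
    obtain ⟨i₀, i₁, i₂, i₃⟩ := ih l₂ h₂ (hA _ _ h)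
    obtain ⟨j₀, j₁, j₂, -⟩ := sound_term t l₁ (l₂ ++ rest) h₁ hr i₁ i₂ h
    exact ⟨by rw [j₀, i₀, polyVal], j₁, j₂, i₃⟩

/-- The truth value of a formula. -/
def truth (X : ℕ → Regs) {n : ℕ} : QFFormula n → Prop
  | .eqZero p => polyVal X p = 0
  | .nonneg p => 0 ≤ polyVal X p
  | .pos p => 0 < polyVal X p
  | .not φ => ¬ truth X φ
  | .and φ ψ => truth X φ ∧ truth X ψ
  | .or φ ψ => truth X φ ∨ truth X ψ

/-- For an atom, the wrong truth value would need an impossible certificate, such as vw² = -1 with v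
≥ 0. For connectives, `operandRegs_formula` identifies the remote register with the value of the
second operand; then product, inclusion-exclusion and complement act on 0 and 1 as the connectives
do. -/
theorem sound_formula {n : ℕ} (φ : QFFormula n) (l rest : List Cell)
    (hl : l.map Prod.fst = roleFormula φ) (h : AllOK X (l ++ rest)) :
    (truth X φ → headRegs (l ++ rest) 0 = 1) ∧ (¬ truth X φ → headRegs (l ++ rest) 0 = 0) ∧
      AllOK X rest := by
  induction φ generalizing l rest with
  | eqZero p =>
    obtain ⟨r, l, rfl, htl⟩ := map_fst_eq_cons hl
    obtain ⟨h₁, h₂⟩ := allOK_cons_append.1 h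
    obtain ⟨i₀, -, -, i₃⟩ := sound_poly p l rest htl h₂
    simp only [LocalOK, equations, Ex.eval, localEnv, List.mem_cons, List.not_mem_nil,
      forall_eq_or_imp, Ex.eval_sub, false_imp_iff, implies_true, and_true,
      Int.cast_one, mul_eq_zero] at h₁
    rw [i₀] at h₁
    change (polyVal X p = 0 → r 0 = 1) ∧ (¬ polyVal X p = 0 → r 0 = 0) ∧ _
    refine ⟨fun h => ?_, fun h => ?_, i₃⟩
    · rcases h₁.2 with h' | h'
      · linarith
      · rw [h] at h'; norm_num at h'
    · exact h₁.1.resolve_right h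
  | nonneg p =>
    obtain ⟨r, l, rfl, htl⟩ := map_fst_eq_cons hl
    obtain ⟨h₁, h₂⟩ := allOK_cons_append.1 h
    obtain ⟨i₀, -, -, i₃⟩ := sound_poly p l rest htl h₂
    simp only [LocalOK, equations, Ex.eval, localEnv, List.mem_cons, List.not_mem_nil,
      forall_eq_or_imp, Ex.eval_sub, false_imp_iff, implies_true, and_true,
      Int.cast_one, mul_eq_zero] at h₁
    rw [i₀] at h₁
    change (0 ≤ polyVal X p → r 0 = 1) ∧ (¬ 0 ≤ polyVal X p → r 0 = 0) ∧ _
    refine ⟨fun h => ?_, fun h => ?_, i₃⟩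
    · rcases h₁.2 with h' | h'
      · linarith
      · have := mul_nonneg h (mul_self_nonneg (r 1)); linarith
    · refine h₁.1.resolve_right fun h' => h ?_
      have := mul_self_nonneg (r 1); linarith
  | pos p =>
    obtain ⟨r, l, rfl, htl⟩ := map_fst_eq_cons hl
    obtain ⟨h₁, h₂⟩ := allOK_cons_append.1 h
    obtain ⟨i₀, -, -, i₃⟩ := sound_poly p l rest htl h₂
    simp only [LocalOK, equations, Ex.eval, localEnv, List.mem_cons, List.not_mem_nil,
      forall_eq_or_imp, Ex.eval_sub, false_imp_iff, implies_true, and_true,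
      Int.cast_one, mul_eq_zero] at h₁
    rw [i₀] at h₁
    change (0 < polyVal X p → r 0 = 1) ∧ (¬ 0 < polyVal X p → r 0 = 0) ∧ _
    refine ⟨fun h => ?_, fun h => ?_, i₃⟩
    · rcases h₁.2 with h' | h'
      · linarith
      · have := mul_self_nonneg (r 1); linarith
    · refine h₁.1.resolve_right fun h' => ?_
      nlinarith [mul_self_nonneg (r 1)]
  | not φ ih =>
    obtain ⟨r, l, rfl, htl⟩ := map_fst_eq_cons hl
    obtain ⟨h₁, h₂⟩ := allOK_cons_append.1 h
    obtain ⟨i₀, i₁, i₂⟩ := ih l rest htl h₂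
    simp only [LocalOK, equations, Ex.eval, localEnv, List.mem_cons, List.not_mem_nil,
      forall_eq, or_false, Ex.eval_sub, sub_eq_zero, Int.cast_one] at h₁
    change (¬ truth X φ → r 0 = 1) ∧ (¬¬ truth X φ → r 0 = 0) ∧ _
    exact ⟨fun h => by rw [h₁, i₁ h, sub_zero],
      fun h => by rw [h₁, i₀ (not_not.1 h), sub_self], i₂⟩
  | and φ ψ ihφ ihψ =>
    obtain ⟨r, l, rfl, htl⟩ := map_fst_eq_cons hl
    obtain ⟨h₁, h₂⟩ := allOK_cons_append.1 h
    obtain ⟨l₁, l₂, rfl, hl₁, hl₂⟩ := List.map_eq_append_iff.1 htl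
    rw [List.append_assoc] at h₂
    obtain ⟨i₀, i₁, i₂⟩ := ihφ l₁ (l₂ ++ rest) hl₁ h₂
    obtain ⟨j₀, j₁, j₂⟩ := ihψ l₂ rest hl₂ i₂
    obtain ⟨b, w, hw, hb⟩ := exists_roleFormula_eq_cons ψ
    obtain ⟨r', l₂, rfl, -⟩ := map_fst_eq_cons (hl₂.trans hw)
    simp only [LocalOK, equations, Ex.eval, localEnv, List.mem_cons, List.not_mem_nil,
      forall_eq, or_false, Ex.eval_sub, sub_eq_zero, List.append_assoc, List.cons_append,
      operandRegs_formula φ l₁ (b, r') (l₂ ++ rest) hl₁ hb] at h₁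
    simp only [List.cons_append] at i₀ i₁ j₀ j₁
    refine ⟨fun h => ?_, fun h => ?_, j₂⟩
    · change r 0 = 1
      rw [h₁, i₀ h.1, one_mul]
      exact j₀ h.2
    · change r 0 = 0
      rw [h₁, mul_eq_zero]
      by_cases h' : truth X φ
      · exact .inr (j₁ fun h'' => h ⟨h', h''⟩)
      · exact .inl (i₁ h')
  | or φ ψ ihφ ihψ =>
    obtain ⟨r, l, rfl, htl⟩ := map_fst_eq_cons hl
    obtain ⟨h₁, h₂⟩ := allOK_cons_append.1 h
    obtain ⟨l₁, l₂, rfl, hl₁, hl₂⟩ := List.map_eq_append_iff.1 htl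
    rw [List.append_assoc] at h₂
    obtain ⟨i₀, i₁, i₂⟩ := ihφ l₁ (l₂ ++ rest) hl₁ h₂
    obtain ⟨j₀, j₁, j₂⟩ := ihψ l₂ rest hl₂ i₂
    obtain ⟨b, w, hw, hb⟩ := exists_roleFormula_eq_cons ψ
    obtain ⟨r', l₂, rfl, -⟩ := map_fst_eq_cons (hl₂.trans hw)
    simp only [LocalOK, equations, Ex.eval, localEnv, List.mem_cons, List.not_mem_nil,
      forall_eq, or_false, Ex.eval_sub, sub_eq_zero, List.append_assoc, List.cons_append,
      operandRegs_formula φ l₁ (b, r') (l₂ ++ rest) hl₁ hb] at h₁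
    simp only [List.cons_append] at i₀ i₁ j₀ j₁
    change truth X ψ → r' 0 = 1 at j₀
    change ¬ truth X ψ → r' 0 = 0 at j₁
    change (truth X φ ∨ truth X ψ → r 0 = 1) ∧ (¬ (truth X φ ∨ truth X ψ) → r 0 = 0) ∧ _
    refine ⟨fun h => ?_, fun h => ?_, j₂⟩
    · rw [h₁]
      rcases h with h | h
      · rw [i₀ h]; ring
      · rw [j₀ h]; ring
    · rw [not_or] at h
      rw [h₁, i₁ h.1, j₁ h.2]; ring

end

end ContinuousClustering

namespace ContinuousClustering

open Turing Turing.Spread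

/-! ### The truth of the formula -/

theorem aeval_toPoly {d : ℕ} (x : Fin d → ℝ) (p : PolyCode d) :
    MvPolynomial.aeval x p.toPoly = (p.map fun t => (t.1 : ℝ) * ∏ i, x i ^ t.2 i).sum := by
  rw [PolyCode.toPoly, map_list_sum, List.map_map]
  congr 2
  funext t
  rw [Function.comp_apply, MvPolynomial.aeval_monomial, Finsupp.prod_fintype _ _ (by simp)]
  simp

/-- Bases are indexed by the number of exponents still to be closed, which for the i-th of d
exponents (from 0) is d - i. -/
theorem monVal_ofFn (X : ℕ → Regs) {d : ℕ} (e : Fin d → ℕ) :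
    monVal X (List.ofFn e) = ∏ i : Fin d, X (d - i) 0 ^ e i := by
  induction d with
  | zero => simp [monVal]
  | succ d ih => rw [List.ofFn_succ, monVal, ih, Fin.prod_univ_succ]; simp

theorem polyVal_eq (X : ℕ → Regs) {d : ℕ} (p : PolyCode d) :
    polyVal X p = MvPolynomial.aeval (fun i : Fin d => X (d - i) 0) p.toPoly := by
  rw [aeval_toPoly]
  induction p with
  | nil => rfl
  | cons t p ih => rw [polyVal, ih, monVal_ofFn, List.map_cons, List.sum_cons, add_comm]

theorem truth_iff (X : ℕ → Regs) {n : ℕ} (φ : QFFormula n) :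
    truth X φ ↔ φ.Holds fun i => X (n - i) 0 := by
  induction φ with
  | eqZero p | nonneg p | pos p => rw [truth, polyVal_eq]; rfl
  | not φ ih => rw [truth, ih]; rfl
  | and φ ψ ihφ ihψ | or φ ψ ihφ ihψ => rw [truth, ihφ, ihψ]; rfl

/-! ### The values at the base -/

/-- Letters that are neither variables nor the end of the list of variables. -/
def Role.isBody (b : Role) : Prop := b ≠ .tick ∧ b ≠ .dimSep

theorem envOf_leftScan_skip (c : ℕ) (w w' : List Role) (vs vs' : List Regs)
    (hw : ∀ b ∈ w, b.isBody) (h : w.length = vs.length) :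
    envOf (leftScan false c (w ++ w')) (vs ++ vs') .base =
      envOf (leftScan false c w') vs' .base := by
  induction w generalizing vs with
  | nil =>
    obtain rfl := List.length_eq_zero_iff.1 h.symm
    rfl
  | cons b w ih =>
    rw [List.forall_mem_cons] at hw
    obtain ⟨⟨h₁, h₂⟩, h₃⟩ := hw
    cases vs with
    | nil => simp at h
    | cons v vs =>
      rw [List.cons_append, List.cons_append, leftScan, envOf_cons]
      simp [h₁, h₂, ih vs h₃ (by simpa using h)]

/-- Only ticks and `dimSep` affect the search for the base, so within the formula the registers of
the variables can be treated as one fixed family `X`. -/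
theorem baseRegs_append (u pre : List Cell) (h : ∀ x ∈ pre, x.1.isBody) (c : ℕ) :
    baseRegs (u ++ pre) c = baseRegs u c := by
  rw [baseRegs, List.map_append, List.map_append, List.reverse_append, List.reverse_append,
    envOf_leftScan_skip _ _ _ _ _ _ (by simp)]
  · rfl
  · intro b hb
    simp only [List.mem_reverse, List.mem_map] at hb
    obtain ⟨x, hx, rfl⟩ := hb
    exact h x hx

theorem not_mem_leftScan_true (K : Kind) (c : ℕ) (l : List Role) :
    some K ∉ leftScan true c l := by
  induction l generalizing c with
  | nil => simp [leftScan]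
  | cons b l ih => simp [leftScan, ih]

theorem envOf_leftScan_ticks (m n : ℕ) (w : List Role) (vs ws : List Regs) (hn : vs.length = n)
    (hm : m < vs.length) :
    envOf (leftScan false m (List.replicate n .tick ++ w)) (vs ++ ws) .base = vs[m] := by
  subst hn
  induction vs generalizing m with
  | nil => simp at hm
  | cons v vs ih =>
    rw [List.length_cons, List.replicate_succ, List.cons_append, List.cons_append, leftScan,
      envOf_cons]
    cases m with
    | zero => simp [envOf_eq_one (not_mem_leftScan_true _ _ _)]
    | succ m => simpa using ih m (by simpa using hm)

/-- The scan to the left starts with n - i; `dimSep` takes off one and each tick passed another one.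
With n - i - 1 left at the last tick, the counter reaches 0 at tick i. -/
theorem baseRegs_vars {n : ℕ} (x : Fin n → ℝ) (r₀ r₁ : Regs) (i : Fin n) :
    baseRegs ((Role.start, r₀) :: (List.ofFn x).map (fun c => (Role.tick, fun _ => c)) ++
      [(Role.dimSep, r₁)]) (n - i) 0 = x i := by
  have hlen : ((List.ofFn x).map fun c => (fun _ => c : Regs)).reverse.length = n := by simp
  have h := envOf_leftScan_ticks (n - i - 1) n [Role.start]
    ((List.ofFn x).map fun c => (fun _ => c : Regs)).reverse [r₀] hlen (by rw [hlen]; omega)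
  have h' : baseRegs ((Role.start, r₀) :: (List.ofFn x).map (fun c => (Role.tick, fun _ => c)) ++
      [(Role.dimSep, r₁)]) (n - i) = envOf (leftScan false (n - i - 1)
        (List.replicate n Role.tick ++ [Role.start]))
        (((List.ofFn x).map fun c => (fun _ => c : Regs)).reverse ++ [r₀]) .base := by
    simp only [baseRegs, List.map_append, List.map_cons, List.map_map, List.map_nil,
      List.reverse_append, List.reverse_cons, List.reverse_nil, List.nil_append,
      List.singleton_append, leftScan, envOf_cons]
    simp [Function.comp_def]
  rw [h', h, List.getElem_reverse]
  simp only [List.length_map, List.length_ofFn, List.getElem_map, List.getElem_ofFn]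
  congr 1
  ext
  simp only
  omega

/-! ### The value of the polynomial -/

/-- The equations of the letters of `l`, where `l` is preceded by `u`. -/
def Good : List Cell → List Cell → Prop
  | _, [] => True
  | u, x :: l => LocalOK (baseRegs u) x.1 x.2 l ∧ Good (u ++ [x]) l

theorem good_iff_allOK (u pre l : List Cell) (hpre : ∀ x ∈ pre, x.1.isBody)
    (hl : ∀ x ∈ l, x.1.isBody) : Good (u ++ pre) l ↔ AllOK (baseRegs u) l := by
  induction l generalizing pre with
  | nil => rfl
  | cons x l ih =>
    rw [List.forall_mem_cons] at hl
    rw [Good, AllOK, funext (baseRegs_append u pre hpre), List.append_assoc,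
      ih (pre ++ [x]) (fun y hy => ?_) hl.2]
    rcases List.mem_append.1 hy with hy | hy
    · exact hpre y hy
    · rw [List.mem_singleton.1 hy]; exact hl.1

theorem good_of_equations_eq_nil (u pre l : List Cell) (h : ∀ x ∈ pre, equations x.1 = []) :
    Good u (pre ++ l) ↔ Good (u ++ pre) l := by
  induction pre generalizing u with
  | nil => simp
  | cons x pre ih =>
    rw [List.forall_mem_cons] at h
    rw [List.cons_append, Good, ih _ h.2, List.append_assoc]
    simp [LocalOK, h.1]

/-- The sum of the contributions of the letters of `l`, where `l` is preceded by `u`. -/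
def total (k : ℕ) : List Cell → List Cell → ℝ
  | _, [] => 0
  | u, x :: l => total k (u ++ [x]) l + (summand k x.1).eval (localEnv (baseRegs u) x.2 l)

theorem eval_summand {k : ℕ} {a : Role} (ha : a ≠ .start) (env : Kind → Regs) :
    (summand k a).eval env = - (Ex.sumSq (equations a)).eval env := by
  cases a <;> first | exact absurd rfl ha | simp [summand, Ex.eval]

/-- Every letter other than `start` contributes minus a sum of squares, so the total reaches 0 only
if all equations hold. -/
theorem total_nonpos (k : ℕ) (u l : List Cell) (hl : ∀ x ∈ l, x.1 ≠ .start) :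
    total k u l ≤ 0 ∧ (0 ≤ total k u l ↔ Good u l) := by
  induction l generalizing u with
  | nil => simp [total, Good]
  | cons x l ih =>
    rw [List.forall_mem_cons] at hl
    obtain ⟨h₁, h₂⟩ := ih (u ++ [x]) hl.2
    have h₃ := Ex.eval_sumSq_nonneg (localEnv (baseRegs u) x.2 l) (equations x.1)
    rw [total, eval_summand hl.1, Good, ← h₂, LocalOK, ← Ex.eval_sumSq_eq_zero]
    refine ⟨by linarith, fun h => ⟨by linarith, by linarith⟩, fun h => ?_⟩
    rw [h.1]
    linarith [h.2]

theorem one_le_total (k : ℕ) (r : Regs) (l : List Cell) (hl : ∀ x ∈ l, x.1 ≠ .start) :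
    1 ≤ total k [] ((.start, r) :: l) ↔ (∃ j < k, r 0 = (j : ℕ)) ∧ Good [(.start, r)] l := by
  obtain ⟨h₁, h₂⟩ := total_nonpos k [(.start, r)] l hl
  rw [← h₂]
  have h₃ := Ex.eval_levels_eq_zero (localEnv (baseRegs []) r l) k
  change _ ↔ ∃ j < k, r 0 = (j : ℕ) at h₃
  rw [← h₃, total, summand, Ex.eval_sub, Ex.eval, Ex.eval, List.nil_append]
  have h₄ := mul_self_nonneg ((Ex.levels k).eval (localEnv (baseRegs []) r l))
  push_cast
  refine ⟨fun h => ⟨mul_self_eq_zero.1 (by linarith), by linarith⟩, fun h => ?_⟩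
  rw [h.1]
  linarith [h.2]

/-! ### The monomials -/

/-- A word with a chosen position and the index of a monomial. -/
structure Pick (n : ℕ) where
  /-- the letters before the position -/
  pre : List Role
  /-- the letter at the position -/
  letter : Role
  /-- the index of the monomial -/
  tag : Fin (n + 1)
  /-- the letters after the position -/
  post : List Role

/-- The words `u ++ v` with a chosen position in `v`, the last position first. -/
def picks (n : ℕ) : List Role → List Role → List (Pick n)
  | _, [] => []
  | u, a :: v => picks n (u ++ [a]) v ++
      (List.range (n + 1)).map fun i => ⟨u, a, Fin.ofNat (n + 1) i, v⟩

theorem pre_append_of_mem_picks {n : ℕ} {u v : List Role} {p : Pick n} (h : p ∈ picks n u v) :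
    p.pre ++ p.letter :: p.post = u ++ v := by
  induction v generalizing u with
  | nil => simp [picks] at h
  | cons a v ih =>
    rw [picks, List.mem_append, List.mem_map] at h
    rcases h with h | ⟨i, -, rfl⟩
    · simpa using ih h
    · rfl

/-- The exponents of the monomial in the variables of all positions. -/
def exponents (L : ℕ) (ks : List (Option Kind)) (E : Kind → Fin 3 → ℕ) (i : Fin (L * 3)) : ℕ :=
  (ks.getD (finProdFinEquiv.symm i).1 none).elim 0 fun K => E K (finProdFinEquiv.symm i).2

/-- The values at the positions. -/
def regsOf (L : ℕ) (x : Fin (L * 3) → ℝ) : List Regs :=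
  List.ofFn fun p : Fin L => fun n => x (finProdFinEquiv (p, n))

theorem prod_getD_eq_zipWith {α β M : Type*} [CommMonoid M] (g : α → β → M) (z : α) (ks : List α)
    {L : ℕ} (vs : Fin L → β) (h : ks.length = L) :
    ∏ p : Fin L, g (ks.getD p z) (vs p) = (List.zipWith g ks (List.ofFn vs)).prod := by
  induction ks generalizing L with
  | nil => subst h; simp
  | cons k ks ih =>
    obtain rfl : L = ks.length + 1 := h.symm
    rw [Fin.prod_univ_succ, List.ofFn_succ, List.zipWith_cons_cons,
      List.prod_cons, ← ih _ rfl]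
    simp

/-- Grouping the positions by kind works because `envOf` is itself a product over all positions of a
kind; no uniqueness of such positions is needed. -/
theorem prod_zipWith_eq (E : Kind → Fin 3 → ℕ) (ks : List (Option Kind)) (vs : List Regs) :
    (List.zipWith (fun (k : Option Kind) (r : Regs) => ∏ n, r n ^ k.elim 0 fun K => E K n)
      ks vs).prod = ∏ K, ∏ n, envOf ks vs K n ^ E K n := by
  induction ks generalizing vs with
  | nil => simp [envOf]
  | cons k ks ih =>
    cases vs with
    | nil => simp [envOf]
    | cons r vs =>
      rw [List.zipWith_cons_cons, List.prod_cons, ih]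
      simp only [envOf_cons, Pi.mul_apply, mul_pow, Finset.prod_mul_distrib]
      congr 1
      cases k with
      | none => simp
      | some K₀ =>
        rw [Finset.prod_eq_single K₀]
        · simp
        · intro K _ hK
          simp [Ne.symm hK]
        · simp

theorem prod_exponents {L : ℕ} (ks : List (Option Kind)) (hks : ks.length = L)
    (E : Kind → Fin 3 → ℕ) (x : Fin (L * 3) → ℝ) :
    ∏ i, x i ^ exponents L ks E i = ∏ K, ∏ n, envOf ks (regsOf L x) K n ^ E K n := by
  rw [← prod_zipWith_eq, regsOf, ← prod_getD_eq_zipWith _ none _ _ hks,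
    ← Fintype.prod_prod_type']
  exact (Fintype.prod_equiv finProdFinEquiv _ _ fun q => by simp [exponents]).symm

/-- The monomial of a pick. -/
def Pick.term (k L : ℕ) (p : Pick (width k)) : ℤ × (Fin (L * 3) → ℕ) :=
  ((monoAt k p.letter p.tag).1, exponents L (kinds p.pre p.post) (monoAt k p.letter p.tag).2)

theorem sum_picks (k : ℕ) (u l : List Cell) :
    ((picks (width k) (u.map Prod.fst) (l.map Prod.fst)).map fun p =>
      (monoAt k p.letter p.tag).eval
        (envOf (kinds p.pre p.post) (u.map Prod.snd ++ l.map Prod.snd))).sum = total k u l := by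
  induction l generalizing u with
  | nil => rfl
  | cons x l ih =>
    have h := ih (u ++ [x])
    simp only [List.map_append, List.map_cons, List.map_nil, List.append_assoc,
      List.singleton_append] at h
    rw [List.map_cons, List.map_cons, picks, List.map_append, List.sum_append, h, total,
      ← sum_monoAt, List.map_map, ← envOf_kinds]
    refine congrArg₂ (· + ·) rfl (congrArg List.sum (List.map_congr_left fun i hi => ?_))
    have hi' : (Fin.ofNat (width k + 1) i : ℕ) = i := Nat.mod_eq_of_lt (List.mem_range.1 hi)
    rw [Function.comp_apply, hi']

theorem aeval_picks (k : ℕ) (l : List Cell) (x : Fin (l.length * 3) → ℝ)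
    (hx : l.map Prod.snd = regsOf l.length x) :
    MvPolynomial.aeval x (PolyCode.toPoly
      ((picks (width k) [] (l.map Prod.fst)).map (Pick.term k l.length))) = total k [] l := by
  rw [← sum_picks, aeval_toPoly, List.map_map]
  congr 1
  refine List.map_congr_left fun p hp => ?_
  have hlen : (kinds p.pre p.post).length = l.length := by
    rw [length_kinds p.pre p.post p.letter, pre_append_of_mem_picks hp]; simp
  simp only [Function.comp_apply, Pick.term, prod_exponents _ hlen, Mono.eval, List.map_nil,
    List.nil_append, hx]

end ContinuousClustering

namespace ContinuousClustering

open Turing Turing.Spread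

/-! ### The reduction -/

/-- The instance of component counting for an existential sentence. -/
def reduction (k : ℕ) (s : ExistsSentence) : LevelInstance where
  d := (roleWord s).length * 3
  f := (picks (width k) [] (roleWord s)).tail.map (Pick.term k (roleWord s).length)
  θ := 1
  θ_pos := one_pos

/-- The first pick is the last letter with tag 0, and no later pick has this letter and tag unless
the letter recurs. Applied to `finish`, this lets a machine recognise the first copy of the word by
letter and tag and write the header there. -/
theorem picks_append_singleton (n : ℕ) (u v : List Role) (a : Role) :
    ∃ ps, picks n u (v ++ [a]) = ⟨u ++ v, a, 0, []⟩ :: ps ∧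
      ∀ p ∈ ps, p.letter = a → p.tag = 0 → a ∈ v := by
  induction v generalizing u with
  | nil =>
    refine ⟨(List.range n).map fun i => ⟨u, a, Fin.ofNat (n + 1) (i + 1), []⟩, ?_, ?_⟩
    · simp only [List.nil_append, picks, List.range_succ_eq_map, List.map_cons, List.map_map,
        List.append_nil]
      rfl
    · intro p hp _ h
      obtain ⟨i, hi, rfl⟩ := List.mem_map.1 hp
      have h' := congrArg Fin.val h
      simp only [Fin.ofNat_eq_cast, Fin.val_natCast, Fin.coe_ofNat_eq_mod, Nat.zero_mod] at h'
      rw [Nat.mod_eq_of_lt (by have := List.mem_range.1 hi; omega)] at h'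
      omega
  | cons b v ih =>
    obtain ⟨ps, h, h'⟩ := ih (u ++ [b])
    refine ⟨ps ++ (List.range (n + 1)).map fun i => ⟨u, b, Fin.ofNat (n + 1) i, v ++ [a]⟩, ?_, ?_⟩
    · rw [List.cons_append, picks, h]; simp
    · intro p hp h₁ h₂
      rcases List.mem_append.1 hp with hp | hp
      · exact List.mem_cons_of_mem _ (h' p hp h₁ h₂)
      · obtain ⟨i, -, rfl⟩ := List.mem_map.1 hp
        exact h₁ ▸ List.mem_cons_self

/-- Letters that occur in formulas. -/
def Role.isInner (b : Role) : Prop := b ≠ .start ∧ b ≠ .tick ∧ b ≠ .dimSep ∧ b ≠ .finish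

theorem isInner_rolePoly {d : ℕ} (p : PolyCode d) : ∀ b ∈ rolePoly p, b.isInner := by
  intro b hb
  simp only [rolePoly, roleTerm, List.cons_append, List.mem_cons, List.mem_append, List.mem_map,
    List.mem_flatMap, List.not_mem_nil, or_false] at hb
  rcases hb with ⟨t, -, rfl | (hb | ⟨_, _, rfl⟩ | rfl) | ⟨_, _, ⟨_, _, rfl⟩ | rfl⟩⟩ | rfl
  · simp [Role.isInner]
  · split_ifs at hb <;> simp at hb; subst hb; simp [Role.isInner]
  all_goals simp [Role.isInner]

theorem isInner_roleFormula {n : ℕ} (φ : QFFormula n) : ∀ b ∈ roleFormula φ, b.isInner := by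
  induction φ with
  | eqZero p | nonneg p | pos p =>
    exact List.forall_mem_cons.2 ⟨by simp [Role.isInner], isInner_rolePoly p⟩
  | not φ ih => exact List.forall_mem_cons.2 ⟨by simp [Role.isInner], ih⟩
  | and φ ψ ihφ ihψ | or φ ψ ihφ ihψ =>
    exact List.forall_mem_cons.2 ⟨by simp [Role.isInner],
      List.forall_mem_append.2 ⟨ihφ, ihψ⟩⟩

theorem exists_roleWord_eq (s : ExistsSentence) :
    ∃ w, roleWord s = Role.start :: w ++ [Role.finish] ∧ Role.start ∉ w ∧ Role.finish ∉ w := by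
  refine ⟨List.replicate s.n .tick ++ .dimSep :: roleFormula s.matrix, by simp [roleWord], ?_, ?_⟩
  · simp only [List.mem_append, List.mem_replicate, List.mem_cons, not_or, reduceCtorEq, and_false,
      not_false_eq_true, true_and]
    exact fun h => (isInner_roleFormula _ _ h).1 rfl
  · simp only [List.mem_append, List.mem_replicate, List.mem_cons, not_or, reduceCtorEq, and_false,
      not_false_eq_true, true_and]
    exact fun h => (isInner_roleFormula _ _ h).2.2.2 rfl

/-- The first copy of the word is spent on the header, so the polynomial loses the corresponding
term (`tail` in `reduction`). Its coefficient is 0, hence the value is unchanged. -/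
theorem monoAt_finish_zero (k : ℕ) : (monoAt k .finish 0).1 = 0 := by
  simp [monoAt, summand, Ex.sub, equations, Ex.sumSq, Ex.expand]

theorem aeval_reduction (k : ℕ) (s : ExistsSentence) (l : List Cell)
    (hl : l.map Prod.fst = roleWord s) (x : Fin ((roleWord s).length * 3) → ℝ)
    (hx : l.map Prod.snd = regsOf (roleWord s).length x) :
    MvPolynomial.aeval x (reduction k s).f.toPoly = total k [] l := by
  have h : ∀ L, (roleWord s).length = L → ∀ x : Fin (L * 3) → ℝ, l.map Prod.snd = regsOf L x →
      MvPolynomial.aeval x (PolyCode.toPoly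
        ((picks (width k) [] (roleWord s)).tail.map (Pick.term k L))) = total k [] l := by
    rintro L hL x hx
    obtain rfl : L = l.length := by rw [← hL, ← hl, List.length_map]
    rw [← aeval_picks k l x hx, hl]
    obtain ⟨w, hw, -⟩ := exists_roleWord_eq s
    obtain ⟨ps, hps, -⟩ := picks_append_singleton (width k) [] (Role.start :: w) .finish
    rw [hw, hps, List.tail_cons, aeval_toPoly, aeval_toPoly, List.map_cons, List.map_cons,
      List.sum_cons]
    have h0 : (Pick.term k l.length ⟨[] ++ Role.start :: w, .finish, 0, []⟩).1 = 0 :=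
      monoAt_finish_zero k
    rw [h0, Int.cast_zero, zero_mul, zero_add]
  exact h _ rfl x hx

/-- Ticks impose nothing, `dimSep` demands that the formula has value 1, and behind it the base
registers no longer depend on the position. -/
theorem good_word {n : ℕ} (φ : QFFormula n) (r₀ r₁ : Regs) (t l : List Cell)
    (ht : ∀ x ∈ t, x.1 = .tick) (hl : l.map Prod.fst = roleFormula φ ++ [.finish]) :
    Good [(.start, r₀)] (t ++ (.dimSep, r₁) :: l) ↔
      headRegs l 0 = 1 ∧ AllOK (baseRegs ((.start, r₀) :: t ++ [(.dimSep, r₁)])) l := by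
  rw [good_of_equations_eq_nil _ _ _ fun x hx => by rw [ht x hx]; rfl, Good]
  refine and_congr ?_ ?_
  · simp [LocalOK, equations, Ex.eval, localEnv, sub_eq_zero]
  · have h := good_iff_allOK ([(.start, r₀)] ++ t ++ [(.dimSep, r₁)]) [] l (by simp) fun x hx => ?_
    · simpa using h
    · have hx' : x.1 ∈ roleFormula φ ++ [.finish] := hl ▸ List.mem_map_of_mem hx
      rcases List.mem_append.1 hx' with h | h
      · exact ⟨(isInner_roleFormula φ _ h).2.1, (isInner_roleFormula φ _ h).2.2.1⟩
      · rw [List.mem_singleton.1 h]; simp [Role.isBody]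

theorem one_le_total_word (k : ℕ) {n : ℕ} (φ : QFFormula n) (r₀ r₁ : Regs) (t l : List Cell)
    (ht : ∀ x ∈ t, x.1 = .tick) (hl : l.map Prod.fst = roleFormula φ ++ [.finish]) :
    1 ≤ total k [] ((.start, r₀) :: (t ++ (.dimSep, r₁) :: l)) ↔ (∃ j < k, r₀ 0 = (j : ℕ)) ∧
      headRegs l 0 = 1 ∧ AllOK (baseRegs ((.start, r₀) :: t ++ [(.dimSep, r₁)])) l := by
  rw [one_le_total, good_word φ r₀ r₁ t l ht hl]
  intro x hx
  rcases List.mem_append.1 hx with hx | hx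
  · simp [ht x hx]
  · rcases List.mem_cons.1 hx with rfl | hx
    · simp
    · have hx' : x.1 ∈ roleFormula φ ++ [.finish] := hl ▸ List.mem_map_of_mem hx
      rcases List.mem_append.1 hx' with h | h
      · exact (isInner_roleFormula φ _ h).1
      · rw [List.mem_singleton.1 h]; simp

theorem truth_of_allOK {X : ℕ → Regs} {n : ℕ} (φ : QFFormula n) (l : List Cell)
    (hl : l.map Prod.fst = roleFormula φ ++ [.finish]) (h : AllOK X l) :
    headRegs l 0 = 1 ↔ φ.Holds fun i => X (n - i) 0 := by
  obtain ⟨l₁, l₂, rfl, h₁, -⟩ := List.map_eq_append_iff.1 hl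
  obtain ⟨h₂, h₃, -⟩ := sound_formula φ l₁ l₂ h₁ h
  rw [← truth_iff]
  refine ⟨fun h => ?_, h₂⟩
  by_contra h'
  rw [h₃ h'] at h
  norm_num at h

/-- The index of the first value at the first position. -/
def firstIndex (s : ExistsSentence) : Fin ((roleWord s).length * 3) :=
  finProdFinEquiv (⟨0, by simp [roleWord]⟩, 0)

theorem exists_of_mem_superLevel {k : ℕ} {s : ExistsSentence}
    {x : Fin ((roleWord s).length * 3) → ℝ}
    (hx : x ∈ superLevel (reduction k s).f.toPoly ((reduction k s).θ : ℝ)) :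
    (∃ y : Fin s.n → ℝ, s.matrix.Holds y) ∧ ∃ j < k, x (firstIndex s) = (j : ℕ) := by
  have hlen : (roleWord s).length = (regsOf (roleWord s).length x).length := by simp [regsOf]
  have h₁ : ((roleWord s).zip (regsOf (roleWord s).length x)).map Prod.fst = roleWord s :=
    List.map_fst_zip hlen.le
  have h₂ : ((roleWord s).zip (regsOf (roleWord s).length x)).map Prod.snd =
    regsOf (roleWord s).length x := List.map_snd_zip hlen.ge
  generalize (roleWord s).zip (regsOf (roleWord s).length x) = l at h₁ h₂
  have hx' : ((1 : ℚ) : ℝ) ≤ MvPolynomial.aeval x (reduction k s).f.toPoly := hx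
  rw [aeval_reduction k s l h₁ x h₂, Rat.cast_one] at hx'
  obtain ⟨r₀, l, rfl, hl₁⟩ := map_fst_eq_cons h₁
  obtain ⟨t, l, rfl, ht, hl₂⟩ := List.map_eq_append_iff.1 hl₁
  obtain ⟨r₁, l, rfl, hl⟩ := map_fst_eq_cons hl₂
  obtain ⟨hj, h, hA⟩ := (one_le_total_word k s.matrix r₀ r₁ t l (fun x hx =>
    (List.mem_replicate.1 (ht ▸ List.mem_map_of_mem hx)).2) hl).1 hx'
  refine ⟨⟨_, (truth_of_allOK _ _ hl hA).1 h⟩, ?_⟩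
  have : r₀ 0 = x (firstIndex s) := by
    have h := congrArg (fun l => (l.head?.getD 0) 0) h₂
    simpa [regsOf, roleWord, List.ofFn_succ, firstIndex] using h
  rwa [← this]

/-- Place j in the register of `start` and y in the ticks, then solve the equations of the formula
from right to left; j is free since no other equation sees it. -/
theorem exists_mem_superLevel {k : ℕ} {s : ExistsSentence} {y : Fin s.n → ℝ}
    (hy : s.matrix.Holds y) {j : ℕ} (hj : j < k) :
    ∃ x ∈ superLevel (reduction k s).f.toPoly ((reduction k s).θ : ℝ),
      x (firstIndex s) = (j : ℕ) := by
  obtain ⟨l, hl, hA⟩ := exists_allOK (baseRegs ((Role.start, fun _ => (j : ℝ)) ::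
    (List.ofFn y).map (fun c => (Role.tick, fun _ => c)) ++ [(Role.dimSep, 0)]))
    (roleFormula s.matrix ++ [.finish]) (by
      simp only [List.mem_append, List.mem_singleton, reduceCtorEq, or_false]
      exact fun h => (isInner_roleFormula _ _ h).2.2.1 rfl)
  have h := (truth_of_allOK _ _ hl hA).2 (by simpa only [baseRegs_vars] using hy)
  have h' := (one_le_total_word k s.matrix (fun _ => (j : ℝ)) 0
    ((List.ofFn y).map fun c => (Role.tick, fun _ => c)) l (by simp) hl).2 ⟨⟨j, hj, rfl⟩, h, hA⟩
  generalize hw : (Role.start, fun _ : Fin 3 => (j : ℝ)) ::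
    ((List.ofFn y).map (fun c => (Role.tick, fun _ : Fin 3 => c)) ++
      (Role.dimSep, (0 : Regs)) :: l) = w at h'
  have hw₁ : w.map Prod.fst = roleWord s := by
    rw [← hw]
    simp [hl, roleWord, Function.comp_def]
  have hlen : w.length = (roleWord s).length := by rw [← hw₁, List.length_map]
  let x : Fin ((roleWord s).length * 3) → ℝ := fun i =>
    (w.map Prod.snd).getD (finProdFinEquiv.symm i).1 0 (finProdFinEquiv.symm i).2
  have hw₂ : w.map Prod.snd = regsOf (roleWord s).length x := by
    refine List.ext_getElem (by simp [regsOf, hlen]) fun i h₁ h₂ => ?_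
    have : i < w.length := by simpa using h₁
    simp only [regsOf, x, List.getElem_ofFn, Equiv.symm_apply_apply]
    simp [this]
  refine ⟨x, ?_, ?_⟩
  · change ((1 : ℚ) : ℝ) ≤ MvPolynomial.aeval x (reduction k s).f.toPoly
    rwa [aeval_reduction k s w hw₁ x hw₂, Rat.cast_one]
  · simp [x, firstIndex, ← hw]

theorem reduction_correct {k : ℕ} (hk : 1 ≤ k) (s : ExistsSentence) :
    ETR.Yes s ↔ (CLSC k).Yes (reduction k s) := by
  constructor
  · rintro ⟨y, hy⟩
    -- A finite subset of ℝ, hence discrete; the first register of `start` is a continuous map onto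
    -- it.
    let D := Set.range fun j : Fin k => ((j : ℕ) : ℝ)
    let S : Set (Fin ((roleWord s).length * 3) → ℝ) :=
      superLevel (reduction k s).f.toPoly ((reduction k s).θ : ℝ)
    let g : S → D := fun x =>
      ⟨x.1 (firstIndex s), by
        obtain ⟨j, hj, h⟩ := (exists_of_mem_superLevel x.2).2
        exact ⟨⟨j, hj⟩, h.symm⟩⟩
    have hg : Continuous g :=
      ((continuous_apply (firstIndex s)).comp continuous_subtype_val).subtype_mk _
    have hs : Function.Surjective g := by
      rintro ⟨_, j, rfl⟩
      obtain ⟨x, hx, h⟩ := exists_mem_superLevel hy j.2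
      exact ⟨⟨x, hx⟩, Subtype.ext h⟩
    have hD : ENat.card D = k := by
      rw [← ENat.card_congr (Equiv.ofInjective (fun j : Fin k => ((j : ℕ) : ℝ))
        (Nat.cast_injective.comp Fin.val_injective))]
      simp
    have h := card_le_numComponents hg hs
    rwa [hD] at h
  · intro h
    obtain ⟨x, hx⟩ := nonempty_of_le_numComponents hk h
    exact (exists_of_mem_superLevel hx).1

end ContinuousClustering

/-- A machine only sees words, so it suffices to compute the correct output on words that encode
instances. -/
theorem Turing.PolyTime.of_words {α β αΓ βΓ : Type} {ea : α → List αΓ} {eb : β → List βΓ}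
    {f : α → β} {F : List αΓ → List βΓ} (hF : Turing.PolyTime id id F)
    (h : ∀ a, F (ea a) = eb (f a)) : Turing.PolyTime ea eb f := by
  obtain ⟨c⟩ := hF
  exact ⟨⟨c.toTM2ComputableAux, c.time, fun a => h a ▸ c.outputsFun (ea a)⟩⟩

namespace ContinuousClustering

open Turing Turing.Spread

/-! ### Annotating the letters -/

/-- The context of a letter of the word of a sentence. -/
inductive Context
  | first
  | dim
  | coef
  | other
  deriving DecidableEq

instance : Fintype Context := ⟨{.first, .dim, .coef, .other}, fun x => by cases x <;> simp⟩

/-- The context of the next letter. -/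
def Context.next (q : Context) : Sym → Context
  | .tick => .dim
  | .sep => .other
  | .term => .coef
  | _ => q

/-- The role of a letter in a context. -/
def Context.role (q : Context) : Sym → Role
  | .bit b => if q = .coef then .coefBit b else .expBit b
  | .tick => .tick
  | .minus => .minus
  | .sep => match q with
    | .first | .dim => .dimSep
    | .coef => .coefSep
    | .other => .expSep
  | .term => .term
  | .endPoly => .endPoly
  | .eqZero => .eqZero
  | .nonneg => .nonneg
  | .pos => .pos
  | .not => .not
  | .and => .and
  | .or => .or

/-- The transducer that annotates the letters of the word of a sentence. -/
def annotator : CounterTransducer Context Sym Role where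
  init := .first
  next q _ x := q.next x
  op _ _ _ := .keep
  out q _ x := (if q = .first then [.start] else []) ++ [q.role x]
  fin _ := [.finish]

/-- The annotated word from a context on. -/
abbrev annotate (q : Context) (l : List Sym) : List Role := annotator.run q 0 l

theorem annotate_cons (q : Context) (hq : q ≠ .first) (x : Sym) (l : List Sym) :
    annotate q (x :: l) = q.role x :: annotate (q.next x) l := by
  simp [annotate, CounterTransducer.run, annotator, hq, CounterOp.app]

theorem annotate_first (x : Sym) (l : List Sym) :
    annotate .first (x :: l) =
      .start :: Context.role .first x :: annotate (Context.next .first x) l := by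
  simp [annotate, CounterTransducer.run, annotator, CounterOp.app]

theorem annotate_coef (bs : List Bool) (l : List Sym) :
    annotate .coef (bs.map .bit ++ .sep :: l) =
      bs.map .coefBit ++ .coefSep :: annotate .other l := by
  induction bs with
  | nil => exact annotate_cons _ (by decide) _ _
  | cons b bs ih => exact (annotate_cons _ (by decide) _ _).trans (congrArg _ ih)

theorem annotate_exp (bs : List Bool) (l : List Sym) :
    annotate .other (bs.map .bit ++ .sep :: l) =
      bs.map .expBit ++ .expSep :: annotate .other l := by
  induction bs with
  | nil => exact annotate_cons _ (by decide) _ _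
  | cons b bs ih => exact (annotate_cons _ (by decide) _ _).trans (congrArg _ ih)

theorem annotate_exps (es : List ℕ) (l : List Sym) :
    annotate .other (encNats es ++ l) = (es.flatMap fun e =>
      (Computability.encodeNat e).map Role.expBit ++ [Role.expSep]) ++ annotate .other l := by
  induction es with
  | nil => rfl
  | cons e es ih =>
    rw [encNats, List.flatMap_cons, encNat, List.append_assoc, List.append_assoc,
      List.singleton_append, annotate_exp, List.flatMap_cons, List.append_assoc,
      List.append_assoc, List.singleton_append]
    exact congrArg (fun l => _ ++ _ :: l) ih

theorem annotate_term {d : ℕ} (t : ℤ × (Fin d → ℕ)) (l : List Sym) :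
    annotate .other (.term :: (encTerm t ++ l)) = roleTerm t ++ annotate .other l := by
  rw [annotate_cons _ (by decide)]
  simp only [Context.role, Context.next, encTerm, encInt, encNat, roleTerm, List.append_assoc,
    List.cons_append]
  congr 1
  split_ifs
  · rw [List.singleton_append, annotate_cons _ (by decide)]
    simp only [Context.role, Context.next, annotate_coef, annotate_exps, List.nil_append,
      List.singleton_append]
  · simp only [annotate_coef, annotate_exps, List.nil_append]

theorem annotate_poly {d : ℕ} (p : PolyCode d) (l : List Sym) :
    annotate .other (encPoly p ++ l) = rolePoly p ++ annotate .other l := by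
  induction p with
  | nil => exact annotate_cons _ (by decide) _ _
  | cons t p ih =>
    rw [encPoly, List.flatMap_cons, List.append_assoc, List.append_assoc, List.cons_append,
      annotate_term, rolePoly, List.flatMap_cons, List.append_assoc, List.append_assoc]
    rw [encPoly, rolePoly, List.append_assoc, List.append_assoc] at ih
    rw [ih]

theorem annotate_formula {n : ℕ} (φ : QFFormula n) (l : List Sym) :
    annotate .other (encFormula φ ++ l) = roleFormula φ ++ annotate .other l := by
  induction φ generalizing l with
  | eqZero p | nonneg p | pos p =>
    exact (annotate_cons _ (by decide) _ _).trans (congrArg _ (annotate_poly p l))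
  | not φ ih => exact (annotate_cons _ (by decide) _ _).trans (congrArg _ (ih l))
  | and φ ψ ihφ ihψ | or φ ψ ihφ ihψ =>
    rw [encFormula, roleFormula, List.cons_append, annotate_cons _ (by decide), List.append_assoc,
      List.cons_append, List.append_assoc, ← ihψ, ← ihφ]
    rfl

theorem annotate_dim (n : ℕ) (l : List Sym) :
    annotate .dim (encDim n ++ l) =
      List.replicate n .tick ++ .dimSep :: annotate .other l := by
  induction n with
  | zero => exact annotate_cons _ (by decide) _ _
  | succ n ih => exact (annotate_cons _ (by decide) _ _).trans (congrArg _ ih)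

theorem annotate_sentence (s : ExistsSentence) :
    annotate .first (encSentence s) = roleWord s := by
  have h : annotate .other (encFormula s.matrix) = roleFormula s.matrix ++ [.finish] := by
    have := annotate_formula s.matrix []
    rwa [List.append_nil] at this
  rw [roleWord, ← h, encSentence]
  generalize encFormula s.matrix = w
  cases s.n with
  | zero => exact annotate_first _ _
  | succ n => exact (annotate_first _ _).trans (congrArg (fun l => _ :: _ :: l) (annotate_dim n _))

/-! ### Annotating the positions that matter -/

theorem blocks_eq {n : ℕ} (u : List Role) (a : Role) (v : List Role) (i : ℕ) :
    blocks n u a v i = (List.range i).flatMap fun i => block u a (Fin.ofNat (n + 1) i) v := by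
  induction i with
  | zero => rfl
  | succ i ih => rw [blocks, ih, List.range_succ, List.flatMap_append]; simp

theorem spread_eq (n : ℕ) (u v : List Role) :
    spread n u v = (picks n u v).flatMap fun p => block p.pre p.letter p.tag p.post := by
  induction v generalizing u with
  | nil => rfl
  | cons a v ih => rw [spread, ih, blocks_eq, picks, List.flatMap_append, List.flatMap_map]

/-- A letter of a word in which a position is chosen, with its kind and whether it ends an exponent
of the current term. -/
abbrev Mark (n : ℕ) := Sight Role n × Option Kind × Bool

/-- The transducer that finds the positions that matter to the right of the chosen one. -/
def rightScanner (n : ℕ) : CounterTransducer Scan (Sight Role n) (Option (Mark n)) where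
  init := .init
  next q pos x := match x.2.1 with
    | .left => q
    | .self => .init
    | .right => q.next pos x.1
  op q _ x := match x.2.1 with
    | .left => .keep
    | .self => .reset
    | .right => q.op x.1
  out q _ x := match x.2.1 with
    | .left => [some (x, none, false)]
    | .self => [some (x, some .self, false)]
    | .right => [some (x, q.kind x.1, q.counts x.1)]
  fin _ := [none]

/-- The letters of a word with a chosen position, after the scan to the right. -/
def Pick.marks {n : ℕ} (p : Pick n) : List (Mark n) :=
  p.pre.map (fun b => ((b, .left, p.letter, p.tag), none, false)) ++
    ((p.letter, .self, p.letter, p.tag), some .self, false) ::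
    (p.post.zip (scan .init 0 p.post)).map fun x => ((x.1, .right, p.letter, p.tag), x.2)

theorem rightScanner_left {n : ℕ} (q : Scan) (c : ℕ) (u : List Role) (a : Role) (j : Fin (n + 1))
    (w : List (Sight Role n)) :
    (rightScanner n).run q c (u.map (fun b => (b, .left, a, j)) ++ w) =
      u.map (fun b => some ((b, .left, a, j), none, false)) ++ (rightScanner n).run q c w := by
  induction u with
  | nil => rfl
  | cons b u ih => exact congrArg (_ :: ·) ih

theorem rightScanner_right {n : ℕ} (q : Scan) (c : ℕ) (v : List Role) (a : Role) (j : Fin (n + 1))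
    (w : List (Sight Role n)) :
    ∃ q' c', (rightScanner n).run q c (v.map (fun b => (b, .right, a, j)) ++ w) =
      (v.zip (scan q c v)).map (fun x => some ((x.1, .right, a, j), x.2)) ++
        (rightScanner n).run q' c' w := by
  induction v generalizing q c with
  | nil => exact ⟨q, c, rfl⟩
  | cons b v ih =>
    obtain ⟨q', c', h⟩ := ih (q.next (decide (0 < c)) b) ((q.op b).app c)
    exact ⟨q', c', congrArg (_ :: ·) h⟩

/-- The state and the counter on entry are irrelevant: letters on the left are copied, and the
chosen letter resets both. So the copies are processed independently. -/
theorem rightScanner_block {n : ℕ} (q : Scan) (c : ℕ) (p : Pick n) (w : List (Sight Role n)) :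
    ∃ q' c', (rightScanner n).run q c (block p.pre p.letter p.tag p.post ++ w) =
      p.marks.map some ++ (rightScanner n).run q' c' w := by
  obtain ⟨q', c', h⟩ := rightScanner_right .init 0 p.post p.letter p.tag w
  refine ⟨q', c', ?_⟩
  rw [block, List.append_assoc, rightScanner_left, Pick.marks]
  simp only [List.map_append, List.map_map, List.map_cons, List.append_assoc, List.cons_append]
  refine congrArg (_ ++ ·) ?_
  exact congrArg (_ :: ·) h

theorem rightScanner_picks {n : ℕ} (q : Scan) (c : ℕ) (ps : List (Pick n)) :
    (rightScanner n).run q c (ps.flatMap fun p => block p.pre p.letter p.tag p.post) =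
      (ps.flatMap fun p => p.marks.map some) ++ [none] := by
  induction ps generalizing q c with
  | nil => rfl
  | cons p ps ih =>
    obtain ⟨q', c', h⟩ := rightScanner_block q c p
      (ps.flatMap fun p => block p.pre p.letter p.tag p.post)
    rw [List.flatMap_cons, h, ih, List.flatMap_cons, List.append_assoc]

/-! ### Writing the polynomial -/

/-- The part of the output that is written for a letter of kind `K` if `a` is the letter at the
chosen position. -/
def emit (k : ℕ) (a : Role) (j : Fin (width k + 1)) (b : Role) (K : Option Kind) : List Sym :=
  if a = .finish ∧ j = 0 then
    [.tick, .tick, .tick] ++ if b = .finish then .sep :: encRat 1 else []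
  else
    (if b = .start then .term :: encInt (monoAt k a j).1 else []) ++
      encNats (List.ofFn fun n => K.elim 0 fun K => (monoAt k a j).2 K n)

/-- The kind of a letter, if the scan to the left has found the base or not. -/
def Mark.kind {n : ℕ} (x : Mark n) (found pos : Bool) : Option Kind :=
  if x.1.2.1 = .left then
    if x.1.1 = .tick ∧ pos = false ∧ found = false then some .base else none
  else x.2.1

/-- The transducer that reads the marks from right to left and writes the polynomial from right to
left. -/
def writer (k : ℕ) : CounterTransducer Bool (Option (Mark (width k))) Sym where
  init := false
  next found pos := fun
    | none => found
    | some x => if x.1.1 = .start then false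
        else if x.1.2.1 = .left then found || (decide (x.1.1 = .tick) && !pos) else found
  op _ _ := fun
    | none => .keep
    | some x => if x.1.1 = .start then .reset
        else if x.1.2.1 = .left then (if x.1.1 = .dimSep ∨ x.1.1 = .tick then .dec else .keep)
        else if x.2.2 then .inc else .keep
  out found pos := fun
    | none => [.endPoly]
    | some x => (emit k x.1.2.2.1 x.1.2.2.2 x.1.1 (x.kind found pos)).reverse
  fin _ := []

theorem writer_cons (k : ℕ) (found : Bool) (c : ℕ) (x : Option (Mark (width k)))
    (w : List (Option (Mark (width k)))) :
    (writer k).run found c (x :: w) = (writer k).out found (decide (0 < c)) x ++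
      (writer k).run ((writer k).next found (decide (0 < c)) x)
        (((writer k).op found (decide (0 < c)) x).app c) w := rfl

/-- Read from right to left, `start` ends a copy of the word. Resetting the flag and the counter
here makes the copies independent. -/
theorem writer_start (k : ℕ) (found : Bool) (c : ℕ) (d : Side) (a : Role) (j : Fin (width k + 1))
    (K : Option Kind) (e : Bool) (w : List (Option (Mark (width k)))) :
    (writer k).run found c (some ((.start, d, a, j), K, e) :: w) =
      (emit k a j .start (if d = .left then none else K)).reverse ++
        (writer k).run false 0 w := by
  rw [writer_cons]
  congr 1

theorem writer_left (k : ℕ) (found : Bool) (c : ℕ) (r : List Role) (hr : Role.start ∉ r) (a : Role)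
    (j : Fin (width k + 1)) (w : List (Option (Mark (width k)))) :
    (writer k).run found c
      ((r ++ [Role.start]).map (fun b => some ((b, .left, a, j), none, false)) ++ w)
      = (List.zipWith (fun b K => (emit k a j b K).reverse) (r ++ [Role.start])
        (leftScan found c (r ++ [Role.start]))).flatten ++ (writer k).run false 0 w := by
  induction r generalizing found c with
  | nil =>
    rw [List.nil_append, List.map_singleton, List.singleton_append, writer_start]
    simp [leftScan]
  | cons b r ih =>
    rw [List.mem_cons, not_or] at hr
    have h₁ := Ne.symm hr.1
    simp only [List.cons_append, List.map_cons, writer_cons, leftScan,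
      List.zipWith_cons_cons, List.flatten_cons, List.append_assoc]
    rw [← ih _ _ hr.2]
    congr 1
    · simp [writer, Mark.kind]
    · simp only [writer, h₁, if_true, if_false]
      congr 1
      split_ifs <;> rfl

/-- On the right of the chosen position the counter collects the marked ends of exponents; its final
value is where the search for the base on the left begins. -/
theorem writer_right (k : ℕ) (c : ℕ) (l : List (Role × Option Kind × Bool))
    (hl : ∀ x ∈ l, x.1 ≠ .start) (a : Role) (j : Fin (width k + 1))
    (w : List (Option (Mark (width k)))) :
    (writer k).run false c (l.map (fun x => some ((x.1, .right, a, j), x.2)) ++ w) =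
      (l.map fun x => (emit k a j x.1 x.2.1).reverse).flatten ++
        (writer k).run false (c + l.countP fun x => x.2.2) w := by
  induction l generalizing c with
  | nil => rfl
  | cons x l ih =>
    rw [List.forall_mem_cons] at hl
    simp only [List.cons_append, List.map_cons, writer_cons, List.flatten_cons,
      List.append_assoc]
    have h := ih (((writer k).op false (decide (0 < c)) (some ((x.1, .right, a, j), x.2))).app c)
      hl.2
    have hn : (writer k).next false (decide (0 < c)) (some ((x.1, .right, a, j), x.2)) = false := by
      simp [writer]
    have ho : ((writer k).op false (decide (0 < c)) (some ((x.1, .right, a, j), x.2))).app c +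
        (l.countP fun x => x.2.2) = c + (x :: l).countP fun x => x.2.2 := by
      rw [List.countP_cons]
      rcases x with ⟨b, K, _ | _⟩
      · simp [writer, hl.1, CounterOp.app]
      · simp only [writer, hl.1, CounterOp.app, if_false, reduceCtorEq, if_true]; ring
    rw [hn, h, ho]
    rfl

/-- The part of the output that is written for a word with a chosen position. -/
def Pick.word (k : ℕ) (p : Pick (width k)) : List Sym :=
  (List.zipWith (emit k p.letter p.tag) (p.pre ++ p.letter :: p.post)
    (kinds p.pre p.post)).flatten

end ContinuousClustering

/-! ### Correctness of the written word and polynomial time of the reduction -/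

namespace ContinuousClustering

open Turing Turing.Spread

theorem reverse_flatten_zipWith {α β γ : Type*} (f : α → β → List γ) (l : List α) (l' : List β)
    (h : l.length = l'.length) : (List.zipWith f l l').flatten.reverse =
      (List.zipWith (fun a b => (f a b).reverse) l.reverse l'.reverse).flatten := by
  rw [List.reverse_flatten, List.map_zipWith, List.reverse_zipWith h]

theorem writer_pick (k : ℕ) (p : Pick (width k)) (w : List Role)
    (hp : p.pre ++ p.letter :: p.post = .start :: w) (hw : Role.start ∉ w)
    (w' : List (Option (Mark (width k)))) :
    (writer k).run false 0 ((p.marks.map some).reverse ++ w') =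
      (p.word k).reverse ++ (writer k).run false 0 w' := by
  rcases p with ⟨u, a, j, v⟩
  have hv : Role.start ∉ v := fun h => by
    rcases u with _ | ⟨b, u⟩
    · simp only [List.nil_append, List.cons.injEq] at hp
      exact hw (hp.2 ▸ h)
    · simp only [List.cons_append, List.cons.injEq] at hp
      exact hw (hp.2 ▸ by simp [h])
  have hright := writer_right k 0 (v.zip (scan .init 0 v)).reverse (fun x hx h => hv <| by
    rw [List.mem_reverse] at hx
    exact h ▸ (List.of_mem_zip (a := x.1) (b := x.2) hx).1) a j
  have hcount : 0 + ((v.zip (scan .init 0 v)).reverse.countP fun x => x.2.2) = expCount v := by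
    rw [zero_add, List.countP_reverse, expCount]
    conv_rhs => rw [← List.map_snd_zip (l₁ := v) (l₂ := scan .init 0 v) (by rw [length_scan])]
    rw [List.countP_map]
    rfl
  rw [hcount] at hright
  have hemit : (((v.zip (scan .init 0 v)).reverse.map fun x => (emit k a j x.1 x.2.1).reverse)
      ).flatten = (List.zipWith (emit k a j) v ((scan .init 0 v).map fun x => x.1)
      ).flatten.reverse := by
    rw [List.zipWith_map_right, List.reverse_flatten, List.map_zipWith, List.map_reverse,
      List.zip, List.map_zipWith]
  rw [hemit] at hright
  have hself : Pick.word k ⟨u, a, j, v⟩ = (List.zipWith (emit k a j) u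
      (leftScan false (expCount v) u.reverse).reverse).flatten ++ (emit k a j a (some .self) ++
        (List.zipWith (emit k a j) v ((scan .init 0 v).map fun x => x.1)).flatten) := by
    rw [Pick.word, kinds, List.zipWith_append (by simp [length_leftScan]), List.flatten_append,
      List.zipWith_cons_cons, List.flatten_cons]
  have hmarks : ((Pick.marks ⟨u, a, j, v⟩).map some).reverse ++ w' =
      (v.zip (scan .init 0 v)).reverse.map (fun x => some ((x.1, .right, a, j), x.2)) ++
        (some ((a, .self, a, j), some .self, false) ::
          (u.reverse.map (fun b => some ((b, .left, a, j), none, false)) ++ w')) := by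
    simp [Pick.marks, Function.comp_def]
  rw [hmarks, hright, hself, List.reverse_append, List.reverse_append, List.append_assoc,
    List.append_assoc]
  congr 1
  -- If nothing precedes the chosen position, the chosen letter is `start` itself and ends the copy;
  -- otherwise `start` is the last letter of the scan to the left.
  rcases u with _ | ⟨b, u⟩
  · simp only [List.nil_append, List.cons.injEq] at hp
    obtain ⟨rfl, rfl⟩ := hp
    rw [writer_start]
    simp
  · simp only [List.cons_append, List.cons.injEq] at hp
    obtain ⟨rfl, rfl⟩ := hp
    have ha : a ≠ .start := fun h => hw (by simp [h])
    have hu : Role.start ∉ u.reverse := fun h => hw (by simp [List.mem_reverse.1 h])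
    have hn : (writer k).next false (decide (0 < expCount v))
        (some ((a, .self, a, j), some .self, false)) = false := by simp [writer]
    have ho : ((writer k).op false (decide (0 < expCount v))
        (some ((a, .self, a, j), some .self, false))).app (expCount v) = expCount v := by
      simp [writer, ha, CounterOp.app]
    rw [writer_cons, hn, ho, List.reverse_cons, writer_left k false _ _ hu,
      reverse_flatten_zipWith _ _ _ (by simp [length_leftScan]), List.reverse_cons,
      List.reverse_reverse]
    rfl

theorem writer_picks (k : ℕ) (ps : List (Pick (width k))) (w : List Role)
    (hp : ∀ p ∈ ps, p.pre ++ p.letter :: p.post = .start :: w) (hw : Role.start ∉ w)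
    (w' : List (Option (Mark (width k)))) :
    (writer k).run false 0 ((ps.flatMap fun p => p.marks.map some).reverse ++ w') =
      (ps.flatMap (Pick.word k)).reverse ++ (writer k).run false 0 w' := by
  induction ps generalizing w' with
  | nil => rfl
  | cons p ps ih =>
    rw [List.forall_mem_cons] at hp
    rw [List.flatMap_cons, List.flatMap_cons, List.reverse_append, List.reverse_append,
      List.append_assoc, ih hp.2, writer_pick k p w hp.1 hw, List.append_assoc]

/-- In the first copy each letter stands for its three variables and emits three ticks; the closing
`finish` adds the separator and the threshold 1. -/
theorem word_head (k : ℕ) (w : List Role) (hw : Role.finish ∉ w) :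
    Pick.word k ⟨w, .finish, 0, []⟩ = encDim ((w.length + 1) * 3) ++ encRat 1 := by
  have h : ∀ (w : List Role) (ks : List (Option Kind)), Role.finish ∉ w → ks.length = w.length →
      (List.zipWith (emit k .finish 0) w ks).flatten = List.replicate (w.length * 3) .tick := by
    intro w ks hw h
    induction w generalizing ks with
    | nil => simp
    | cons b w ih =>
      rw [List.mem_cons, not_or] at hw
      cases ks with
      | nil => simp at h
      | cons K ks =>
        rw [List.zipWith_cons_cons, List.flatten_cons, ih ks hw.2 (by simpa using h),
          List.length_cons, Nat.succ_mul, Nat.add_comm _ 3, List.replicate_add]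
        simp [emit, Ne.symm hw.1, List.replicate]
  rw [Pick.word, kinds, List.zipWith_append (by simp [length_leftScan]), List.flatten_append,
    h _ _ hw (by simp [length_leftScan]), encDim, Nat.succ_mul, List.replicate_add]
  simp [emit, List.replicate]

theorem ofFn_exponents (ks : List (Option Kind)) (L : ℕ) (hL : ks.length = L)
    (E : Kind → Fin 3 → ℕ) : List.ofFn (exponents L ks E) =
      (ks.map fun K => List.ofFn fun n => K.elim 0 fun K => E K n).flatten := by
  subst hL
  rw [List.ofFn_mul]
  congr 1
  refine List.ext_getElem (by simp) fun i h₁ h₂ => ?_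
  have hi : i < ks.length := by simpa using h₁
  simp only [List.getElem_ofFn, List.getElem_map]
  congr 1
  funext n
  have h : finProdFinEquiv.symm (⟨i * 3 + n, by omega⟩ : Fin (ks.length * 3)) = (⟨i, hi⟩, n) := by
    rw [Equiv.symm_apply_eq]
    ext
    simp [finProdFinEquiv]
    ring
  simp only [exponents, h]
  simp [hi]

theorem encNats_flatten (l : List (List ℕ)) : encNats l.flatten = (l.map encNats).flatten := by
  induction l with
  | nil => rfl
  | cons a l ih => simp [encNats, ← ih]

/-- `start` emits the term symbol and the coefficient, and every letter then emits the exponents of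
its three registers; position after position this is the full vector of exponents. -/
theorem word_tail (k : ℕ) (p : Pick (width k)) (w : List Role)
    (hp : p.pre ++ p.letter :: p.post = .start :: w) (hw : Role.start ∉ w)
    (h : ¬ (p.letter = .finish ∧ p.tag = 0)) :
    p.word k = .term :: encTerm (p.term k (w.length + 1)) := by
  have hk : (kinds p.pre p.post).length = w.length + 1 := by
    rw [length_kinds _ _ p.letter, hp, List.length_cons]
  rw [Pick.word, hp, encTerm, Pick.term, ofFn_exponents _ _ hk, encNats_flatten]
  generalize kinds p.pre p.post = ks at hk
  cases ks with
  | nil => simp at hk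
  | cons K ks =>
    have hk' : ks.length = w.length := by simpa using hk
    have hz : List.zipWith (emit k p.letter p.tag) w ks = ks.map fun K =>
        encNats (List.ofFn fun n => K.elim 0 fun K => (monoAt k p.letter p.tag).2 K n) := by
      clear hk hp
      induction w generalizing ks with
      | nil => simp [List.length_eq_zero_iff.1 hk']
      | cons b w ih =>
        rw [List.mem_cons, not_or] at hw
        cases ks with
        | nil => simp at hk'
        | cons K ks =>
          rw [List.zipWith_cons_cons, ih hw.2 ks (by simpa using hk'), List.map_cons]
          simp [emit, h, Ne.symm hw.1]
    rw [List.zipWith_cons_cons, hz, List.flatten_cons]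
    simp [emit, h, Function.comp_def]

/-- Both reversals produced by output stacks are put to use: the first lets the writer read the
marks from right to left, the second puts what it writes into the right order. -/
theorem polyTime_reduction (k : ℕ) : PolyTime encSentence encLevel (reduction k) := by
  have : Inhabited Sym := ⟨.tick⟩
  have h := ((writer k).polyTime_reverse.comp (rightScanner (width k)).polyTime_reverse).comp
    ((Spread.polyTime (α := Role) (width k)).comp annotator.polyTime)
  refine PolyTime.of_words h fun s => ?_
  obtain ⟨w, hw, hstart, hfinish⟩ := exists_roleWord_eq s
  obtain ⟨ps, hps, hps'⟩ := picks_append_singleton (width k) [] (Role.start :: w) .finish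
  have hmem : ∀ p ∈ picks (width k) [] (roleWord s), p.pre ++ p.letter :: p.post =
      .start :: (w ++ [.finish]) := fun p hp => by
    rw [pre_append_of_mem_picks hp, hw]; rfl
  have hs : Role.start ∉ w ++ [Role.finish] := by simp [hstart]
  have ha : annotator.run annotator.init 0 (encSentence s) = roleWord s := annotate_sentence s
  simp only [Function.comp_apply]
  rw [ha, spread_eq, rightScanner_picks, List.reverse_append, List.reverse_singleton,
    List.singleton_append, writer_cons]
  have hpicks := writer_picks k _ _ hmem hs []
  rw [List.append_nil] at hpicks
  -- The end marker `none` is read first and emits `endPoly`, which the final reversal moves to the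
  -- end; it leaves flag and counter as they were.
  have hrun : (writer k).run ((writer k).next (writer k).init (decide (0 < 0)) none)
      (((writer k).op (writer k).init (decide (0 < 0)) none).app 0)
      ((picks (width k) [] (roleWord s)).flatMap fun p => p.marks.map some).reverse =
      ((picks (width k) [] (roleWord s)).flatMap (Pick.word k)).reverse ++ [] := hpicks
  rw [hrun, List.append_nil, List.reverse_append, List.reverse_reverse, encLevel, reduction]
  have hlen : (roleWord s).length = w.length + 1 + 1 := by rw [hw]; simp
  rw [← hw] at hps
  simp only [hlen, hps, List.tail_cons, List.flatMap_cons, encPoly, List.nil_append]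
  rw [word_head k _ (by simp [hfinish]), List.length_cons]
  simp only [List.append_assoc]
  refine congrArg (fun l => encDim _ ++ (encRat 1 ++ (l ++ [Sym.endPoly]))) ?_
  rw [List.flatMap_map]
  refine List.flatMap_congr fun p hp => ?_
  have := word_tail k p _ (hmem p (hps ▸ List.mem_cons_of_mem _ hp)) hs fun h => by
    simpa [hfinish] using hps' p hp h.1 h.2
  have hL : (w ++ [Role.finish]).length + 1 = (roleWord s).length := by rw [hw]; simp
  rwa [hL] at this

end ContinuousClustering

/-! ### Hardness for every k ≥ 1 and the final statement -/

namespace ContinuousClustering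

theorem existsRHard_CLSC {k : ℕ} (hk : 1 ≤ k) : ExistsRHard (CLSC k) := by
  rintro A ⟨f, hf, h⟩
  exact ⟨reduction k ∘ f, Turing.PolyTime.comp (polyTime_reduction k) hf, fun a =>
    (h a).trans (reduction_correct hk (f a))⟩

end ContinuousClustering

theorem mainTheorem3 (k : ℕ) (hk : 2 ≤ k) :
    ContinuousClustering.ExistsRHard (ContinuousClustering.CLSC k) ∧
    ∀ (m : ℕ) (r : MvPolynomial (Fin m) ℤ),
      -- the two-sheet polynomial
      (ContinuousClustering.superLevel (ContinuousClustering.twoSheet r) 1 =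
          ContinuousClustering.sheets r ∧
        (2 ≤ ContinuousClustering.numComponents
            (ContinuousClustering.superLevel (ContinuousClustering.twoSheet r) 1) ↔
          (ContinuousClustering.realZeros r).Nonempty)) ∧
      -- its `k - 1` independent copies
      (ContinuousClustering.superLevel (ContinuousClustering.twoSheetCopies (k - 1) r) 1 =
          {x | ∀ i : Fin (k - 1), (fun v => x (i, v)) ∈ ContinuousClustering.sheets r} ∧
        ((ContinuousClustering.realZeros r).Nonempty →
          ((2 ^ (k - 1) : ℕ) : ℕ∞) ≤ ContinuousClustering.numComponents
            (ContinuousClustering.superLevel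
              (ContinuousClustering.twoSheetCopies (k - 1) r) 1)) ∧
        ((k : ℕ∞) ≤ ContinuousClustering.numComponents
            (ContinuousClustering.superLevel
              (ContinuousClustering.twoSheetCopies (k - 1) r) 1) ↔
          (ContinuousClustering.realZeros r).Nonempty)) := by
  refine ⟨ContinuousClustering.existsRHard_CLSC (by omega), fun m r => ?_⟩
  rw [ContinuousClustering.superLevel_twoSheet, ContinuousClustering.superLevel_twoSheetCopies]
  exact ⟨⟨rfl, ContinuousClustering.two_le_numComponents_sheets_iff r⟩, rfl,
    ContinuousClustering.two_pow_le_numComponents_copies r (k - 1),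
    ContinuousClustering.le_numComponents_copies_iff r hk⟩
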